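/- \textbf{Groups.} For $\omega=\omega_0\omega_1\omega_2\dots\in\{0,1,2\}^{\mathbb N}$ let $\sigma\omega=\omega_1\omega_2\dots$ and let $G_\omega=\langle a,b_\omega,c_\omega,d_\omega\rangle$ be the group of automorphisms of the binary rooted tree $T$ in which $a$ exchanges the two subtrees below the root and, for $v\in\{b,c,d\}$, $v_\omega=(u^v(\omega_0),v_{\sigma\omega})$ fixes the first level and acts on the subtrees below the vertices $0$ and $1$ by $u^v(\omega_0)$ and $v_{\sigma\omega}$. Here $u^b(2)=u^c(1)=u^d(0)=\mathrm{id}$ and all other values of $u^b,u^c,u^d$ are $a$. Fix a finite group $F\ne 1$. Let $X$ be the orbit of the ray $\rho=1^\infty\in\partial T$ under $G_\omega$, and let $\Gamma_\omega=F\wr_X G_\omega$ be the permutational wreath product, i.e. the semidirect product of the group of finitely supported functions $X\to F$ with $G_\omega$. For a finite symmetric generating set $S\ni 1$ of a group $\Gamma$ put $b(r)=b_{\Gamma,S}(r)=|S^r|$. \textbf{Pseudo-periods.} For $b:\mathbb N\to\mathbb N$ and $\alpha'<\beta'$ let $$L=\Big\{t\ge 2:\tfrac{\log\log b(t)}{\log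 t}\le\alpha'\Big\},\qquad U=\Big\{s\ge 2:\tfrac{\log\log b(s)}{\log s}\ge\beta'\Big\}.$$ If both are infinite, $L\sqcup U$ splits, in increasing order, into finite blocks $\dots,U_i,L_i,U_{i+1},L_{i+1},\dots$ contained alternately in $U$ and in $L$. Let $u_{\alpha',\beta'}\in[0,\infty]$ be the infimum of the $\nu\geq 0$ such that $\min U_{i+1}\le(\max L_i)^\nu$ for all large $i$, and let $l_{\alpha',\beta'}\in[0,\infty]$ be the infimum of the $\nu\geq 0$ such that $\min L_i\le(\max U_i)^\nu$ for all large $i$. The upper and lower pseudo-period exponents of $b$ are the limits $$u(\alpha,\beta)=\lim_{\alpha'\to\alpha^+,\ \beta'\to\beta^-}u_{\alpha',\beta'},\qquad l(\alpha,\beta)=\lim_{\alpha'\to\alpha^+,\ \beta'\to\beta^-}l_{\alpha',\beta'}$$ in $[0,\infty]$, when they exist. \textbf{Statement.} Let $\eta\approx 0.8105$ be the real root of $X^3+X^2+X-2$ and $\alpha_0=\frac{\log 2}{\log 2-\log\eta}$. There are sequences $\omega(\zeta)\in\{0,1,2\}^{\mathbb N}$, $\zeta\in[\alpha_0,1]$,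 such that $\lim_{r\to\infty}\frac{\log\log b_{\Gamma_{\omega(\zeta)},S}(r)}{\log r}=\zeta$ for every finite symmetric generating set $S\ni1$ of $\Gamma_{\omega(\zeta)}$, with the following property. For all $\alpha_0\le\delta\le\alpha<\beta\le\gamma\le1$ there are integers $0\le m_1<n_1<m_2<n_2<\cdots$ such that, for the spliced sequence $$\omega=\omega(\delta)|_{0\dots m_1}\,\omega(\gamma)|_{m_1+1\dots n_1}\,\omega(\delta)|_{n_1+1\dots m_2}\,\omega(\gamma)|_{m_2+1\dots n_2}\cdots,$$ the finitely generated group $\Gamma_\omega$ has the following properties, for every finite symmetric generating set $S\ni 1$: for all $\alpha<\alpha'<\beta'<\beta$ the sets $L$ and $U$ of $b_{\Gamma_\omega,S}$ are infinite; the limits $u(\alpha,\beta)$ and $l(\alpha,\beta)$ exist and do not depend on $S$; and $$u(\alpha,\beta)\le\frac1{\gamma-\beta},\qquad l(\alpha,\beta)\le\frac1{\alpha-\delta},$$ where $\frac10=\infty$. -/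

import Mathlib

open Filter Topology
open scoped NNReal ENNReal Pointwise

/-! ### The groups acting on the binary rooted tree -/

/-- The boundary of the binary rooted tree `T`: infinite rays, coded by their successive turns,
with `false` for the child `0` and `true` for the child `1`. An automorphism of `T` is determined
by its action on the boundary, so automorphisms are written as permutations of the boundary. -/
abbrev Ray : Type := ℕ → Bool

/-- The ray `x₁x₂x₃…` seen from the first vertex of `x₀x₁x₂…`. -/
def Ray.tail (x : Ray) : Ray := fun n => x (n + 1)

/-- The shift `σω = ω₁ω₂ω₃…` of a sequence `ω = ω₀ω₁ω₂…`. -/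
def shiftSeq (ω : ℕ → Fin 3) : ℕ → Fin 3 := fun n => ω (n + 1)

/-- The action of `a = (1,1)ε`: exchange the two children of the root. -/
def rootFun (x : Ray) : Ray
  | 0 => !(x 0)
  | n + 1 => x (n + 1)

/-- The labels `b`, `c`, `d` of the three other generators. -/
inductive KleinGen : Type
  | b
  | c
  | d

/-- `switches v i = true` if `u^v(i) = a`, and `switches v i = false` if `u^v(i) = id`. -/
def switches : KleinGen → Fin 3 → Bool
  | .b, 0 => true
  | .b, 1 => true
  | .b, 2 => false
  | .c, 0 => true
  | .c, 1 => false
  | .c, 2 => true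
  | .d, 0 => false
  | .d, 1 => true
  | .d, 2 => true

/-- The action of `v_ω = (u^v(ω₀), v_{σω})` on rays, for `v` one of `b, c, d`: the root is not
permuted, `u^v(ω₀)` acts below the child `0` and `v_{σω}` acts below the child `1`. -/
def directedFun (v : KleinGen) : (ℕ → Fin 3) → Ray → Ray
  | _, x, 0 => x 0
  | ω, x, n + 1 =>
      if x 0 = false then
        (if switches v (ω 0) = true then rootFun x.tail n else x.tail n)
      else directedFun v (shiftSeq ω) x.tail n

theorem rootFun_involutive : Function.Involutive rootFun := by
  intro x
  funext n
  cases n <;> simp [rootFun]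

theorem directedFun_involutive (v : KleinGen) (ω : ℕ → Fin 3) :
    Function.Involutive (directedFun v ω) := by
  intro x
  funext n
  induction n generalizing ω x with
  | zero => rfl
  | succ n ih =>
    have h0 : directedFun v ω x 0 = x 0 := rfl
    by_cases hx : x 0 = false
    · by_cases hs : switches v (ω 0) = true
      · have ht : (directedFun v ω x).tail = rootFun x.tail := by
          funext k
          simp [Ray.tail, directedFun, hx, hs]
        have := congrFun (rootFun_involutive x.tail) n
        rw [directedFun, h0, if_pos hx, if_pos hs, ht, this]
        rfl
      · simp [directedFun, Ray.tail, hx, hs]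
    · have ht : (directedFun v ω x).tail = directedFun v (shiftSeq ω) x.tail := by
        funext k
        simp [Ray.tail, directedFun, hx]
      rw [directedFun, h0, if_neg hx, ht, ih]
      rfl

/-- The generator `a`. -/
def rootGen : Equiv.Perm Ray := rootFun_involutive.toPerm

/-- The generators `b_ω`, `c_ω`, `d_ω`. -/
def directedGen (v : KleinGen) (ω : ℕ → Fin 3) : Equiv.Perm Ray :=
  (directedFun_involutive v ω).toPerm

/-- The group `G_ω = ⟨a, b_ω, c_ω, d_ω⟩`. -/
def treeGroup (ω : ℕ → Fin 3) : Subgroup (Equiv.Perm Ray) :=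
  Subgroup.closure
    {rootGen, directedGen .b ω, directedGen .c ω, directedGen .d ω}

/-! ### Permutational wreath products -/

/-- The group of finitely supported functions `X → F`, with pointwise multiplication. -/
def finSuppFun (X F : Type*) [Group F] : Subgroup (X → F) where
  carrier := {φ | (Function.mulSupport φ).Finite}
  one_mem' := by simp
  mul_mem' {φ ψ} hφ hψ :=
    (Set.Finite.union hφ hψ).subset (Function.mulSupport_mul φ ψ)
  inv_mem' {φ} hφ := by
    have h : Function.mulSupport φ⁻¹ = Function.mulSupport φ := Function.mulSupport_inv φ
    simpa [h] using hφ

theorem lampShift_mem {G X F : Type*} [Group G] [MulAction G X] [Group F] (g : G)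
    {φ : X → F} (hφ : φ ∈ finSuppFun X F) :
    (fun x => φ (g⁻¹ • x)) ∈ finSuppFun X F := by
  have h : (Function.mulSupport φ).Finite := hφ
  refine (h.image (fun x => g • x)).subset ?_
  intro x hx
  exact ⟨g⁻¹ • x, hx, by simp⟩

/-- `G` acts on finitely supported functions by `(g · φ)(x) = φ(g⁻¹ • x)`, that is `φ(x g)` when
the action on `X` is written on the right (`x g = g⁻¹ • x`). -/
def lampShift (G X F : Type*) [Group G] [MulAction G X] [Group F] :
    G →* MulAut (finSuppFun X F) where
  toFun g :=
    { toFun := fun φ => ⟨fun x => φ.1 (g⁻¹ • x), lampShift_mem g φ.2⟩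
      invFun := fun φ => ⟨fun x => φ.1 (g • x), by
        simpa using lampShift_mem g⁻¹ φ.2⟩
      left_inv := fun φ => by ext x; simp
      right_inv := fun φ => by ext x; simp
      map_mul' := fun φ ψ => by ext x; simp }
  map_one' := by ext φ x; simp
  map_mul' g h := by ext φ x; simp [mul_smul]

/-- The permutational wreath product `F ≀_X G`. -/
abbrev PermWreath (F G X : Type*) [Group F] [Group G] [MulAction G X] : Type _ :=
  finSuppFun X F ⋊[lampShift G X F] G

/-- The rightmost ray `ρ = 1^∞`. -/
def rightRay : Ray := fun _ => true

/-- The group `Γ_ω = F ≀_X G_ω`, where `X` is the orbit of `ρ` under `G_ω`. -/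
abbrev GammaGroup (F : Type*) [Group F] (ω : ℕ → Fin 3) : Type _ :=
  PermWreath F (treeGroup ω) (MulAction.orbit (treeGroup ω) rightRay)

/-! ### Growth -/

/-- `S` is a finite symmetric generating set that contains the identity. -/
structure IsGeneratingSet {G : Type*} [Group G] (S : Set G) : Prop where
  finite : S.Finite
  one_mem : 1 ∈ S
  symm : S⁻¹ = S
  generates : Subgroup.closure S = ⊤

/-- The growth function `b_{G,S}(r) = |S^r|`. -/
noncomputable def growth {G : Type*} [Group G] (S : Set G) (r : ℕ) : ℕ := (S ^ r).ncard

/-- The finitely generated group `G` has logarithmic growth exponent `ζ`, that is,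
`log log b_G(r) / log r` tends to `ζ`. -/
def HasLogGrowthExponent (G : Type*) [Group G] (ζ : ℝ) : Prop :=
  Group.FG G ∧ ∀ S : Set G, IsGeneratingSet S →
    Tendsto (fun r : ℕ => Real.log (Real.log (growth S r)) / Real.log r) atTop (𝓝 ζ)

/-! ### Pseudo-periods of oscillation -/

/-- The upper set of `b` at `β`. (The radii `0` and `1`, where the quotient has no meaning, are
left out.) -/
def upperRadii (b : ℕ → ℕ) (β : ℝ) : Set ℕ :=
  {s | 2 ≤ s ∧ β ≤ Real.log (Real.log (b s)) / Real.log s}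

/-- The lower set of `b` at `α`. -/
def lowerRadii (b : ℕ → ℕ) (α : ℝ) : Set ℕ :=
  {t | 2 ≤ t ∧ Real.log (Real.log (b t)) / Real.log t ≤ α}

/-- `x` is in `A`, `y` is the next element of `A ∪ B` after `x`, and `y` is in `B`: in the
decomposition of `A ∪ B` into alternating blocks, `x` is the maximum of a block of `A` and `y` is
the minimum of the following block of `B`. -/
structure IsPassage (A B : Set ℕ) (x y : ℕ) : Prop where
  left_mem : x ∈ A
  right_mem : y ∈ B
  lt : x < y
  between : ∀ z, x < z → z < y → z ∉ A ∪ B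

/-- The infimum of the exponents `ν` such that `y ≤ x ^ ν` for all but finitely many passages
`(x, y)` from `A` to `B`; it is infinite if there is no such `ν`. -/
noncomputable def passageExponent (A B : Set ℕ) : ℝ≥0∞ :=
  ⨅ (ν : ℝ≥0) (_ : ∃ N : ℕ, ∀ x y : ℕ, N ≤ x → IsPassage A B x y →
    (y : ℝ) ≤ (x : ℝ) ^ (ν : ℝ)), (ν : ℝ≥0∞)

/-- `u_{α,β}`: passages from the last radius of a lower block to the first radius of the next
upper block. -/
noncomputable def upperPseudoPeriod (b : ℕ → ℕ) (α β : ℝ) : ℝ≥0∞ :=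
  passageExponent (lowerRadii b α) (upperRadii b β)

/-- `l_{α,β}`: passages from the last radius of an upper block to the first radius of the next
lower block. -/
noncomputable def lowerPseudoPeriod (b : ℕ → ℕ) (α β : ℝ) : ℝ≥0∞ :=
  passageExponent (upperRadii b β) (lowerRadii b α)

/-- For all `α < α' < β' < β` the lower set at `α'` and the upper set at `β'` are infinite, so
that the blocks go on forever and the pseudo-periods at `(α', β')` are meaningful. -/
def OscillatesBetween (b : ℕ → ℕ) (α β : ℝ) : Prop :=
  ∀ α' β' : ℝ, α < α' → α' < β' → β' < β →
    (lowerRadii b α').Infinite ∧ (upperRadii b β').Infinite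

/-- The growth functions of the finitely generated group `G` oscillate between `α` and `β`, and
`u` is the upper pseudo-period exponent `u(α,β)` of `G` and `l` its lower pseudo-period exponent
`l(α,β)`: the limits of `u_{α',β'}` and of `l_{α',β'}` as `α' → α⁺` and `β' → β⁻`. -/
def HasPseudoPeriodExponents (G : Type*) [Group G] (α β : ℝ) (u l : ℝ≥0∞) : Prop :=
  Group.FG G ∧ ∀ S : Set G, IsGeneratingSet S →
    OscillatesBetween (growth S) α β ∧
    Tendsto (fun p : ℝ × ℝ => upperPseudoPeriod (growth S) p.1 p.2) (𝓝[>] α ×ˢ 𝓝[<] β) (𝓝 u) ∧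
    Tendsto (fun p : ℝ × ℝ => lowerPseudoPeriod (growth S) p.1 p.2) (𝓝[>] α ×ˢ 𝓝[<] β) (𝓝 l)

/-! ### Spliced sequences -/

open Classical in
/-- For `m₀ < n₀ < m₁ < n₁ < …`, the sequence which is `p` on `0 … m₀`, `q` on `m₀+1 … n₀`, `p` on
`n₀+1 … m₁`, `q` on `m₁+1 … n₁`, and so on. -/
noncomputable def splice (p q : ℕ → Fin 3) (m n : ℕ → ℕ) : ℕ → Fin 3 := fun k =>
  if ∃ i, m i < k ∧ k ≤ n i then q k else p k

/-! The proof rests on a two-sided estimate of the growth, level by level. Start with three weights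
`1` and let the letter `i = ω k` replace the weight `l i` by half of the sum of the weights. As long
as the weights stay comparable to each other, `log b(r)` is `2 ^ k` up to a constant factor when `r`
is about `2 ^ k` times the total weight at level `k`.

Upper bound: words carry weights such that the two sections of an element of weight `t` have total
weight at most `A + t` for the next weights. Hence `Z = ∑ exp (-c ‖g‖)` satisfies `Z ≤ 2 exp (c A)
Z' ^ 2`. Going down `k` levels, with `c` chosen so that the last sum is bounded, gives
`log_ncard_generators_pow_le`. Lower bound: a substitution whose transpose is the recursion of the
weights lifts words through the levels and doubles the inverted orbit of `ρ`. Lamps can be set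
independently along this orbit, which gives `two_pow_le_ncard_generators_pow`.

In the coordinates `(log r, log log b(r))` the growth is therefore the graph of `k log 2` against
`logRadius ω k`, up to a bounded error, which also absorbs the choice of `S`. Sequences of blocks
`012` and `222` keep the weights within a factor `20` of each other (`IsBlockSeq.total_le`).
Repeated blocks `012` make the weights grow by `η⁻³` per block and repeated blocks `222` keep them
bounded, so a greedy mixture realizes every slope `ζ ∈ [α₀, 1]` (`hasRate_rateSeq`). The steps are
positive linear maps, so the slope along a stretch does not depend on what precedes it, up to a
bounded error (`abs_log_total_sub_le`).

Splicing switches to slope `γ` when the ratio of the coordinates is nearly `α`, and to slope `δ`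
when it is nearly `β` (`exists_splice`, `exists_isZigzag`). The line of slope `c` through `(x, y)`
has ratio `e` at the abscissa `(c x - y) / (c - e)`, so a passage from `α'` to `β'` multiplies `log
r` by `(γ - α') / (γ - β')`, up to a bounded error. In the limit `u = (γ - α) / (γ - β)`, and
symmetrically `l = (β - δ) / (α - δ)`; both numerators are at most `1`. -/

set_option linter.unusedSectionVars false

/-! ### Rays and their first vertex -/

/-- The ray which starts with the child `b` of the root and continues along `x`. -/
def consRay (b : Bool) (x : Ray) : Ray
  | 0 => b
  | n + 1 => x n

@[simp] theorem consRay_zero (b : Bool) (x : Ray) : consRay b x 0 = b := rfl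

@[simp] theorem tail_consRay (b : Bool) (x : Ray) : (consRay b x).tail = x := rfl

@[simp] theorem consRay_head_tail (x : Ray) : consRay (x 0) x.tail = x := by
  funext n; cases n <;> rfl

theorem consRay_injective (b : Bool) : Function.Injective (consRay b) := fun x y h => by
  rw [← tail_consRay b x, h, tail_consRay]

theorem exists_consRay (x : Ray) : ∃ b y, x = consRay b y :=
  ⟨x 0, x.tail, (consRay_head_tail x).symm⟩

@[simp] theorem rootGen_consRay (b : Bool) (x : Ray) :
    rootGen (consRay b x) = consRay (!b) x := by
  funext n; cases n <;> rfl

@[simp] theorem directedGen_consRay_true (v : KleinGen) (ω : ℕ → Fin 3) (x : Ray) :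
    directedGen v ω (consRay true x) = consRay true (directedGen v (shiftSeq ω) x) := by
  funext n; cases n
  · rfl
  · change directedFun v ω (consRay true x) (_ + 1) = directedFun v (shiftSeq ω) x _
    simp [directedFun]

/-- The permutation `u^v(i)`. -/
def switchGen (v : KleinGen) (i : Fin 3) : Equiv.Perm Ray :=
  if switches v i = true then rootGen else 1

@[simp] theorem directedGen_consRay_false (v : KleinGen) (ω : ℕ → Fin 3) (x : Ray) :
    directedGen v ω (consRay false x) = consRay false (switchGen v (ω 0) x) := by
  funext n; cases n
  · rfl
  · change directedFun v ω (consRay false x) (_ + 1) = switchGen v (ω 0) x _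
    simp only [directedFun, consRay_zero, tail_consRay, switchGen]
    split_ifs <;> simp_all [rootGen]

theorem rightRay_eq_consRay : rightRay = consRay true rightRay := by
  funext n; cases n <;> rfl

@[simp] theorem consRay_false_ne_rightRay (x : Ray) : consRay false x ≠ rightRay := fun h => by
  have := congrFun h 0
  simp [rightRay] at this

@[simp] theorem consRay_true_eq_rightRay (x : Ray) : consRay true x = rightRay ↔ x = rightRay := by
  constructor
  · intro h
    rw [rightRay_eq_consRay] at h
    exact consRay_injective _ h
  · rintro rfl
    exact rightRay_eq_consRay.symm

@[simp] theorem directedGen_rightRay (v : KleinGen) (ω : ℕ → Fin 3) :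
    directedGen v ω rightRay = rightRay := by
  funext n
  induction n generalizing ω with
  | zero => rfl
  | succ n ih =>
    rw [rightRay_eq_consRay, directedGen_consRay_true]
    exact ih _

@[simp] theorem rootGen_mul_self : rootGen * rootGen = 1 :=
  Equiv.ext fun x => rootFun_involutive x

@[simp] theorem rootGen_rootGen (x : Ray) : rootGen (rootGen x) = x := rootFun_involutive x

@[simp] theorem directedGen_mul_self (v : KleinGen) (ω : ℕ → Fin 3) :
    directedGen v ω * directedGen v ω = 1 :=
  Equiv.ext fun x => directedFun_involutive v ω x

/-- The generators `b`, `c`, `d` with an identity element. -/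
def directedOpt (v : Option KleinGen) (ω : ℕ → Fin 3) : Equiv.Perm Ray :=
  v.elim 1 fun v => directedGen v ω

/-- The multiplication of the Klein four group `{1, b, c, d}`. -/
def kleinMul : Option KleinGen → Option KleinGen → Option KleinGen
  | none, w => w
  | v, none => v
  | some .b, some .b => none
  | some .c, some .c => none
  | some .d, some .d => none
  | some .b, some .c => some .d
  | some .c, some .b => some .d
  | some .b, some .d => some .c
  | some .d, some .b => some .c
  | some .c, some .d => some .b
  | some .d, some .c => some .b

/-- Only the sections below the child `0` need checking: below the child `1` stands the same
relation for the shifted sequence. -/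
theorem directedGen_apply_directedGen {v w z : KleinGen}
    (h : ∀ i, switchGen v i * switchGen w i = switchGen z i) (ω : ℕ → Fin 3) (x : Ray) :
    directedGen v ω (directedGen w ω x) = directedGen z ω x := by
  funext n
  induction n generalizing ω x with
  | zero => rfl
  | succ n ih =>
    obtain ⟨b, y, rfl⟩ := exists_consRay x
    cases b
    · simp only [directedGen_consRay_false]
      rw [← h]
      rfl
    · simp only [directedGen_consRay_true]
      exact ih _ _

theorem directedOpt_mul (v w : Option KleinGen) (ω : ℕ → Fin 3) :
    directedOpt v ω * directedOpt w ω = directedOpt (kleinMul v w) ω := by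
  rcases v with _ | v <;> rcases w with _ | w
  · simp [directedOpt, kleinMul]
  · simp [directedOpt, kleinMul]
  · cases v <;> simp [directedOpt, kleinMul]
  · cases v <;> cases w <;>
      first
      | exact directedGen_mul_self _ _
      | exact Equiv.ext fun x => directedGen_apply_directedGen
          (by intro i; fin_cases i <;> simp [switchGen, switches]) ω x

@[simp] theorem directedOpt_rightRay (v : Option KleinGen) (ω : ℕ → Fin 3) :
    directedOpt v ω rightRay = rightRay := by
  cases v <;> simp [directedOpt]

/-! ### Lamps: `Γ_ω` inside the permutations of `Ray × F`, and sections of permutations -/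

section Lamps

variable {F : Type*} [Group F]

/-- A permutation of the rays acting on the product of the rays with `F`. -/
def liftRay (F : Type*) : Equiv.Perm Ray →* Equiv.Perm (Ray × F) where
  toFun g := Equiv.prodCongr g (Equiv.refl F)
  map_one' := rfl
  map_mul' _ _ := rfl

@[simp] theorem liftRay_apply (g : Equiv.Perm Ray) (y : Ray × F) :
    liftRay F g y = (g y.1, y.2) := rfl

/-- A function `φ` acting on the fibre above `x` by multiplication by `φ x`. -/
def twist : (Ray → F) →* Equiv.Perm (Ray × F) where
  toFun φ :=
    { toFun := fun y => (y.1, φ y.1 * y.2)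
      invFun := fun y => (y.1, (φ y.1)⁻¹ * y.2)
      left_inv := fun y => by simp
      right_inv := fun y => by simp }
  map_one' := by ext y <;> simp
  map_mul' φ ψ := by ext y <;> simp [mul_assoc]

@[simp] theorem twist_apply (φ : Ray → F) (y : Ray × F) : twist φ y = (y.1, φ y.1 * y.2) := rfl

theorem liftRay_mul_twist (g : Equiv.Perm Ray) (φ : Ray → F) :
    liftRay F g * twist φ = twist (fun x => φ (g⁻¹ x)) * liftRay F g := by
  ext y <;> simp

open Classical in
/-- The function with value `f` at the ray `x` and `1` elsewhere. -/
noncomputable def lampAt (x : Ray) : F →* (Ray → F) := MonoidHom.mulSingle (fun _ : Ray => F) x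

open Classical in
theorem lampAt_apply (x : Ray) (f : F) (y : Ray) : lampAt x f y = if y = x then f else 1 := by
  simp [lampAt, Pi.mulSingle_apply]

/-- Since `ρ = 1ρ`, a lamp at `ρ` passes unchanged to the section below `1` and leaves no trace
below `0`. -/
theorem lampAt_consRay_true (f : F) (x : Ray) :
    lampAt rightRay f (consRay true x) = lampAt rightRay f x := by
  rw [lampAt_apply, lampAt_apply]
  have h := consRay_true_eq_rightRay x
  by_cases hx : x = rightRay
  · rw [if_pos hx, if_pos (h.2 hx)]
  · rw [if_neg hx, if_neg (mt h.1 hx)]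

theorem lampAt_consRay_false (f : F) (x : Ray) :
    lampAt rightRay f (consRay false x) = 1 := by
  rw [lampAt_apply, if_neg (consRay_false_ne_rightRay x)]

theorem liftRay_mul_twist_lampAt (g : Equiv.Perm Ray) (x : Ray) (f : F) :
    liftRay F g * twist (lampAt x f) = twist (lampAt (g x) f) * liftRay F g := by
  rw [liftRay_mul_twist]
  congr 2
  funext y
  have h : g⁻¹ y = x ↔ y = g x := Equiv.Perm.inv_eq_iff_eq.trans Iff.rfl
  rw [lampAt_apply, lampAt_apply]
  by_cases hx : y = g x
  · rw [if_pos hx, if_pos (h.2 hx)]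
  · rw [if_neg hx, if_neg (mt h.1 hx)]

/-- The letters which fix the ray `ρ`: products of an element of `{1, b, c, d}` and a lamp. -/
abbrev Letter (F : Type*) : Type _ := Option KleinGen × F

/-- The permutation given by a letter. -/
noncomputable def letterPerm (ω : ℕ → Fin 3) (q : Letter F) : Equiv.Perm (Ray × F) :=
  liftRay F (directedOpt q.1 ω) * twist (lampAt rightRay q.2)

/-- The product of two letters. -/
def letterMul (q r : Letter F) : Letter F := (kleinMul q.1 r.1, q.2 * r.2)

/-- The generators `b`, `c`, `d` fix `ρ`, hence commute with the lamps at `ρ`; letters multiply as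
in the direct product of the Klein group and `F`. -/
theorem letterPerm_mul (ω : ℕ → Fin 3) (q r : Letter F) :
    letterPerm ω q * letterPerm ω r = letterPerm ω (letterMul q r) := by
  have h := liftRay_mul_twist_lampAt (directedOpt r.1 ω) rightRay q.2
  rw [directedOpt_rightRay] at h
  simp only [letterPerm, letterMul, ← directedOpt_mul, map_mul]
  rw [mul_assoc, ← mul_assoc (twist _), ← h]
  simp only [mul_assoc]

@[simp] theorem letterPerm_one (ω : ℕ → Fin 3) : letterPerm ω ((none, 1) : Letter F) = 1 := by
  simp [letterPerm, directedOpt]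

/-- The generator `a` acting on the product of the rays with `F`. -/
def rootPerm (F : Type*) : Equiv.Perm (Ray × F) := liftRay F rootGen

@[simp] theorem rootPerm_mul_self : rootPerm F * rootPerm F = 1 := by
  rw [rootPerm, ← map_mul, rootGen_mul_self, map_one]

/-- The first vertex of a ray and the rest of it. -/
def splitRay (F : Type*) : Bool × (Ray × F) ≃ Ray × F where
  toFun z := (consRay z.1 z.2.1, z.2.2)
  invFun y := (y.1 0, y.1.tail, y.2)
  left_inv _ := rfl
  right_inv y := by simp

/-- The permutation `(p₀, p₁)aˢ`. -/
def joinPerm (p : Bool → Equiv.Perm (Ray × F)) (s : Bool) : Equiv.Perm (Ray × F) :=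
  (splitRay F).permCongr
    (Equiv.prodCongrRight p * Equiv.prodCongr (Equiv.boolNot ^ s.toNat) (Equiv.refl _))

@[simp] theorem joinPerm_apply (p : Bool → Equiv.Perm (Ray × F)) (s b : Bool) (x : Ray) (f : F) :
    joinPerm p s (consRay b x, f) =
      (consRay (b ^^ s) (p (b ^^ s) (x, f)).1, (p (b ^^ s) (x, f)).2) := by
  have h : (splitRay F).symm (consRay b x, f) = (b, x, f) := rfl
  cases s <;> cases b <;>
    simp only [joinPerm, Equiv.permCongr_apply, h] <;> rfl

theorem perm_ext_consRay {p q : Equiv.Perm (Ray × F)}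
    (h : ∀ b x f, p (consRay b x, f) = q (consRay b x, f)) : p = q := by
  refine Equiv.ext fun y => ?_
  obtain ⟨x, f⟩ := y
  obtain ⟨b, x, rfl⟩ := exists_consRay x
  exact h b x f

theorem joinPerm_injective :
    Function.Injective fun z : (Bool → Equiv.Perm (Ray × F)) × Bool => joinPerm z.1 z.2 := by
  rintro ⟨p, s⟩ ⟨q, t⟩ h
  have h' : ∀ b x f, joinPerm p s (consRay b x, f) = joinPerm q t (consRay b x, f) :=
    fun b x f => by rw [show joinPerm p s = joinPerm q t from h]
  simp only [joinPerm_apply, Prod.mk.injEq] at h'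
  have hs : s = t := by
    have := congrFun (h' false rightRay 1).1 0
    simpa using this
  subst hs
  simp only [Prod.mk.injEq, and_true]
  funext b
  refine Equiv.ext fun y => ?_
  have := h' (b ^^ s) y.1 y.2
  rw [Bool.xor_assoc, Bool.xor_self, Bool.xor_false] at this
  exact Prod.ext (consRay_injective _ this.1) this.2

theorem rootPerm_mul_joinPerm (p : Bool → Equiv.Perm (Ray × F)) (s : Bool) :
    rootPerm F * joinPerm p s = joinPerm (fun b => p (!b)) (!s) := by
  refine perm_ext_consRay fun b x f => ?_
  cases b <;> cases s <;> simp [rootPerm]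

/-- The permutation `u^v(i)`, acting on the product of the rays with `F`. -/
def switchPerm (F : Type*) (v : Option KleinGen) (i : Fin 3) : Equiv.Perm (Ray × F) :=
  liftRay F (v.elim 1 fun v => switchGen v i)

/-- The recursion `v_ω = (u^v(ω₀), v_{σω})`, with the lamp at `ρ` carried along the child `1`. -/
theorem letterPerm_mul_joinPerm (ω : ℕ → Fin 3) (q : Letter F)
    (p : Bool → Equiv.Perm (Ray × F)) (s : Bool) :
    letterPerm ω q * joinPerm p s =
      joinPerm (fun b => (if b = true then letterPerm (shiftSeq ω) q
        else switchPerm F q.1 (ω 0)) * p b) s := by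
  refine perm_ext_consRay fun b x f => ?_
  obtain ⟨v, g⟩ := q
  cases hb : (b ^^ s) <;> cases v <;>
    simp [letterPerm, hb, directedOpt, switchPerm, lampAt_consRay_true,
      lampAt_consRay_false]

theorem letterPerm_eq_joinPerm (ω : ℕ → Fin 3) (q : Letter F) :
    letterPerm ω q =
      joinPerm (fun b => if b = true then letterPerm (shiftSeq ω) q
        else switchPerm F q.1 (ω 0)) false := by
  have h1 : joinPerm (fun _ => (1 : Equiv.Perm (Ray × F))) false = 1 :=
    perm_ext_consRay fun b x f => by simp
  have := letterPerm_mul_joinPerm ω q (fun _ => 1) false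
  simpa only [h1, mul_one] using this

end Lamps

/-! ### The weights of the generators -/

/-- The letter of the alphabet `{0, 1, 2}` at which the generator does not switch. -/
def specialIdx : KleinGen → Fin 3
  | .b => 2
  | .c => 1
  | .d => 0

instance : Finite KleinGen :=
  Finite.of_injective specialIdx fun v w h => by cases v <;> cases w <;> simp_all [specialIdx]

theorem switches_eq_true_iff (v : KleinGen) (i : Fin 3) :
    switches v i = true ↔ specialIdx v ≠ i := by
  cases v <;> fin_cases i <;> simp [switches, specialIdx]

/-- The sum of a triple of weights. -/
def total (l : Fin 3 → ℝ) : ℝ := l 0 + l 1 + l 2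

/-- The least of a triple of weights. -/
noncomputable def least (l : Fin 3 → ℝ) : ℝ := min (min (l 0) (l 1)) (l 2)

theorem least_le (l : Fin 3 → ℝ) (i : Fin 3) : least l ≤ l i := by
  fin_cases i <;> simp [least]

theorem le_least {l : Fin 3 → ℝ} {x : ℝ} (h : ∀ i, x ≤ l i) : x ≤ least l :=
  le_min (le_min (h 0) (h 1)) (h 2)

theorem exists_eq_least (l : Fin 3 → ℝ) : ∃ i, l i = least l := by
  rcases min_choice (min (l 0) (l 1)) (l 2) with h | h
  · rcases min_choice (l 0) (l 1) with h' | h'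
    · exact ⟨0, by rw [least, h, h']⟩
    · exact ⟨1, by rw [least, h, h']⟩
  · exact ⟨2, by rw [least, h]⟩

/-- One step of the evolution of the weights: the weight with index `i` becomes half the sum. -/
noncomputable def weightStep (l : Fin 3 → ℝ) (i : Fin 3) : Fin 3 → ℝ :=
  Function.update l i (total l / 2)

/-- The weights at level `k`. -/
noncomputable def weights (l : Fin 3 → ℝ) (ω : ℕ → Fin 3) : ℕ → Fin 3 → ℝ
  | 0 => l
  | k + 1 => weightStep (weights l ω k) (ω k)

/-- `weights` appends a step at the end, whereas inductions on self-similarity remove the first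
letter of `ω`; this passes between the two. -/
theorem weights_succ_eq_shiftSeq (l : Fin 3 → ℝ) (ω : ℕ → Fin 3) (k : ℕ) :
    weights l ω (k + 1) = weights (weightStep l (ω 0)) (shiftSeq ω) k := by
  induction k with
  | zero => rfl
  | succ k ih => rw [weights, ih]; rfl

/-- The weight `l v` is the common weight of `a` and the generator with index `v`, while `A` is
the weight of `a`. The weights of the generators satisfy the triangle inequalities. -/
structure Admissible (A : ℝ) (l : Fin 3 → ℝ) : Prop where
  nonneg : 0 ≤ A
  le : ∀ i, A ≤ l i
  triangle : ∀ i, 2 * l i + A ≤ total l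

theorem weightStep_self (l : Fin 3 → ℝ) (i : Fin 3) : weightStep l i i = total l / 2 := by
  simp [weightStep]

theorem weightStep_of_ne (l : Fin 3 → ℝ) {i j : Fin 3} (h : j ≠ i) : weightStep l i j = l j := by
  simp [weightStep, h]

theorem total_weightStep (l : Fin 3 → ℝ) (i : Fin 3) :
    total (weightStep l i) = 3 / 2 * total l - l i := by
  fin_cases i <;> simp [total, weightStep, Function.update] <;> ring

theorem Admissible.weightStep {A : ℝ} {l : Fin 3 → ℝ} (h : Admissible A l) (i : Fin 3) :
    Admissible (total l / 2 - l i) (weightStep l i) where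
  nonneg := by linarith [h.triangle i, h.nonneg]
  le j := by
    by_cases hj : j = i
    · subst hj
      rw [weightStep_self]
      linarith [h.nonneg, h.le j]
    · rw [weightStep_of_ne l hj]
      have h0 := h.triangle
      have h1 := h.nonneg
      have h00 := h0 0
      have h01 := h0 1
      have h02 := h0 2
      simp only [total] at *
      fin_cases i <;> fin_cases j <;> simp at hj ⊢ <;> linarith
  triangle j := by
    rw [total_weightStep]
    by_cases hj : j = i
    · subst hj
      rw [weightStep_self]
      linarith
    · rw [weightStep_of_ne l hj]
      linarith [h.triangle j, h.nonneg]

/-- The initial weights: `a`, `b`, `c`, `d` and the nontrivial lamps all weigh `1 / 2`. -/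
theorem admissible_one : Admissible (1 / 2) fun _ => 1 where
  nonneg := by norm_num
  le _ := by norm_num
  triangle _ := by norm_num [total]

theorem Admissible.le_weightStep {A : ℝ} {l : Fin 3 → ℝ} (h : Admissible A l) (i j : Fin 3) :
    l j ≤ _root_.weightStep l i j := by
  by_cases hj : j = i
  · subst hj
    rw [weightStep_self]
    linarith [h.triangle j, h.nonneg]
  · rw [weightStep_of_ne l hj]

theorem Admissible.le_total {A : ℝ} {l : Fin 3 → ℝ} (h : Admissible A l) : A ≤ total l := by
  have := h.nonneg
  simp only [total]
  linarith [h.le 0, h.le 1, h.le 2]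

theorem Admissible.exists_weights {A : ℝ} {l : Fin 3 → ℝ} (h : Admissible A l) (ω : ℕ → Fin 3)
    (k : ℕ) : ∃ A', Admissible A' (weights l ω k) := by
  induction k with
  | zero => exact ⟨A, h⟩
  | succ k ih =>
    obtain ⟨A', h'⟩ := ih
    exact ⟨_, h'.weightStep (ω k)⟩

theorem Admissible.le_weights {A : ℝ} {l : Fin 3 → ℝ} (h : Admissible A l) (ω : ℕ → Fin 3)
    (i : Fin 3) : Monotone fun k => weights l ω k i := by
  refine monotone_nat_of_le_succ fun k => ?_
  obtain ⟨A', h'⟩ := h.exists_weights ω k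
  exact h'.le_weightStep (ω k) i

theorem Admissible.total_weights_mono {A : ℝ} {l : Fin 3 → ℝ} (h : Admissible A l)
    (ω : ℕ → Fin 3) : Monotone fun k => total (weights l ω k) := fun _ _ hij =>
  add_le_add (add_le_add (h.le_weights ω 0 hij) (h.le_weights ω 1 hij)) (h.le_weights ω 2 hij)

/-! ### Words and their weights -/

section Words

variable {F : Type*} [Group F]

open Classical in
/-- The weight of a letter. -/
noncomputable def letterWeight (A : ℝ) (l : Fin 3 → ℝ) : Letter F → ℝ
  | (some v, _) => l (specialIdx v) - A
  -- A pure lamp weighs as much as the lightest of `b`, `c`, `d`: little enough for subadditivity,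
  -- and enough for `least_le_letterWeight`.
  | (none, f) => if f = 1 then 0 else least l - A

theorem letterWeight_nonneg {A : ℝ} {l : Fin 3 → ℝ} (h : Admissible A l) (q : Letter F) :
    0 ≤ letterWeight A l q := by
  rcases q with ⟨_ | v, f⟩
  · simp only [letterWeight]
    split_ifs
    · rfl
    · exact sub_nonneg.2 (le_least h.le)
  · exact sub_nonneg.2 (h.le _)

theorem least_le_letterWeight (A : ℝ) (l : Fin 3 → ℝ) {q : Letter F} (hq : q ≠ (none, 1)) :
    least l ≤ A + letterWeight A l q := by
  rcases q with ⟨_ | v, f⟩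
  · have hf : f ≠ 1 := by rintro rfl; exact hq rfl
    simp [letterWeight, hf]
  · simpa [letterWeight] using least_le l _

theorem letterWeight_none_le {A : ℝ} {l : Fin 3 → ℝ} (h : Admissible A l) (f : F) (i : Fin 3) :
    letterWeight A l (none, f) ≤ l i - A := by
  simp only [letterWeight]
  split_ifs
  · linarith [h.le i]
  · linarith [least_le l i]

theorem letterWeight_none_mul_le {A : ℝ} {l : Fin 3 → ℝ} (h : Admissible A l) (f g : F) :
    letterWeight A l (none, f * g) ≤ letterWeight A l (none, f) + letterWeight A l (none, g) := by
  have hl := le_least h.le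
  simp only [letterWeight]
  split_ifs <;> simp_all

/-- For a product of two different elements of `{b, c, d}` this is the triangle inequality in
`Admissible`. -/
theorem letterWeight_mul_le {A : ℝ} {l : Fin 3 → ℝ} (h : Admissible A l) (q r : Letter F) :
    letterWeight A l (letterMul q r) ≤ letterWeight A l q + letterWeight A l r := by
  have h0 := h.triangle
  have h1 := h.le
  obtain ⟨v, f⟩ := q
  obtain ⟨w, g⟩ := r
  have hf := letterWeight_nonneg h ((none, f) : Letter F)
  have hg := letterWeight_nonneg h ((none, g) : Letter F)
  rcases v with _ | v <;> rcases w with _ | w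
  · exact letterWeight_none_mul_le h f g
  · simpa [letterMul, kleinMul, letterWeight] using hf
  · cases v <;> simpa [letterMul, kleinMul, letterWeight] using hg
  · have h2 := letterWeight_none_le h (f * g)
    have h00 := h0 0
    have h01 := h0 1
    have h02 := h0 2
    have h10 := h1 0
    have h11 := h1 1
    have h12 := h1 2
    have h20 := h2 0
    have h21 := h2 1
    have h22 := h2 2
    simp only [total] at h00 h01 h02
    cases v <;> cases w <;> simp only [letterMul, kleinMul] <;>
      simp only [letterWeight, specialIdx] at * <;> linarith

open Classical in
/-- The weight of the permutation `u^v(i)`. -/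
noncomputable def switchWeight (A : ℝ) (v : Option KleinGen) (i : Fin 3) : ℝ :=
  if ∃ w, v = some w ∧ specialIdx w ≠ i then A else 0

/-- This explains `weightStep` and the new weight `A' = total l / 2 - l i` of `a`: the sections of
`v` should together weigh `l v`, the old weight of `a v`. If `v` does not switch at `i`, its only
nontrivial section weighs `total l / 2 - A' = l i`; otherwise the sections weigh `l v - A'` and
`A'`. -/
theorem letterWeight_weightStep_le {A : ℝ} {l : Fin 3 → ℝ} (h : Admissible A l) (i : Fin 3)
    (q : Letter F) :
    letterWeight (total l / 2 - l i) (weightStep l i) q +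
      switchWeight (total l / 2 - l i) q.1 i ≤ A + letterWeight A l q := by
  have hA := h.nonneg
  have hA' := (h.weightStep i).nonneg
  rcases q with ⟨_ | v, f⟩
  · have hs : switchWeight (total l / 2 - l i) none i = 0 := by simp [switchWeight]
    rw [hs, add_zero]
    by_cases hf : f = 1
    · simpa [letterWeight, hf] using hA
    · simp only [letterWeight, hf, if_false, add_sub_cancel]
      refine le_least fun j => ?_
      by_cases hj : j = i
      · subst hj
        have := least_le (weightStep l j) j
        rw [weightStep_self] at this
        linarith
      · have := least_le (weightStep l i) j
        rw [weightStep_of_ne l hj] at this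
        linarith
  · by_cases hv : specialIdx v = i
    · have hs : switchWeight (total l / 2 - l i) (some v) i = 0 := by simp [switchWeight, hv]
      simp only [hs, letterWeight, hv, weightStep_self]
      linarith
    · have hs : switchWeight (total l / 2 - l i) (some v) i = total l / 2 - l i := by
        simp [switchWeight, hv]
      simp only [hs, letterWeight, weightStep_of_ne l hv]
      linarith

/-- The permutation given by a word `q a q₁ a q₂ a … a qₙ`. -/
noncomputable def wordPerm (ω : ℕ → Fin 3) : Letter F → List (Letter F) → Equiv.Perm (Ray × F)
  | q, [] => letterPerm ω q
  | q, r :: L => letterPerm ω q * rootPerm F * wordPerm ω r L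

/-- The weight of a word `q a q₁ a q₂ a … a qₙ`. -/
noncomputable def wordWeight (A : ℝ) (l : Fin 3 → ℝ) : Letter F → List (Letter F) → ℝ
  | q, [] => letterWeight A l q
  | q, r :: L => letterWeight A l q + A + wordWeight A l r L

/-- The permutation `g` is given by a word of weight at most `t`. -/
def HasWord (ω : ℕ → Fin 3) (A : ℝ) (l : Fin 3 → ℝ) (g : Equiv.Perm (Ray × F)) (t : ℝ) : Prop :=
  ∃ q L, wordPerm ω q L = g ∧ wordWeight A l q L ≤ t

theorem wordPerm_letterMul (ω : ℕ → Fin 3) (q r : Letter F) (L : List (Letter F)) :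
    wordPerm ω (letterMul q r) L = letterPerm ω q * wordPerm ω r L := by
  cases L <;> simp [wordPerm, ← letterPerm_mul, mul_assoc]

theorem wordWeight_letterMul_le {A : ℝ} {l : Fin 3 → ℝ} (h : Admissible A l) (q r : Letter F)
    (L : List (Letter F)) :
    wordWeight A l (letterMul q r) L ≤ letterWeight A l q + wordWeight A l r L := by
  have := letterWeight_mul_le h q r
  cases L <;> simp only [wordWeight] <;> linarith

theorem HasWord.mono {ω : ℕ → Fin 3} {A : ℝ} {l : Fin 3 → ℝ} {g : Equiv.Perm (Ray × F)} {s t : ℝ}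
    (h : HasWord ω A l g s) (hst : s ≤ t) : HasWord ω A l g t := by
  obtain ⟨q, L, h1, h2⟩ := h
  exact ⟨q, L, h1, h2.trans hst⟩

theorem hasWord_letterPerm (ω : ℕ → Fin 3) (A : ℝ) (l : Fin 3 → ℝ) (q : Letter F) :
    HasWord ω A l (letterPerm ω q) (letterWeight A l q) := ⟨q, [], rfl, le_rfl⟩

theorem hasWord_one (ω : ℕ → Fin 3) (A : ℝ) (l : Fin 3 → ℝ) :
    HasWord ω A l (1 : Equiv.Perm (Ray × F)) 0 :=
  ⟨(none, 1), [], by simp [wordPerm], by simp [wordWeight, letterWeight]⟩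

theorem HasWord.letterPerm_mul {ω : ℕ → Fin 3} {A : ℝ} {l : Fin 3 → ℝ} (h : Admissible A l)
    {g : Equiv.Perm (Ray × F)} {t : ℝ} (hg : HasWord ω A l g t) (q : Letter F) :
    HasWord ω A l (letterPerm ω q * g) (letterWeight A l q + t) := by
  obtain ⟨r, L, rfl, hL⟩ := hg
  exact ⟨letterMul q r, L, wordPerm_letterMul ω q r L,
    (wordWeight_letterMul_le h q r L).trans (by linarith)⟩

theorem HasWord.rootPerm_mul {ω : ℕ → Fin 3} {A : ℝ} {l : Fin 3 → ℝ}
    {g : Equiv.Perm (Ray × F)} {t : ℝ} (hg : HasWord ω A l g t) :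
    HasWord ω A l (rootPerm F * g) (A + t) := by
  obtain ⟨r, L, rfl, hL⟩ := hg
  exact ⟨(none, 1), r :: L, by simp [wordPerm], by simpa [wordWeight, letterWeight] using hL⟩

theorem HasWord.switchPerm_mul {ω : ℕ → Fin 3} {A : ℝ} {l : Fin 3 → ℝ}
    {g : Equiv.Perm (Ray × F)} {t : ℝ} (hg : HasWord ω A l g t) (v : Option KleinGen) (i : Fin 3) :
    HasWord ω A l (switchPerm F v i * g) (switchWeight A v i + t) := by
  rcases v with _ | v
  · simpa [switchPerm, switchWeight] using hg
  · by_cases hv : specialIdx v = i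
    · have : ¬ switches v i = true := fun h => (switches_eq_true_iff v i).1 h hv
      simpa [switchPerm, switchWeight, switchGen, this, hv] using hg
    · have := (switches_eq_true_iff v i).2 hv
      simpa [switchPerm, switchWeight, switchGen, this, hv, rootPerm] using hg.rootPerm_mul

theorem hasWord_switchPerm (ω : ℕ → Fin 3) (A : ℝ) (l : Fin 3 → ℝ) (v : Option KleinGen)
    (i : Fin 3) :
    HasWord ω A l (switchPerm F v i) (switchWeight A v i) := by
  simpa using (hasWord_one (F := F) ω A l).switchPerm_mul v i

/-- The two sections of a permutation given by a word are given by words of smaller total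
weight. -/
theorem HasWord.exists_joinPerm {ω : ℕ → Fin 3} {A : ℝ} {l : Fin 3 → ℝ} (h : Admissible A l)
    {g : Equiv.Perm (Ray × F)} {t : ℝ} (hg : HasWord ω A l g t) :
    ∃ (p : Bool → Equiv.Perm (Ray × F)) (s : Bool) (w : Bool → ℝ),
      joinPerm p s = g ∧ w false + w true ≤ A + t ∧
      ∀ b, HasWord (shiftSeq ω) (total l / 2 - l (ω 0)) (weightStep l (ω 0)) (p b) (w b) := by
  obtain ⟨q, L, rfl, hL⟩ := hg
  induction L generalizing q t with
  | nil =>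
    have hw := letterWeight_weightStep_le h (ω 0) q
    simp only [wordWeight] at hL
    refine ⟨_, _, fun b => if b = true then letterWeight (total l / 2 - l (ω 0)) (weightStep l (ω 0)) q else
      switchWeight (total l / 2 - l (ω 0)) q.1 (ω 0), (letterPerm_eq_joinPerm ω q).symm, ?_, ?_⟩
    rotate_left
    · intro b
      cases b
      · exact hasWord_switchPerm _ _ _ _ _
      · exact hasWord_letterPerm _ _ _ _
    · simp only [Bool.false_eq_true, if_false, if_true]
      linarith
  | cons r L ih =>
    obtain ⟨p, s, w, hp, hw, hpw⟩ := ih r le_rfl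
    have hq := letterWeight_weightStep_le h (ω 0) q
    simp only [wordWeight] at hL
    -- Prepending `q a` exchanges the sections of the rest of the word and multiplies them by the
    -- sections of `q`. By `letterWeight_weightStep_le` this adds no more weight than `q a` has.
    have key := letterPerm_mul_joinPerm ω q (fun b => p (!b)) (!s)
    rw [← rootPerm_mul_joinPerm, hp, ← mul_assoc] at key
    refine ⟨_, _, fun b => (if b = true then letterWeight (total l / 2 - l (ω 0))
      (weightStep l (ω 0)) q else switchWeight (total l / 2 - l (ω 0)) q.1 (ω 0)) + w (!b),
      key.symm, ?_, ?_⟩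
    rotate_left
    · intro b
      cases b
      · exact (hpw _).switchPerm_mul _ _
      · exact (hpw _).letterPerm_mul (h.weightStep _) _
    · simp only [Bool.false_eq_true, if_false, if_true, Bool.not_false, Bool.not_true]
      linarith

/-- Every word can be replaced by a word which has no trivial letter except possibly at its
ends. -/
theorem exists_reduced_word {A : ℝ} {l : Fin 3 → ℝ} (h : Admissible A l) (ω : ℕ → Fin 3)
    (q : Letter F) (L : List (Letter F)) :
    ∃ r M, wordPerm ω r M = wordPerm ω q L ∧ wordWeight A l r M ≤ wordWeight A l q L ∧
      ∀ z ∈ M.dropLast, z ≠ (none, 1) := by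
  induction L generalizing q with
  | nil => exact ⟨q, [], rfl, le_rfl, by simp⟩
  | cons q' L ih =>
    obtain ⟨r, M, h1, h2, h3⟩ := ih q'
    have key : wordPerm ω q (r :: M) = wordPerm ω q (q' :: L) := by simp only [wordPerm, h1]
    have hw : wordWeight A l q (r :: M) ≤ wordWeight A l q (q' :: L) := by
      simp only [wordWeight]; linarith
    rcases M with _ | ⟨r', M⟩
    · exact ⟨q, [r], key, hw, by simp⟩
    · by_cases hr : r = (none, 1)
      -- A trivial letter between two `a` disappears together with them: `q a 1 a r' = q r'`.
      · subst hr
        refine ⟨letterMul q r', M, ?_, ?_, fun z hz => h3 z ?_⟩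
        · rw [← key, wordPerm_letterMul, wordPerm, wordPerm, letterPerm_one, one_mul, mul_assoc,
            ← mul_assoc (rootPerm F), rootPerm_mul_self, one_mul]
        · refine (wordWeight_letterMul_le h q r' M).trans (le_trans ?_ hw)
          simp only [wordWeight, letterWeight, if_true]
          linarith [h.nonneg]
        · rcases M with _ | ⟨m, M⟩
          · simp at hz
          · rw [List.dropLast_cons_cons]
            exact List.mem_cons_of_mem _ hz
      · refine ⟨q, r :: r' :: M, key, hw, fun z hz => ?_⟩
        rw [List.dropLast_cons_cons] at hz
        rcases List.mem_cons.1 hz with rfl | hz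
        · exact hr
        · exact h3 z hz

/-- A nontrivial letter together with the `a` in front of it weighs at least `least l`. The last
letter may be trivial, whence the `- 1`. -/
theorem length_mul_least_le_wordWeight {A : ℝ} {l : Fin 3 → ℝ} (h : Admissible A l) (q : Letter F)
    (L : List (Letter F)) (hL : ∀ z ∈ L.dropLast, z ≠ (none, 1)) :
    letterWeight A l q + ((L.length : ℝ) - 1) * least l ≤ wordWeight A l q L := by
  have hl : 0 ≤ least l := h.nonneg.trans (le_least h.le)
  induction L generalizing q with
  | nil =>
    simp only [wordWeight, List.length_nil]
    push_cast
    linarith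
  | cons r L ih =>
    rcases L with _ | ⟨r', L⟩
    · have := letterWeight_nonneg h r
      simp only [wordWeight, List.length_singleton]
      push_cast
      linarith [h.nonneg]
    · rw [List.dropLast_cons_cons] at hL
      have h1 := ih r fun z hz => hL z (List.mem_cons_of_mem _ hz)
      have h2 := least_le_letterWeight A l (hL r List.mem_cons_self)
      rw [wordWeight, List.length_cons]
      push_cast
      linarith

end Words

/-! ### Exponential sums over the group and the upper bound for the growth -/

section Partition

variable {F : Type*} [Group F]

/-- The largest number `exp(-λt)` such that `g` is given by a word of weight at most `t`. -/
noncomputable def expWeight (c : ℝ) (ω : ℕ → Fin 3) (A : ℝ) (l : Fin 3 → ℝ)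
    (g : Equiv.Perm (Ray × F)) : ℝ≥0∞ :=
  ⨆ (t : ℝ) (_ : HasWord ω A l g t), ENNReal.ofReal (Real.exp (-(c * t)))

/-- The sum of `exp(-λ‖g‖)`, where `‖g‖` is the least weight of a word for `g`. -/
noncomputable def partitionSum (F : Type*) [Group F] (c : ℝ) (ω : ℕ → Fin 3) (A : ℝ)
    (l : Fin 3 → ℝ) : ℝ≥0∞ :=
  ∑' g : Equiv.Perm (Ray × F), expWeight c ω A l g

theorem le_expWeight {c : ℝ} {ω : ℕ → Fin 3} {A : ℝ} {l : Fin 3 → ℝ}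
    {g : Equiv.Perm (Ray × F)} {t : ℝ} (h : HasWord ω A l g t) :
    ENNReal.ofReal (Real.exp (-(c * t))) ≤ expWeight c ω A l g :=
  le_iSup₂ (f := fun t (_ : HasWord ω A l g t) => ENNReal.ofReal (Real.exp (-(c * t)))) t h

/-- A permutation determines its sections, so every word for `(p₀, p₁)aˢ` yields words for these
very `p₀` and `p₁`, of total weight at most `A + t`. -/
theorem expWeight_joinPerm_le {c : ℝ} (hc : 0 ≤ c) {A : ℝ} {l : Fin 3 → ℝ} (h : Admissible A l)
    (ω : ℕ → Fin 3) (p : Bool → Equiv.Perm (Ray × F)) (s : Bool) :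
    expWeight c ω A l (joinPerm p s) ≤ ENNReal.ofReal (Real.exp (c * A)) *
      (expWeight c (shiftSeq ω) (total l / 2 - l (ω 0)) (weightStep l (ω 0)) (p false) *
        expWeight c (shiftSeq ω) (total l / 2 - l (ω 0)) (weightStep l (ω 0)) (p true)) := by
  refine iSup₂_le fun t ht => ?_
  obtain ⟨p', s', w, hp, hw, hpw⟩ := ht.exists_joinPerm h
  have := joinPerm_injective (a₁ := (p', s')) (a₂ := (p, s)) hp
  obtain ⟨rfl, rfl⟩ := Prod.mk.inj this
  refine le_trans ?_ (mul_le_mul_right (mul_le_mul' (le_expWeight (hpw false))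
    (le_expWeight (hpw true))) _)
  rw [← ENNReal.ofReal_mul (Real.exp_pos _).le, ← ENNReal.ofReal_mul (Real.exp_pos _).le,
    ← Real.exp_add, ← Real.exp_add]
  refine ENNReal.ofReal_le_ofReal (Real.exp_le_exp.2 ?_)
  nlinarith

/-- Summing over all `(p₀, p₁)aˢ`, the sections contribute a square and the two values of `s` a
factor `2`. -/
theorem partitionSum_le {c : ℝ} (hc : 0 ≤ c) {A : ℝ} {l : Fin 3 → ℝ} (h : Admissible A l)
    (ω : ℕ → Fin 3) :
    partitionSum F c ω A l ≤ 2 * ENNReal.ofReal (Real.exp (c * A)) *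
      partitionSum F c (shiftSeq ω) (total l / 2 - l (ω 0)) (weightStep l (ω 0)) ^ 2 := by
  -- A permutation without a word has weight `0`, the supremum of the empty set, so only the `(p₀,
  -- p₁)aˢ` count.
  have hsupp : Function.support (expWeight (F := F) c ω A l) ⊆
      Set.range fun z : (Bool → Equiv.Perm (Ray × F)) × Bool => joinPerm z.1 z.2 := by
    intro g hg
    by_contra hcon
    refine hg ?_
    simp only [expWeight, ENNReal.iSup_eq_zero]
    intro t ht
    obtain ⟨p, s, -, hp, -⟩ := ht.exists_joinPerm h
    exact (hcon ⟨(p, s), hp⟩).elim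
  rw [partitionSum, ← joinPerm_injective.tsum_eq hsupp]
  set W := expWeight (F := F) c (shiftSeq ω) (total l / 2 - l (ω 0)) (weightStep l (ω 0)) with hW
  calc _ ≤ ∑' z : (Bool → Equiv.Perm (Ray × F)) × Bool,
        ENNReal.ofReal (Real.exp (c * A)) * (W (z.1 false) * W (z.1 true)) :=
        ENNReal.tsum_le_tsum fun z => expWeight_joinPerm_le hc h ω z.1 z.2
    _ = 2 * ENNReal.ofReal (Real.exp (c * A)) *
        ∑' p : Bool → Equiv.Perm (Ray × F), W (p false) * W (p true) := by
        rw [ENNReal.tsum_prod', ENNReal.tsum_comm]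
        simp only [tsum_bool, ENNReal.tsum_mul_left]
        ring
    _ = _ := by
        congr 1
        rw [← (Equiv.boolArrowEquivProd (Equiv.Perm (Ray × F))).symm.tsum_eq, ENNReal.tsum_prod', sq]
        have h1 : ∀ g g', (Equiv.boolArrowEquivProd (Equiv.Perm (Ray × F))).symm (g, g') false = g :=
          fun _ _ => rfl
        have h2 : ∀ g g', (Equiv.boolArrowEquivProd (Equiv.Perm (Ray × F))).symm (g, g') true = g' :=
          fun _ _ => rfl
        simp only [h1, h2, ENNReal.tsum_mul_left, ENNReal.tsum_mul_right, partitionSum, hW]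

/-- Normalized by `2 exp (c M)`, where `M` bounds the weight of `a` at all levels up to `k`, the
recursion becomes `Z ≤ Z' ^ 2` and can be iterated. -/
theorem partitionSum_le_pow {c : ℝ} (hc : 0 ≤ c) {A : ℝ} {l : Fin 3 → ℝ} (h : Admissible A l)
    (ω : ℕ → Fin 3) (k : ℕ) {M : ℝ} (hM : total (weights l ω k) ≤ M) :
    ∃ A' ω', Admissible A' (weights l ω k) ∧
      2 * ENNReal.ofReal (Real.exp (c * M)) * partitionSum F c ω A l ≤
        (2 * ENNReal.ofReal (Real.exp (c * M)) *
          partitionSum F c ω' A' (weights l ω k)) ^ 2 ^ k := by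
  induction k generalizing A l ω with
  | zero => exact ⟨A, ω, h, by simp [weights]⟩
  | succ k ih =>
    rw [weights_succ_eq_shiftSeq] at hM ⊢
    obtain ⟨A', ω', h1, h2⟩ := ih (h.weightStep (ω 0)) (shiftSeq ω) hM
    refine ⟨A', ω', h1, ?_⟩
    have hA : A ≤ M := by
      refine h.le_total.trans (le_trans ?_ hM)
      have := h.total_weights_mono ω (Nat.zero_le (k + 1))
      rwa [← weights_succ_eq_shiftSeq]
    calc _ ≤ 2 * ENNReal.ofReal (Real.exp (c * M)) * (2 * ENNReal.ofReal (Real.exp (c * M)) *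
          partitionSum F c (shiftSeq ω) (total l / 2 - l (ω 0)) (weightStep l (ω 0)) ^ 2) := by
          refine mul_le_mul_right ((partitionSum_le hc h ω).trans ?_) _
          gcongr
      _ = (2 * ENNReal.ofReal (Real.exp (c * M)) *
          partitionSum F c (shiftSeq ω) (total l / 2 - l (ω 0)) (weightStep l (ω 0))) ^ 2 := by
          ring
      _ ≤ _ := by
          rw [pow_succ 2, pow_mul]
          gcongr

/-- If the weights are large compared to `1 / c`, then the sum is bounded. -/
theorem partitionSum_le_card [Finite F] {c : ℝ} (hc : 0 ≤ c) {A : ℝ} {l : Fin 3 → ℝ}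
    (h : Admissible A l) (ω : ℕ → Fin 3)
    (hl : Real.exp (c * least l) = 2 * Nat.card (Letter F)) :
    partitionSum F c ω A l ≤ 4 * (Nat.card (Letter F) : ℝ≥0∞) ^ 2 := by
  have := Fintype.ofFinite F
  have : Fintype (Letter F) := Fintype.ofFinite _
  set N := Nat.card (Letter F) with hN
  have hN0 : 0 < N := Nat.card_pos
  set x : ℝ≥0∞ := (2 * N)⁻¹ with hx
  have hxe : ENNReal.ofReal (Real.exp (-(c * least l))) = x := by
    rw [Real.exp_neg, hl, ENNReal.ofReal_inv_of_pos (by positivity),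
      ENNReal.ofReal_mul (by norm_num)]
    simp [hx]
  have hword : ∀ g : Equiv.Perm (Ray × F), expWeight c ω A l g ≤
      ∑' z : Letter F × List (Letter F),
        Set.indicator {z | wordPerm ω z.1 z.2 = g} (fun z => 2 * N * x ^ z.2.length) z := by
    intro g
    refine iSup₂_le fun t ht => ?_
    obtain ⟨q, L, hg, hL⟩ := ht
    obtain ⟨r, M, h1, h2, h3⟩ := exists_reduced_word h ω q L
    refine le_trans ?_ (ENNReal.le_tsum (r, M))
    rw [Set.indicator_of_mem (by exact h1.trans hg)]
    have h4 := length_mul_least_le_wordWeight h r M h3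
    have h5 := letterWeight_nonneg h r
    -- The factor `2 * N = exp (c * least l)` makes up for the `- 1` in
    -- `length_mul_least_le_wordWeight`.
    have : Real.exp (-(c * t)) ≤ (2 * N) * Real.exp (-(c * least l)) ^ M.length := by
      rw [← hl, ← Real.exp_nat_mul, ← Real.exp_add]
      refine Real.exp_le_exp.2 ?_
      nlinarith
    refine (ENNReal.ofReal_le_ofReal this).trans ?_
    rw [ENNReal.ofReal_mul (by positivity), ENNReal.ofReal_pow (Real.exp_pos _).le, hxe,
      ENNReal.ofReal_mul (by norm_num)]
    simp
  -- There are `N ^ n` lists of length `n`, so this is the geometric series with ratio `N * x = 1 /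
  -- 2`.
  have hlen : ∑' L : List (Letter F), x ^ L.length = 2 := by
    have hx2 : (N : ℝ≥0∞) * x = 2⁻¹ := by
      rw [hx, ENNReal.mul_inv (by simp) (by simp), mul_left_comm,
        ENNReal.mul_inv_cancel (by simpa using hN0.ne') (by simp), mul_one]
    rw [← (List.equivSigmaTuple (α := Letter F)).symm.tsum_eq, ENNReal.tsum_sigma']
    simp only [List.equivSigmaTuple, Equiv.coe_fn_symm_mk, List.length_ofFn, tsum_fintype,
      Finset.sum_const, Finset.card_univ, nsmul_eq_mul, ← Nat.card_eq_fintype_card, Nat.card_fun,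
      Nat.card_fin, Nat.cast_pow, ← mul_pow, ← hN, hx2]
    rw [ENNReal.tsum_geometric, ENNReal.one_sub_inv_two, inv_inv]
  calc partitionSum F c ω A l ≤ ∑' g : Equiv.Perm (Ray × F), ∑' z : Letter F × List (Letter F),
        Set.indicator {z | wordPerm ω z.1 z.2 = g} (fun z => 2 * N * x ^ z.2.length) z :=
        ENNReal.tsum_le_tsum hword
    _ = ∑' z : Letter F × List (Letter F), 2 * N * x ^ z.2.length := by
        rw [ENNReal.tsum_comm]
        refine tsum_congr fun z => ?_
        rw [tsum_eq_single (wordPerm ω z.1 z.2)]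
        · simp
        · intro g hg
          simp [hg.symm]
    _ = 4 * (N : ℝ≥0∞) ^ 2 := by
        rw [ENNReal.tsum_prod']
        simp only [ENNReal.tsum_mul_left, hlen, tsum_fintype, Finset.sum_const,
          Finset.card_univ, nsmul_eq_mul, ← Nat.card_eq_fintype_card, ← hN]
        ring
    _ ≤ _ := le_rfl

/-- The generators of `Γ_ω`, acting on the product of the rays with `F`. -/
def generators (F : Type*) [Group F] (ω : ℕ → Fin 3) : Set (Equiv.Perm (Ray × F)) :=
  insert (rootPerm F) (Set.range (letterPerm ω))

theorem Set.Finite.pow_monoid {G : Type*} [Monoid G] {S : Set G} (hS : S.Finite) (n : ℕ) :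
    (S ^ n).Finite := by
  induction n with
  | zero => simp
  | succ n ih => rw [pow_succ]; exact ih.mul hS

theorem finite_generators (F : Type*) [Group F] [Finite F] (ω : ℕ → Fin 3) :
    (generators F ω).Finite := (Set.finite_range _).insert _

theorem one_mem_generators (F : Type*) [Group F] (ω : ℕ → Fin 3) : 1 ∈ generators F ω :=
  Set.mem_insert_of_mem _ ⟨(none, 1), letterPerm_one ω⟩

/-- Every generator has initial weight at most `1 / 2`. -/
theorem hasWord_of_mem_pow {ω : ℕ → Fin 3} {n : ℕ} {g : Equiv.Perm (Ray × F)}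
    (hg : g ∈ generators F ω ^ n) : HasWord ω (1 / 2) (fun _ => 1) g (n / 2) := by
  induction n generalizing g with
  | zero =>
    rw [pow_zero, Set.mem_one] at hg
    subst hg
    simpa using hasWord_one ω (1 / 2) fun _ => 1
  | succ n ih =>
    rw [pow_succ', Set.mem_mul] at hg
    obtain ⟨s, hs, h, hh, rfl⟩ := hg
    have h1 := ih hh
    rcases hs with rfl | ⟨q, rfl⟩
    · refine h1.rootPerm_mul.mono ?_
      push_cast
      linarith
    · refine (h1.letterPerm_mul admissible_one q).mono ?_
      have : letterWeight (1 / 2) (fun _ => 1) q ≤ 1 / 2 := by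
        rcases q with ⟨_ | v, f⟩
        · simp only [letterWeight, least]
          split_ifs <;> norm_num
        · norm_num [letterWeight]
      push_cast
      linarith

/-- A Markov inequality: each element of the ball contributes at least `exp (-c n / 2)` to the sum.
-/
theorem ncard_mul_exp_le_partitionSum [Finite F] (c : ℝ) (ω : ℕ → Fin 3) (n : ℕ) :
    ((generators F ω ^ n).ncard : ℝ≥0∞) * ENNReal.ofReal (Real.exp (-(c * (n / 2)))) ≤
      partitionSum F c ω (1 / 2) fun _ => 1 := by
  have hfin : (generators F ω ^ n).Finite := (finite_generators F ω).pow_monoid n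
  rw [Set.ncard_eq_toFinset_card _ hfin, ← nsmul_eq_mul, ← Finset.sum_const]
  refine le_trans (Finset.sum_le_sum fun g hg => ?_) (ENNReal.sum_le_tsum hfin.toFinset)
  exact le_expWeight (hasWord_of_mem_pow (hfin.mem_toFinset.1 hg))

/-- The upper bound for the growth. -/
theorem log_ncard_generators_pow_le [Finite F] {D : ℝ} {ω : ℕ → Fin 3} {k n : ℕ}
    (hD : total (weights (fun _ => 1) ω k) ≤ D * least (weights (fun _ => 1) ω k))
    (hn : (n : ℝ) ≤ 2 ^ k * total (weights (fun _ => 1) ω k)) :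
    Real.log ((generators F ω ^ n).ncard) ≤
      (2 * D * Real.log (2 * Nat.card (Letter F)) +
        Real.log (8 * (Nat.card (Letter F) : ℝ) ^ 2)) * 2 ^ k := by
  set N := Nat.card (Letter F) with hN
  have hN0 : (1 : ℝ) ≤ N := by exact_mod_cast Nat.card_pos (α := Letter F)
  set l := weights (fun _ => 1) ω k with hl
  have hleast : 1 ≤ least l := le_least fun i =>
    admissible_one.le_weights ω i (Nat.zero_le k)
  -- With this `c` the sum at level `k` is bounded by a constant (`partitionSum_le_card`), and `c *
  -- total l` stays below `D * log (2 N)`.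
  set c := Real.log (2 * N) / least l with hc
  have hlog : 0 ≤ Real.log (2 * N) := Real.log_nonneg (by linarith)
  have hc0 : 0 ≤ c := div_nonneg hlog (by linarith)
  have hcl : c * least l = Real.log (2 * N) := div_mul_cancel₀ _ (by linarith)
  have hcM : c * total l ≤ D * Real.log (2 * N) := by
    rw [← hcl]
    nlinarith
  have hfin : (generators F ω ^ n).Finite := (finite_generators F ω).pow_monoid n
  have hpos : 0 < (generators F ω ^ n).ncard :=
    (Set.ncard_pos hfin).2 ⟨1, Set.one_mem_pow (one_mem_generators F ω)⟩
  obtain ⟨A', ω', hA', hZ⟩ := partitionSum_le_pow (F := F) hc0 admissible_one ω k (M := total l) le_rfl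
  have hZk := partitionSum_le_card (F := F) hc0 hA' ω'
    (by rw [← hl, hcl, Real.exp_log (by linarith)])
  have h1 : ((generators F ω ^ n).ncard : ℝ≥0∞) * ENNReal.ofReal (Real.exp (-(c * (n / 2)))) ≤
      (2 * ENNReal.ofReal (Real.exp (c * total l)) * (4 * (N : ℝ≥0∞) ^ 2)) ^ 2 ^ k := by
    refine (ncard_mul_exp_le_partitionSum c ω n).trans (le_trans ?_ (hZ.trans (by gcongr)))
    have : (1 : ℝ≥0∞) ≤ 2 * ENNReal.ofReal (Real.exp (c * total l)) := by
      have h2 : (1 : ℝ≥0∞) ≤ ENNReal.ofReal (Real.exp (c * total l)) := by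
        rw [ENNReal.one_le_ofReal]
        exact Real.one_le_exp (mul_nonneg hc0 (admissible_one.nonneg.trans
          ((admissible_one.le_total).trans (admissible_one.total_weights_mono ω (Nat.zero_le k)))))
      calc (1 : ℝ≥0∞) = 1 * 1 := by simp
        _ ≤ _ := mul_le_mul' (by norm_num) h2
    exact le_mul_of_one_le_left' this
  have h2 : ((generators F ω ^ n).ncard : ℝ) * Real.exp (-(c * (n / 2))) ≤
      (2 * Real.exp (c * total l) * (4 * (N : ℝ) ^ 2)) ^ 2 ^ k := by
    rw [← ENNReal.ofReal_le_ofReal_iff (by positivity), ENNReal.ofReal_mul (by positivity),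
      ENNReal.ofReal_pow (by positivity), ENNReal.ofReal_mul (by positivity),
      ENNReal.ofReal_mul (by positivity), ENNReal.ofReal_mul (by positivity),
      ENNReal.ofReal_pow (by positivity)]
    simpa using h1
  have h3 := Real.log_le_log (by positivity) h2
  rw [Real.log_mul (by positivity) (by positivity), Real.log_exp, Real.log_pow,
    show 2 * Real.exp (c * total l) * (4 * (N : ℝ) ^ 2) = Real.exp (c * total l) * (8 * (N : ℝ) ^ 2)
      by ring, Real.log_mul (by positivity) (by positivity), Real.log_exp] at h3
  push_cast at h3
  have h4 : c * n ≤ c * (2 ^ k * total l) := mul_le_mul_of_nonneg_left hn hc0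
  have h5 : 2 ^ k * (c * total l) ≤ 2 ^ k * (D * Real.log (2 * N)) :=
    mul_le_mul_of_nonneg_left hcM (by positivity)
  have h6 : 0 ≤ 2 ^ k * (D * Real.log (2 * N)) :=
    le_trans (by have := admissible_one.le_total.trans
                   (admissible_one.total_weights_mono ω (Nat.zero_le k))
                 have : 0 ≤ total l := by linarith
                 positivity) h5
  nlinarith

end Partition

/-! ### The lower bound: words whose inverted orbit is long -/

/-- The permutation `a vₙ … a v₁` given by a list `v₁, …, vₙ`. -/
def revPerm (ω : ℕ → Fin 3) : List KleinGen → Equiv.Perm Ray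
  | [] => 1
  | v :: L => revPerm ω L * rootGen * directedGen v ω

/-- The images of `ρ` under the prefixes of the word `a vₙ … a v₁` which end with `a`. -/
def orbitPoints (ω : ℕ → Fin 3) : List KleinGen → Set Ray
  | [] => ∅
  | _ :: L => insert (revPerm ω L (rootGen rightRay)) (orbitPoints ω L)

/-- The cyclic permutation of the three generators `b`, `c`, `d`. -/
def KleinGen.next : KleinGen → KleinGen
  | .b => .c
  | .c => .d
  | .d => .b

/-- The substitution which lifts words from the first level. -/
def liftWord (i : Fin 3) : List KleinGen → List KleinGen
  | [] => []
  | v :: L =>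
      if specialIdx v = i then v.next :: v :: v.next.next :: liftWord i L
      else v :: v :: liftWord i L

theorem switchGen_of_ne {v : KleinGen} {i : Fin 3} (h : specialIdx v ≠ i) :
    switchGen v i = rootGen := by
  rw [switchGen, if_pos ((switches_eq_true_iff v i).2 h)]

theorem switchGen_of_eq {v : KleinGen} {i : Fin 3} (h : specialIdx v = i) :
    switchGen v i = 1 := by
  rw [switchGen, if_neg fun h' => (switches_eq_true_iff v i).1 h' h]

theorem specialIdx_next_ne (v : KleinGen) : specialIdx v.next ≠ specialIdx v := by
  cases v <;> simp [KleinGen.next, specialIdx]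

theorem specialIdx_next_next_ne (v : KleinGen) : specialIdx v.next.next ≠ specialIdx v := by
  cases v <;> simp [KleinGen.next, specialIdx]

theorem directedGen_next_next_next (v : KleinGen) (ω : ℕ → Fin 3) (x : Ray) :
    directedGen v.next.next ω (directedGen v.next ω x) = directedGen v ω x := by
  have h := directedOpt_mul (some v.next.next) (some v.next) ω
  have h' : kleinMul (some v.next.next) (some v.next) = some v := by cases v <;> rfl
  rw [h'] at h
  exact DFunLike.congr_fun h x

/-- The sections of the lift of a word. -/
theorem revPerm_liftWord (ω : ℕ → Fin 3) (L : List KleinGen) :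
    (∀ x, revPerm ω (liftWord (ω 0) L) (consRay true x) =
        consRay true (revPerm (shiftSeq ω) L x) ∧
      revPerm ω (liftWord (ω 0) L) (consRay false x) =
        consRay false (rootGen (revPerm (shiftSeq ω) L (rootGen x)))) ∨
    (∀ x, revPerm ω (liftWord (ω 0) L) (consRay true x) =
        consRay false (rootGen (revPerm (shiftSeq ω) L x)) ∧
      revPerm ω (liftWord (ω 0) L) (consRay false x) =
        consRay true (revPerm (shiftSeq ω) L (rootGen x))) := by
  -- A switching letter lifts to `a v a v`, with sections `a v` below `1` and `v a = a (a v) a`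
  -- below `0`. A letter `v` that does not switch lifts to `a v'' a v a v'` with `v'' v' = v`; this
  -- has the same effect and also exchanges the children. The two alternatives record the parity of
  -- such letters.
  induction L with
  | nil => exact Or.inl fun x => ⟨rfl, by simp [liftWord, revPerm]⟩
  | cons v L ih =>
    by_cases hv : specialIdx v = ω 0
    · have h1 := switchGen_of_ne (hv ▸ specialIdx_next_ne v)
      have h2 := switchGen_of_ne (hv ▸ specialIdx_next_next_ne v)
      have h3 := switchGen_of_eq hv
      rcases ih with ih | ih
      · refine Or.inr fun x => ?_
        simp [liftWord, hv, revPerm, h1, h2, h3, ih, directedGen_next_next_next]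
      · refine Or.inl fun x => ?_
        simp [liftWord, hv, revPerm, h1, h2, h3, ih, directedGen_next_next_next]
    · have h1 := switchGen_of_ne hv
      rcases ih with ih | ih
      · refine Or.inl fun x => ?_
        simp [liftWord, hv, revPerm, h1, ih]
      · refine Or.inr fun x => ?_
        simp [liftWord, hv, revPerm, h1, ih]

/-- Every point `x` visited by a word gives two points visited by its lift, `1x` and `0(ax)`. They
are the images of `aρ = 0ρ` just before and just after the last entry of the lift of a letter, which
always switches. -/
theorem orbitPoints_liftWord (ω : ℕ → Fin 3) (L : List KleinGen) :
    consRay true '' orbitPoints (shiftSeq ω) L ∪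
      (fun x => consRay false (rootGen x)) '' orbitPoints (shiftSeq ω) L ⊆
      orbitPoints ω (liftWord (ω 0) L) := by
  have hρ : rootGen rightRay = consRay false rightRay := by
    conv_lhs => rw [rightRay_eq_consRay]
    simp
  induction L with
  | nil => simp [orbitPoints]
  | cons v L ih =>
    have key : ∀ u, switchGen u (ω 0) = rootGen → ({consRay true (revPerm (shiftSeq ω) L (rootGen rightRay)),
        consRay false (rootGen (revPerm (shiftSeq ω) L (rootGen rightRay)))} : Set Ray) ⊆
        {revPerm ω (u :: liftWord (ω 0) L) (rootGen rightRay),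
          revPerm ω (liftWord (ω 0) L) (rootGen rightRay)} := by
      intro u hu
      rcases revPerm_liftWord ω L with h | h
      · have e1 : revPerm ω (u :: liftWord (ω 0) L) (rootGen rightRay) =
            consRay true (revPerm (shiftSeq ω) L (rootGen rightRay)) := by
          rw [hρ]; simp [revPerm, hu, h, hρ]
        have e2 : revPerm ω (liftWord (ω 0) L) (rootGen rightRay) =
            consRay false (rootGen (revPerm (shiftSeq ω) L (rootGen rightRay))) := by
          rw [hρ, (h _).2]
          simp [hρ]
        rw [e1, e2]
      · have e1 : revPerm ω (u :: liftWord (ω 0) L) (rootGen rightRay) =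
            consRay false (rootGen (revPerm (shiftSeq ω) L (rootGen rightRay))) := by
          rw [hρ]; simp [revPerm, hu, h, hρ]
        have e2 : revPerm ω (liftWord (ω 0) L) (rootGen rightRay) =
            consRay true (revPerm (shiftSeq ω) L (rootGen rightRay)) := by
          rw [hρ, (h _).2]
          simp [hρ]
        rw [e1, e2, Set.pair_comm]
    have hsplit : consRay true '' orbitPoints (shiftSeq ω) (v :: L) ∪
      (fun x => consRay false (rootGen x)) '' orbitPoints (shiftSeq ω) (v :: L) ⊆
      {consRay true (revPerm (shiftSeq ω) L (rootGen rightRay)),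
        consRay false (rootGen (revPerm (shiftSeq ω) L (rootGen rightRay)))} ∪
      orbitPoints ω (liftWord (ω 0) L) := by
      simp only [orbitPoints, Set.image_insert_eq]
      rintro x ((rfl | hx) | (rfl | hx))
      · simp
      · exact Or.inr (ih (Or.inl hx))
      · simp
      · exact Or.inr (ih (Or.inr hx))
    refine hsplit.trans ?_
    by_cases hv : specialIdx v = ω 0
    · refine (Set.union_subset_union_left _
        (key v.next.next (switchGen_of_ne (hv ▸ specialIdx_next_next_ne v)))).trans ?_
      simp only [liftWord, hv, if_true, orbitPoints]
      rintro x ((rfl | rfl) | hx)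
      · simp
      · simp
      · simp [hx]
    · refine (Set.union_subset_union_left _ (key v (switchGen_of_ne hv))).trans ?_
      simp only [liftWord, hv, if_false, orbitPoints]
      rintro x ((rfl | rfl) | hx)
      · simp
      · simp
      · simp [hx]

theorem finite_orbitPoints (ω : ℕ → Fin 3) (L : List KleinGen) : (orbitPoints ω L).Finite := by
  induction L with
  | nil => exact Set.finite_empty
  | cons v L ih => exact ih.insert _

theorem two_mul_ncard_orbitPoints_le (ω : ℕ → Fin 3) (L : List KleinGen) :
    2 * (orbitPoints (shiftSeq ω) L).ncard ≤ (orbitPoints ω (liftWord (ω 0) L)).ncard := by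
  have hfin := finite_orbitPoints (shiftSeq ω) L
  refine le_trans (le_of_eq ?_) (Set.ncard_le_ncard (orbitPoints_liftWord ω L)
    (finite_orbitPoints _ _))
  rw [Set.ncard_union_eq _ (hfin.image _) (hfin.image _), two_mul,
    Set.ncard_image_of_injective _ (consRay_injective true),
    Set.ncard_image_of_injective _ (show Function.Injective fun x => consRay false (rootGen x) from
      (consRay_injective false).comp rootGen.injective)]
  rw [Set.disjoint_left]
  rintro _ ⟨x, -, rfl⟩ ⟨y, -, h⟩
  have := congrFun h 0
  simp at this

/-- The length of a list with respect to weights of the generators. -/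
noncomputable def weightedLength (l : Fin 3 → ℝ) : List KleinGen → ℝ
  | [] => 0
  | v :: L => l (specialIdx v) + weightedLength l L

theorem weightedLength_one (L : List KleinGen) : weightedLength (fun _ => 1) L = L.length := by
  induction L with
  | nil => simp [weightedLength]
  | cons v L ih => rw [weightedLength, ih, List.length_cons]; push_cast; ring

/-- The substitution is twice the transpose of `weightStep`: a letter with index `i` lifts to one
copy each of `b`, `c`, `d`, of weight `total l`, any other to two copies of itself. So the same
weights govern both bounds for the growth. -/
theorem weightedLength_liftWord (l : Fin 3 → ℝ) (i : Fin 3) (L : List KleinGen) :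
    weightedLength l (liftWord i L) = 2 * weightedLength (weightStep l i) L := by
  induction L with
  | nil => simp [liftWord, weightedLength]
  | cons v L ih =>
    by_cases hv : specialIdx v = i
    · simp only [liftWord, hv, if_true, weightedLength, ih, weightStep_self]
      subst hv
      cases v <;> simp [KleinGen.next, specialIdx, total] <;> ring
    · simp only [liftWord, hv, if_false, weightedLength, ih, weightStep_of_ne l hv]
      ring

/-- Lift the word with the single letter `v` through `k` levels. -/
theorem exists_orbitPoints (ω : ℕ → Fin 3) (l : Fin 3 → ℝ) (k : ℕ) (v : KleinGen) :
    ∃ L, weightedLength l L = 2 ^ k * weights l ω k (specialIdx v) ∧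
      2 ^ k ≤ (orbitPoints ω L).ncard := by
  induction k generalizing ω l with
  | zero => exact ⟨[v], by simp [weightedLength, weights], by simp [orbitPoints]⟩
  | succ k ih =>
    obtain ⟨L, h1, h2⟩ := ih (shiftSeq ω) (weightStep l (ω 0))
    refine ⟨liftWord (ω 0) L, ?_, ?_⟩
    · rw [weightedLength_liftWord, h1, weights_succ_eq_shiftSeq]
      ring
    · rw [pow_succ']
      exact (Nat.mul_le_mul_left 2 h2).trans (two_mul_ncard_orbitPoints_le ω L)

/-! ### Lamp configurations along an inverted orbit and the lower bound for the growth -/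

section Lamps

variable {F : Type*} [Group F]

/-- A lamp `f` attached to the letter `v` ends up at the image of `ρ` under the part of the word
that is applied later. Attaching a lamp to each letter thus realizes every configuration on the
orbit points without lengthening the word. -/
theorem twist_mul_liftRay_revPerm_mem (ω : ℕ → Fin 3) (L : List KleinGen) (φ : Ray → F)
    (hφ : ∀ x, x ∉ orbitPoints ω L → φ x = 1) :
    twist φ * liftRay F (revPerm ω L) ∈ generators F ω ^ (2 * L.length) := by
  induction L generalizing φ with
  | nil =>
    have : φ = 1 := funext fun x => hφ x (by simp [orbitPoints])
    simp [this, revPerm]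
  | cons v L ih =>
    set x₀ := revPerm ω L (rootGen rightRay) with hx₀
    -- The letter `v` is responsible for the value at `x₀`, unless `x₀` is also an orbit point of
    -- `L`; then its lamp is left trivial.
    obtain ⟨ψ, f, hψ, hf⟩ : ∃ (ψ : Ray → F) (f : F), (∀ x, x ∉ orbitPoints ω L → ψ x = 1) ∧
        φ = ψ * lampAt x₀ f := by
      by_cases h : x₀ ∈ orbitPoints ω L
      · refine ⟨φ, 1, fun x hx => hφ x ?_, by simp⟩
        rintro (rfl | hx')
        · exact hx h
        · exact hx hx'
      · refine ⟨φ * lampAt x₀ (φ x₀)⁻¹, φ x₀, fun x hx => ?_, ?_⟩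
        · by_cases hxx : x = x₀
          · simp [lampAt_apply, hxx]
          · have : φ x = 1 := hφ x (by rintro (h' | h') <;> contradiction)
            simp [lampAt_apply, hxx, this]
        · rw [mul_assoc, ← map_mul]
          simp
    have h1 := liftRay_mul_twist_lampAt (revPerm ω L * rootGen) rightRay f
    have h2 := liftRay_mul_twist_lampAt (directedGen v ω) rightRay f
    rw [directedGen_rightRay] at h2
    have key : twist φ * liftRay F (revPerm ω (v :: L)) =
        twist ψ * liftRay F (revPerm ω L) * (rootPerm F * letterPerm ω (some v, f)) := by
      have h3 : letterPerm ω (some v, f) =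
          twist (lampAt rightRay f) * liftRay F (directedGen v ω) := h2
      have h4 : liftRay F (revPerm ω L) * (rootPerm F * twist (lampAt rightRay f)) =
          twist (lampAt x₀ f) * (liftRay F (revPerm ω L) * rootPerm F) := by
        rw [← mul_assoc, rootPerm, ← map_mul]
        exact h1
      have h5 : liftRay F (revPerm ω (v :: L)) =
          liftRay F (revPerm ω L) * rootPerm F * liftRay F (directedGen v ω) := rfl
      rw [h3, hf, map_mul, h5, mul_assoc (twist ψ), mul_assoc (twist ψ), ← mul_assoc _ (rootPerm F),
        ← mul_assoc (twist _) _ (liftRay F (directedGen v ω)), ← h4]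
      simp only [mul_assoc]
    rw [key, List.length_cons, show 2 * (L.length + 1) = 2 * L.length + 2 by ring, pow_add, sq]
    exact Set.mul_mem_mul (ih ψ hψ) (Set.mul_mem_mul (Set.mem_insert _ _)
      (Set.mem_insert_of_mem _ ⟨_, rfl⟩))

theorem twist_injective : Function.Injective (twist : (Ray → F) → Equiv.Perm (Ray × F)) := by
  intro φ ψ h
  funext x
  have := congrArg Prod.snd (DFunLike.congr_fun h (x, (1 : F)))
  simpa using this

/-- The lower bound for the growth. -/
theorem two_pow_le_ncard_generators_pow [Finite F] [Nontrivial F] (ω : ℕ → Fin 3) {k n : ℕ}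
    (hn : 2 ^ k * total (weights (fun _ => 1) ω k) ≤ n) :
    2 ^ 2 ^ k ≤ (generators F ω ^ n).ncard := by
  classical
  -- Lifting the generator of least weight gives a shortest word; as twice the least weight is below
  -- the total, its `2 * L.length` letters fit into `n`.
  obtain ⟨i, hi⟩ := exists_eq_least (weights (fun _ => 1) ω k)
  obtain ⟨v, rfl⟩ : ∃ v, specialIdx v = i := by
    fin_cases i
    · exact ⟨.d, rfl⟩
    · exact ⟨.c, rfl⟩
    · exact ⟨.b, rfl⟩
  obtain ⟨L, hL, hcard⟩ := exists_orbitPoints ω (fun _ => 1) k v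
  rw [weightedLength_one] at hL
  have hlen : 2 * L.length ≤ n := by
    have h0 : 2 * weights (fun _ => 1) ω k (specialIdx v) ≤ total (weights (fun _ => 1) ω k) := by
      have h1 := admissible_one.le_weights ω (specialIdx v) (Nat.zero_le k)
      simp only [weights] at h1
      simp only [total]
      linarith [least_le (weights (fun _ => 1) ω k) 0, least_le (weights (fun _ => 1) ω k) 1,
        least_le (weights (fun _ => 1) ω k) 2]
    have h2 : (2 : ℝ) ^ k * (2 * weights (fun _ => 1) ω k (specialIdx v)) ≤ n :=
      (mul_le_mul_of_nonneg_left h0 (by positivity)).trans hn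
    have : ((2 * L.length : ℕ) : ℝ) ≤ n := by
      push_cast
      rw [hL]
      linarith
    exact_mod_cast this
  set P := orbitPoints ω L
  have hPfin : P.Finite := finite_orbitPoints ω L
  have := hPfin.to_subtype
  have hfin : (generators F ω ^ n).Finite := (finite_generators F ω).pow_monoid n
  have := hfin.to_subtype
  let e : (P → F) → (generators F ω ^ n : Set (Equiv.Perm (Ray × F))) := fun h =>
    ⟨twist (fun x => if hx : x ∈ P then h ⟨x, hx⟩ else 1) * liftRay F (revPerm ω L),
      Set.pow_subset_pow_right (one_mem_generators F ω) hlen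
        (twist_mul_liftRay_revPerm_mem ω L _ fun x hx => by
          have : x ∉ P := hx
          simp [this])⟩
  have he : Function.Injective e := by
    intro h h' hh
    have := twist_injective (mul_right_cancel (Subtype.ext_iff.1 hh))
    funext x
    simpa using congrFun this x
  have hle := Nat.card_le_card_of_injective e he
  rw [Nat.card_fun, Nat.card_coe_set_eq, Nat.card_coe_set_eq] at hle
  refine le_trans ?_ hle
  calc 2 ^ 2 ^ k ≤ Nat.card F ^ 2 ^ k := Nat.pow_le_pow_left Finite.one_lt_card _
    _ ≤ _ := Nat.pow_le_pow_right Nat.card_pos hcard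

end Lamps

/-! ### Growth functions of different generating sets -/

section Growth

variable {G : Type*} [Group G]

theorem ncard_mul_le_mul_ncard (S T : Set G) : (S * T).ncard ≤ S.ncard * T.ncard := by
  simpa [Nat.card_coe_set_eq] using Set.natCard_mul_le (s := S) (t := T)

theorem ncard_pow_le (S : Set G) (n : ℕ) : (S ^ n).ncard ≤ S.ncard ^ n := by
  induction n with
  | zero => rw [pow_zero, pow_zero, ← Set.singleton_one, Set.ncard_singleton]
  | succ n ih =>
    rw [pow_succ, pow_succ]
    exact (ncard_mul_le_mul_ncard _ _).trans (Nat.mul_le_mul_right _ ih)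

theorem IsGeneratingSet.exists_mem_pow {S : Set G} (hS : IsGeneratingSet S) (g : G) :
    ∃ n, g ∈ S ^ n := by
  have hg : g ∈ Subgroup.closure S := hS.generates ▸ Subgroup.mem_top g
  induction hg using Subgroup.closure_induction with
  | mem x hx => exact ⟨1, by simpa using hx⟩
  | one => exact ⟨0, by simp⟩
  | mul x y _ _ hx hy =>
    obtain ⟨m, hm⟩ := hx
    obtain ⟨n, hn⟩ := hy
    exact ⟨m + n, pow_add S m n ▸ Set.mul_mem_mul hm hn⟩
  | inv x _ hx =>
    obtain ⟨n, hn⟩ := hx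
    refine ⟨n, ?_⟩
    rw [← Set.inv_mem_inv, ← inv_pow, hS.symm] at hn
    exact hn

theorem IsGeneratingSet.exists_subset_pow {S T : Set G} (hS : IsGeneratingSet S) (hT : T.Finite) :
    ∃ n, T ⊆ S ^ n := by
  induction T, hT using Set.Finite.induction_on with
  | empty => exact ⟨0, Set.empty_subset _⟩
  | insert _ _ ih =>
    rename_i g T _ _
    obtain ⟨m, hm⟩ := ih
    obtain ⟨n, hn⟩ := hS.exists_mem_pow g
    refine ⟨m + n, Set.insert_subset ?_ (hm.trans ?_)⟩
    · exact Set.pow_subset_pow_right hS.one_mem (Nat.le_add_left n m) hn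
    · exact Set.pow_subset_pow_right hS.one_mem (Nat.le_add_right m n)

theorem IsGeneratingSet.exists_growth_le {S T : Set G} (hS : IsGeneratingSet S)
    (hT : IsGeneratingSet T) : ∃ n : ℕ, 0 < n ∧ ∀ r, growth T r ≤ growth S r ^ n := by
  obtain ⟨n, hn⟩ := hS.exists_subset_pow hT.finite
  have hn' : T ⊆ S ^ (n + 1) := hn.trans (Set.pow_subset_pow_right hS.one_mem n.le_succ)
  refine ⟨n + 1, n.succ_pos, fun r => ?_⟩
  refine le_trans (Set.ncard_le_ncard (t := (S ^ r) ^ (n + 1)) ?_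
    ((hS.finite.pow_monoid r).pow_monoid _)) (ncard_pow_le _ _)
  rw [← pow_mul, mul_comm, pow_mul]
  exact Set.pow_subset_pow_left hn'

end Growth

/-! ### The groups `Γ_ω` -/

section Gamma

variable {F : Type*} [Group F]

open Classical in
/-- Extension of a function on a set of rays by `1`. -/
noncomputable def extendOne (X : Set Ray) : (X → F) →* (Ray → F) where
  toFun φ x := if hx : x ∈ X then φ ⟨x, hx⟩ else 1
  map_one' := by funext x; simp
  map_mul' φ ψ := by funext x; by_cases hx : x ∈ X <;> simp [hx]

theorem extendOne_of_mem {X : Set Ray} (φ : X → F) {x : Ray} (hx : x ∈ X) :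
    extendOne X φ x = φ ⟨x, hx⟩ := by simp [extendOne, hx]

theorem extendOne_of_notMem {X : Set Ray} (φ : X → F) {x : Ray} (hx : x ∉ X) :
    extendOne X φ x = 1 := by simp [extendOne, hx]

/-- The orbit of `ρ` under `G_ω`. -/
abbrev rayOrbit (ω : ℕ → Fin 3) : Set Ray := MulAction.orbit (treeGroup ω) rightRay

/-- The action of `Γ_ω` on the product of the rays with `F`. -/
noncomputable def gammaPerm (F : Type*) [Group F] (ω : ℕ → Fin 3) :
    GammaGroup F ω →* Equiv.Perm (Ray × F) :=
  SemidirectProduct.lift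
    (twist.comp ((extendOne (rayOrbit ω)).comp (finSuppFun (rayOrbit ω) F).subtype))
    ((liftRay F).comp (treeGroup ω).subtype) (by
      intro g
      ext1 φ
      change twist _ = liftRay F g.1 * twist _ * (liftRay F g.1)⁻¹
      rw [liftRay_mul_twist, mul_inv_cancel_right]
      congr 1
      funext x
      have hx : (g.1⁻¹ : Equiv.Perm Ray) x ∈ rayOrbit ω ↔ x ∈ rayOrbit ω := by
        rw [rayOrbit, ← MulAction.orbit_eq_iff, ← MulAction.orbit_eq_iff (a := x)]
        rw [show (g.1⁻¹ : Equiv.Perm Ray) x = g⁻¹ • x from rfl, MulAction.orbit_smul]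
      by_cases h : x ∈ rayOrbit ω
      · simp only [MonoidHom.coe_comp, Function.comp_apply]
        rw [extendOne_of_mem _ h, extendOne_of_mem _ (hx.2 h)]
        rfl
      · simp only [MonoidHom.coe_comp, Function.comp_apply]
        rw [extendOne_of_notMem _ h, extendOne_of_notMem _ (mt hx.1 h)])

theorem gammaPerm_inl (ω : ℕ → Fin 3) (φ : finSuppFun (rayOrbit ω) F) :
    gammaPerm F ω (SemidirectProduct.inl φ) = twist (extendOne (rayOrbit ω) φ.1) := by
  simp [gammaPerm]

theorem gammaPerm_inr (ω : ℕ → Fin 3) (g : treeGroup ω) :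
    gammaPerm F ω (SemidirectProduct.inr g) = liftRay F g.1 := by
  simp [gammaPerm]

/-- Faithfulness allows the growth to be computed in `Equiv.Perm (Ray × F)`, common to all `ω`. -/
theorem gammaPerm_injective (ω : ℕ → Fin 3) : Function.Injective (gammaPerm F ω) := by
  rw [injective_iff_map_eq_one]
  intro z hz
  rw [← SemidirectProduct.inl_left_mul_inr_right z, map_mul, gammaPerm_inl, gammaPerm_inr] at hz
  have hr : z.right = 1 := by
    refine Subtype.ext (Equiv.ext fun x => ?_)
    have := congrArg Prod.fst (DFunLike.congr_fun hz (x, (1 : F)))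
    simpa using this
  have hl : z.left = 1 := by
    refine Subtype.ext (funext fun x => ?_)
    rw [hr] at hz
    have := congrArg Prod.snd (DFunLike.congr_fun hz (x.1, (1 : F)))
    simpa [extendOne_of_mem _ x.2] using this
  exact SemidirectProduct.ext hl hr

theorem rootGen_mem_treeGroup (ω : ℕ → Fin 3) : rootGen ∈ treeGroup ω :=
  Subgroup.subset_closure (by simp)

theorem directedGen_mem_treeGroup (v : KleinGen) (ω : ℕ → Fin 3) :
    directedGen v ω ∈ treeGroup ω :=
  Subgroup.subset_closure (by cases v <;> simp)

/-- The function on the orbit of `ρ` with a single value different from `1`. -/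
noncomputable def orbitLamp {ω : ℕ → Fin 3} (x : rayOrbit ω) (f : F) :
    finSuppFun (rayOrbit ω) F := by
  classical
  exact ⟨Pi.mulSingle x f, (Set.finite_singleton x).subset Pi.mulSupport_mulSingle_subset⟩

theorem extendOne_orbitLamp {ω : ℕ → Fin 3} (x : rayOrbit ω) (f : F) :
    extendOne (rayOrbit ω) (orbitLamp x f).1 = lampAt x.1 f := by
  funext y
  rw [lampAt_apply]
  by_cases hy : y ∈ rayOrbit ω
  · rw [extendOne_of_mem _ hy]
    by_cases hyx : y = x.1
    · rw [if_pos hyx, show (⟨y, hy⟩ : rayOrbit ω) = x from Subtype.ext hyx]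
      simp [orbitLamp]
    · rw [if_neg hyx]
      have : (⟨y, hy⟩ : rayOrbit ω) ≠ x := fun h => hyx (congrArg Subtype.val h)
      simp [orbitLamp, this]
  · rw [extendOne_of_notMem _ hy, if_neg]
    rintro rfl
    exact hy x.2

/-- The ray `ρ` as a point of its orbit. -/
def orbitBase (ω : ℕ → Fin 3) : rayOrbit ω := ⟨rightRay, MulAction.mem_orbit_self _⟩

/-- The generators of `Γ_ω`. -/
def gammaGenerators (F : Type*) [Group F] (ω : ℕ → Fin 3) : Set (GammaGroup F ω) :=
  gammaPerm F ω ⁻¹' generators F ω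

theorem generators_subset_range (ω : ℕ → Fin 3) :
    generators F ω ⊆ Set.range (gammaPerm F ω) := by
  rintro _ (rfl | ⟨⟨v, f⟩, rfl⟩)
  · exact ⟨SemidirectProduct.inr ⟨rootGen, rootGen_mem_treeGroup ω⟩, gammaPerm_inr _ _⟩
  · have hv : directedOpt v ω ∈ treeGroup ω := by
      cases v
      · exact one_mem _
      · exact directedGen_mem_treeGroup _ ω
    refine ⟨SemidirectProduct.inr ⟨_, hv⟩ * SemidirectProduct.inl (orbitLamp (orbitBase ω) f), ?_⟩
    rw [map_mul, gammaPerm_inl, gammaPerm_inr, extendOne_orbitLamp]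
    rfl

theorem image_gammaGenerators (ω : ℕ → Fin 3) :
    gammaPerm F ω '' gammaGenerators F ω = generators F ω :=
  Set.image_preimage_eq_of_subset (generators_subset_range ω)

theorem growth_gammaGenerators (ω : ℕ → Fin 3) (r : ℕ) :
    growth (gammaGenerators F ω) r = (generators F ω ^ r).ncard := by
  rw [growth, ← Set.ncard_image_of_injective _ (gammaPerm_injective ω), Set.image_pow,
    image_gammaGenerators]

theorem inr_mem_closure (ω : ℕ → Fin 3) (g : treeGroup ω) :
    SemidirectProduct.inr g ∈ Subgroup.closure (gammaGenerators F ω) := by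
  obtain ⟨g, hg⟩ := g
  induction hg using Subgroup.closure_induction with
  | mem x hx =>
    refine Subgroup.subset_closure ?_
    rw [gammaGenerators, Set.mem_preimage, gammaPerm_inr]
    have h : ∀ v, liftRay F (directedGen v ω) ∈ generators F ω := fun v =>
      Set.mem_insert_of_mem _ ⟨(some v, 1), by simp [letterPerm, directedOpt]⟩
    rcases hx with rfl | rfl | rfl | rfl
    · exact Set.mem_insert _ _
    · exact h _
    · exact h _
    · exact h _
  | one => exact one_mem _
  | mul x y hx hy ihx ihy =>
    have := mul_mem ihx ihy
    rw [← map_mul] at this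
    exact this
  | inv x hx ih =>
    have := inv_mem ih
    rw [← map_inv] at this
    exact this

theorem orbitLamp_mem_closure {ω : ℕ → Fin 3} (x : rayOrbit ω) (f : F) :
    (SemidirectProduct.inl (orbitLamp x f) : GammaGroup F ω) ∈
      Subgroup.closure (gammaGenerators F ω) := by
  obtain ⟨g, hg⟩ := x.2
  have key : (SemidirectProduct.inl (orbitLamp x f) : GammaGroup F ω) =
      SemidirectProduct.inr g * SemidirectProduct.inl (orbitLamp (orbitBase ω) f) *
        (SemidirectProduct.inr g)⁻¹ := by
    refine gammaPerm_injective ω ?_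
    rw [map_mul, map_mul, map_inv, gammaPerm_inl, gammaPerm_inl, gammaPerm_inr,
      extendOne_orbitLamp, extendOne_orbitLamp, liftRay_mul_twist_lampAt, mul_inv_cancel_right]
    rw [show x.1 = g.1 rightRay from hg.symm]
    rfl
  rw [key]
  refine mul_mem (mul_mem (inr_mem_closure ω g) (Subgroup.subset_closure ?_))
    (inv_mem (inr_mem_closure ω g))
  rw [gammaGenerators, Set.mem_preimage, gammaPerm_inl, extendOne_orbitLamp]
  exact Set.mem_insert_of_mem _ ⟨(none, f), by simp [letterPerm, directedOpt, orbitBase]⟩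

theorem inl_mem_closure {ω : ℕ → Fin 3} (φ : finSuppFun (rayOrbit ω) F) :
    (SemidirectProduct.inl φ : GammaGroup F ω) ∈ Subgroup.closure (gammaGenerators F ω) := by
  classical
  have h : (Function.mulSupport φ.1).Finite := φ.2
  obtain ⟨s, hs⟩ : ∃ s : Finset (rayOrbit ω), ∀ x, x ∉ s → φ.1 x = 1 :=
    ⟨h.toFinset, fun x hx => by simpa using hx⟩
  induction s using Finset.induction_on generalizing φ with
  | empty =>
    have : φ = 1 := Subtype.ext (funext fun x => hs x (by simp))
    rw [this, map_one]
    exact one_mem _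
  | insert x s _ ih =>
    have h1 := ih (φ * orbitLamp x (φ.1 x)⁻¹) (Subgroup.mem_carrier.1 (φ * orbitLamp x (φ.1 x)⁻¹).2)
      fun y hy => by
        by_cases hyx : y = x
        · subst hyx
          simp [orbitLamp]
        · have := hs y (by simp [hyx, hy])
          simp [orbitLamp, hyx, this]
    have h2 := mul_mem h1 (orbitLamp_mem_closure x (φ.1 x))
    rw [← map_mul] at h2
    convert h2 using 2
    ext y
    by_cases hyx : y = x
    · subst hyx
      simp [orbitLamp]
    · simp [orbitLamp, hyx]

theorem letterPerm_inv (ω : ℕ → Fin 3) (q : Letter F) :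
    (letterPerm ω q)⁻¹ = letterPerm ω (q.1, q.2⁻¹) := by
  rw [inv_eq_iff_mul_eq_one, letterPerm_mul]
  have : letterMul q (q.1, q.2⁻¹) = (none, 1) := by
    obtain ⟨_ | v, f⟩ := q
    · simp [letterMul, kleinMul]
    · cases v <;> simp [letterMul, kleinMul]
  rw [this, letterPerm_one]

theorem generators_inv (ω : ℕ → Fin 3) : (generators F ω)⁻¹ = generators F ω := by
  have h : ∀ g ∈ generators F ω, g⁻¹ ∈ generators F ω := by
    rintro _ (rfl | ⟨q, rfl⟩)
    · rw [inv_eq_of_mul_eq_one_left rootPerm_mul_self]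
      exact Set.mem_insert _ _
    · exact Set.mem_insert_of_mem _ ⟨_, (letterPerm_inv ω q).symm⟩
  exact Set.Subset.antisymm (fun g hg => by simpa using h _ hg) fun g hg => h g hg

theorem isGeneratingSet_gammaGenerators [Finite F] (ω : ℕ → Fin 3) :
    IsGeneratingSet (gammaGenerators F ω) where
  finite := (finite_generators F ω).preimage (gammaPerm_injective ω).injOn
  one_mem := by
    rw [gammaGenerators, Set.mem_preimage, map_one]
    exact one_mem_generators F ω
  symm := by
    ext z
    rw [Set.mem_inv, gammaGenerators, Set.mem_preimage, map_inv, ← Set.mem_inv, generators_inv]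
    rfl
  generates := by
    rw [eq_top_iff]
    intro z _
    rw [← SemidirectProduct.inl_left_mul_inr_right z]
    exact mul_mem (inl_mem_closure _) (inr_mem_closure ω _)

theorem gammaGroup_fg [Finite F] (ω : ℕ → Fin 3) : Group.FG (GammaGroup F ω) := by
  have h := isGeneratingSet_gammaGenerators (F := F) ω
  exact Group.fg_iff.2 ⟨_, h.generates, h.finite⟩

/-- The growth of `Γ_ω` is determined up to constants by the total weights. -/
theorem exists_abs_log_log_growth_sub_le [Finite F] [Nontrivial F] {ω : ℕ → Fin 3} {D : ℝ}
    (hD : ∀ k, total (weights (fun _ => 1) ω k) ≤ D * least (weights (fun _ => 1) ω k))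
    {S : Set (GammaGroup F ω)} (hS : IsGeneratingSet S) :
    ∃ C : ℝ, ∀ k r : ℕ, 2 ^ k * total (weights (fun _ => 1) ω k) ≤ r →
      r ≤ 2 ^ (k + 1) * total (weights (fun _ => 1) ω (k + 1)) →
      0 < Real.log (growth S r) ∧
      |Real.log (Real.log (growth S r)) - k * Real.log 2| ≤ C := by
  have hT := isGeneratingSet_gammaGenerators (F := F) ω
  -- A change of generating set changes the growth by fixed powers at the same radius, hence `log
  -- log` by a bounded amount.
  obtain ⟨m, hm, hm'⟩ := hS.exists_growth_le hT
  obtain ⟨n, hn, hn'⟩ := hT.exists_growth_le hS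
  set K : ℝ := 2 * D * Real.log (2 * Nat.card (Letter F)) +
        Real.log (8 * (Nat.card (Letter F) : ℝ) ^ 2) with hK
  have hlog2 : 0 < Real.log 2 := Real.log_pos (by norm_num)
  refine ⟨|Real.log (Real.log 2 / m)| + |Real.log (2 * n * K)|, fun k r h1 h2 => ?_⟩
  have hlow := two_pow_le_ncard_generators_pow (F := F) ω h1
  have hupp := log_ncard_generators_pow_le (F := F) (hD (k + 1)) h2
  rw [← growth_gammaGenerators] at hlow hupp
  rw [← hK] at hupp
  set x := growth S r
  set y := growth (gammaGenerators F ω) r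
  have hy : (2 : ℝ) ^ k * Real.log 2 ≤ Real.log y := by
    have : ((2 : ℝ) ^ 2 ^ k) ≤ y := by exact_mod_cast hlow
    have := Real.log_le_log (by positivity) this
    rwa [Real.log_pow, Nat.cast_pow, Nat.cast_ofNat] at this
  have hypos : 0 < y := lt_of_lt_of_le (by positivity) hlow
  have hxpos : 0 < x := by
    rcases Nat.eq_zero_or_pos x with h | h
    · have := hm' r
      rw [show growth S r = 0 from h, zero_pow hm.ne'] at this
      exact absurd this (by have : 0 < growth (gammaGenerators F ω) r := hypos
                            omega)
    · exact h
  have hyx : Real.log y ≤ m * Real.log x := by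
    have : (y : ℝ) ≤ (x : ℝ) ^ m := by exact_mod_cast hm' r
    have := Real.log_le_log (by positivity) this
    rwa [Real.log_pow] at this
  have hxy : Real.log x ≤ n * Real.log y := by
    have : (x : ℝ) ≤ (y : ℝ) ^ n := by exact_mod_cast hn' r
    have := Real.log_le_log (by positivity) this
    rwa [Real.log_pow] at this
  have hm0 : (0 : ℝ) < m := by exact_mod_cast hm
  have hn0 : (0 : ℝ) < n := by exact_mod_cast hn
  have h3 : 2 ^ k * (Real.log 2 / m) ≤ Real.log x := by
    rw [mul_div_assoc', div_le_iff₀ hm0]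
    linarith
  have h4 : Real.log x ≤ 2 ^ k * (2 * n * K) := by
    calc Real.log x ≤ n * Real.log y := hxy
      _ ≤ n * (K * 2 ^ (k + 1)) := mul_le_mul_of_nonneg_left hupp hn0.le
      _ = _ := by ring
  have hpos : 0 < Real.log x := lt_of_lt_of_le (by positivity) h3
  have hKpos : 0 < 2 * n * K := by
    by_contra hcon
    have : (2 : ℝ) ^ k * (2 * n * K) ≤ 0 :=
      mul_nonpos_of_nonneg_of_nonpos (by positivity) (not_lt.1 hcon)
    linarith
  refine ⟨hpos, ?_⟩
  have h5 := Real.log_le_log (by positivity) h3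
  have h6 := Real.log_le_log hpos h4
  rw [Real.log_mul (by positivity) (by positivity), Real.log_pow] at h5 h6
  rw [abs_le]
  constructor
  · linarith [neg_abs_le (Real.log (Real.log 2 / m)), abs_nonneg (Real.log (2 * n * K))]
  · linarith [le_abs_self (Real.log (2 * n * K)), abs_nonneg (Real.log (Real.log 2 / m))]

end Gamma

/-! ### Passages of zigzag functions -/

theorem exists_log_mem_Icc {u : ℝ} (hu : 1 ≤ u) :
    ∃ r : ℕ, 2 ≤ r ∧ u ≤ Real.log r ∧ Real.log r ≤ u + 1 := by
  have h0 : 2 ≤ Real.exp u := by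
    have := Real.add_one_le_exp u
    linarith
  have h1 : Real.exp u ≤ ⌈Real.exp u⌉₊ := Nat.le_ceil _
  have h2 : (⌈Real.exp u⌉₊ : ℝ) < Real.exp u + 1 := Nat.ceil_lt_add_one (Real.exp_pos _).le
  refine ⟨⌈Real.exp u⌉₊, ?_, ?_, ?_⟩
  · exact_mod_cast h0.trans h1
  · rw [Real.le_log_iff_exp_le (by linarith)]
    exact h1
  · rw [Real.log_le_iff_le_exp (by linarith), Real.exp_add]
    have := Real.add_one_le_exp (1 : ℝ)
    nlinarith

theorem exists_le_and_lt_succ {x : ℕ → ℝ} (hx : Tendsto x atTop atTop) {t : ℝ} {n : ℕ}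
    (hn : x n ≤ t) : ∃ j, n ≤ j ∧ x j ≤ t ∧ t < x (j + 1) := by
  by_contra! hcon
  have hall : ∀ j, n ≤ j → x j ≤ t := fun j hj => by
    induction j, hj using Nat.le_induction with
    | base => exact hn
    | succ j hj ih => exact hcon j hj ih
  obtain ⟨J, hJ⟩ := (hx.eventually_gt_atTop t).exists_forall_of_atTop
  exact absurd (hall (max n J) (le_max_left _ _)) (not_le.2 (hJ _ (le_max_right _ _)))

/-- For large `x` the bounded error is smaller than `|ν - R| * log x`, so every `ν > R` is admitted
and no `ν < R`. -/
theorem passageExponent_eq_of_log {A B : Set ℕ} {R K : ℝ} {N : ℕ} (hR : 0 ≤ R)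
    (h : ∀ x y, N ≤ x → IsPassage A B x y → |Real.log y - R * Real.log x| ≤ K)
    (hex : ∀ M : ℕ, ∃ x y, M ≤ x ∧ IsPassage A B x y) :
    passageExponent A B = ENNReal.ofReal R := by
  have hlog : Tendsto (fun x : ℕ => Real.log x) atTop atTop :=
    Real.tendsto_log_atTop.comp tendsto_natCast_atTop_atTop
  have hle : ∀ {x y : ℕ} {ν : ℝ}, 1 ≤ x → x < y →
      ((y : ℝ) ≤ (x : ℝ) ^ ν ↔ Real.log y ≤ ν * Real.log x) := by
    intro x y ν hx hxy
    have hx' : (0 : ℝ) < x := by exact_mod_cast hx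
    have hy' : (0 : ℝ) < y := by exact_mod_cast hx.trans hxy.le
    rw [← Real.log_le_log_iff hy' (Real.rpow_pos_of_pos hx' _), Real.log_rpow hx']
  apply le_antisymm
  · refine le_of_forall_gt fun ν' hν' => ?_
    obtain ⟨ν, hν1, hν2⟩ := ENNReal.lt_iff_exists_nnreal_btwn.1 hν'
    refine lt_of_le_of_lt (iInf₂_le ν ?_) hν2
    have hRν : R < ν := by
      rw [← ENNReal.ofReal_coe_nnreal] at hν1
      exact (ENNReal.ofReal_lt_ofReal_iff_of_nonneg hR).1 hν1
    obtain ⟨M, hM⟩ := eventually_atTop.1 (hlog.eventually_ge_atTop (K / (ν - R)))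
    refine ⟨max (max N M) 1, fun x y hx hxy => ?_⟩
    have h1 := (abs_le.1 (h x y (by omega) hxy)).2
    have h2 := hM x (by omega)
    rw [div_le_iff₀ (by linarith)] at h2
    rw [hle (by omega) hxy.lt]
    linarith
  · refine le_iInf₂ fun ν hν => ?_
    obtain ⟨N', hN'⟩ := hν
    rw [← ENNReal.ofReal_coe_nnreal]
    refine ENNReal.ofReal_le_ofReal ?_
    by_contra hcon
    rw [not_le] at hcon
    obtain ⟨M, hM⟩ := eventually_atTop.1 (hlog.eventually_gt_atTop (K / (R - ν)))
    obtain ⟨x, y, hx, hxy⟩ := hex (max (max N M) (max N' 1))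
    have h1 := (abs_le.1 (h x y (by omega) hxy)).1
    have h2 := hM x (by omega)
    rw [div_lt_iff₀ (by linarith)] at h2
    have h3 := (hle (by omega) hxy.lt).1 (hN' x y (by omega) hxy)
    linarith

/-- Take the first element of `B` after `w`, then the last element of `A` before it. -/
theorem exists_isPassage {A B : Set ℕ} {w z : ℕ} (hw : w ∈ A) (hz : z ∈ B) (hwz : w < z)
    (hAB : Disjoint A B) : ∃ x y, w ≤ x ∧ IsPassage A B x y := by
  classical
  have hex : ∃ q, w < q ∧ q ∈ B := ⟨z, hwz, hz⟩
  obtain ⟨hq1, hq2⟩ := Nat.find_spec hex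
  set q := Nat.find hex
  have hmax := Nat.findGreatest_spec (P := fun r => r ∈ A) (n := q) hq1.le hw
  have hle := Nat.le_findGreatest (P := fun r => r ∈ A) (n := q) hq1.le hw
  set r := Nat.findGreatest (fun r => r ∈ A) q with hr
  have hrq : r < q := by
    refine lt_of_le_of_ne (Nat.findGreatest_le _) fun h => ?_
    rw [h] at hmax
    exact Set.disjoint_left.1 hAB hmax hq2
  refine ⟨r, q, hle, hmax, hq2, hrq, fun t ht1 ht2 ht => ?_⟩
  rcases ht with ht | ht
  · have := Nat.le_findGreatest (P := fun r => r ∈ A) (n := q) ht2.le ht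
    omega
  · exact Nat.find_min hex ht2 ⟨by omega, ht⟩

/-- The function `f(r) log r` follows, up to a bounded error, lines of slope `c` between the
corners with even and with odd index, and lines of slope `c'` between the corners with odd and with
even index; in the corners, `f` is close to `a` and to `b` in turn. -/
structure IsZigzag (f : ℕ → ℝ) (a b c c' C : ℝ) (x y : ℕ → ℝ) : Prop where
  tendsto : Tendsto x atTop atTop
  rise : ∀ i (r : ℕ), 2 ≤ r → x (2 * i) ≤ Real.log r → Real.log r ≤ x (2 * i + 1) →
    |f r * Real.log r - (y (2 * i) + c * (Real.log r - x (2 * i)))| ≤ C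
  fall : ∀ i (r : ℕ), 2 ≤ r → x (2 * i + 1) ≤ Real.log r → Real.log r ≤ x (2 * i + 2) →
    |f r * Real.log r - (y (2 * i + 1) + c' * (Real.log r - x (2 * i + 1)))| ≤ C
  corner : ∀ i, |y (2 * i + 1) - (y (2 * i) + c * (x (2 * i + 1) - x (2 * i)))| ≤ C
  low : Tendsto (fun i => y (2 * i) / x (2 * i)) atTop (𝓝 a)
  high : Tendsto (fun i => y (2 * i + 1) / x (2 * i + 1)) atTop (𝓝 b)

namespace IsZigzag

variable {f : ℕ → ℝ} {a b c c' C : ℝ} {x y : ℕ → ℝ}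

theorem tendsto_even (h : IsZigzag f a b c c' C x y) : Tendsto (fun i => x (2 * i)) atTop atTop :=
  h.tendsto.comp (tendsto_atTop_mono (fun i => by dsimp only [id]; omega) tendsto_id)

theorem tendsto_odd (h : IsZigzag f a b c c' C x y) :
    Tendsto (fun i => x (2 * i + 1)) atTop atTop :=
  h.tendsto.comp (tendsto_atTop_mono (fun i => by dsimp only [id]; omega) tendsto_id)

theorem nonneg (h : IsZigzag f a b c c' C x y) : 0 ≤ C := (abs_nonneg _).trans (h.corner 0)

/-- On all rising lines but finitely many, `f` passes from `a'` to `b'` in the interior. -/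
theorem eventually_rise (h : IsZigzag f a b c c' C x y) (hbc : b ≤ c) {a' b' : ℝ} (haa' : a < a')
    (hab' : a' < b') (hb'b : b' < b) (K : ℝ) :
    ∀ᶠ i in atTop, x (2 * i) + K ≤ (c * x (2 * i) - y (2 * i)) / (c - a') ∧
      (c * x (2 * i) - y (2 * i)) / (c - a') + K ≤ (c * x (2 * i) - y (2 * i)) / (c - b') ∧
      (c * x (2 * i) - y (2 * i)) / (c - b') + K ≤ x (2 * i + 1) := by
  -- The line of slope `c` through `(x (2 * i), y (2 * i))` has ratio `e` at the abscissa `(c * x (2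
  -- * i) - y (2 * i)) / (c - e)`. The gaps between its left end, the crossings at `a'` and `b'`,
  -- and its right end all tend to infinity, since the ratios at the ends tend to `a < a'` and to `b
  -- > b'`.
  have hca : 0 < c - a' := by linarith
  have hcb : 0 < c - b' := by linarith
  have hx0 := h.tendsto_even
  have hx1 := h.tendsto_odd
  have h1 : Tendsto (fun i => x (2 * i) * (a' - y (2 * i) / x (2 * i))) atTop atTop :=
    hx0.atTop_mul_pos (by linarith : 0 < a' - a) (h.low.const_sub a')
  have h2 : Tendsto (fun i => x (2 * i) * (c - y (2 * i) / x (2 * i))) atTop atTop :=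
    hx0.atTop_mul_pos (by linarith : 0 < c - a) (h.low.const_sub c)
  have h3 : Tendsto (fun i => x (2 * i + 1) * (y (2 * i + 1) / x (2 * i + 1) - b')) atTop atTop :=
    hx1.atTop_mul_pos (by linarith : 0 < b - b') (h.high.sub_const b')
  filter_upwards [h1.eventually_ge_atTop (K * (c - a')),
    h2.eventually_ge_atTop (K / (1 / (c - b') - 1 / (c - a'))),
    h3.eventually_ge_atTop (K * (c - b') + C), hx0.eventually_gt_atTop 0,
    hx1.eventually_gt_atTop 0] with i h1 h2 h3 h4 h5
  have e0 : ∀ e, x (2 * i) * (e - y (2 * i) / x (2 * i)) = x (2 * i) * e - y (2 * i) := fun e => by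
    field_simp
  rw [e0] at h1 h2
  rw [show x (2 * i + 1) * (y (2 * i + 1) / x (2 * i + 1) - b') =
    y (2 * i + 1) - x (2 * i + 1) * b' by field_simp] at h3
  have h6 := abs_le.1 (h.corner i)
  refine ⟨?_, ?_, ?_⟩
  · rw [le_div_iff₀ hca]
    linarith
  · have h7 : 0 < 1 / (c - b') - 1 / (c - a') :=
      sub_pos.2 (one_div_lt_one_div_of_lt hcb (by linarith))
    rw [div_le_iff₀ h7] at h2
    have e1 : (c * x (2 * i) - y (2 * i)) / (c - b') - (c * x (2 * i) - y (2 * i)) / (c - a') =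
        (x (2 * i) * c - y (2 * i)) * (1 / (c - b') - 1 / (c - a')) := by ring
    linarith
  · rw [← le_sub_iff_add_le, div_le_iff₀ hcb]
    nlinarith

/-- A vertical error `C` shifts the crossing at `e` horizontally by at most `C / (c - e)`. -/
theorem le_of_mem_rise (h : IsZigzag f a b c c' C x y) {e : ℝ} (hec : e < c) {i r : ℕ} (hr : 2 ≤ r)
    (h1 : x (2 * i) ≤ Real.log r) (h2 : Real.log r ≤ x (2 * i + 1)) :
    (f r ≤ e → Real.log r ≤ (c * x (2 * i) - y (2 * i)) / (c - e) + C / (c - e)) ∧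
    (e ≤ f r → (c * x (2 * i) - y (2 * i)) / (c - e) - C / (c - e) ≤ Real.log r) := by
  have hlog : 0 < Real.log r := Real.log_pos (by exact_mod_cast hr)
  have h3 := abs_le.1 (h.rise i r hr h1 h2)
  have hc : 0 < c - e := by linarith
  constructor
  · intro hf
    rw [← add_div, le_div_iff₀ hc]
    nlinarith
  · intro hf
    rw [← sub_div, div_le_iff₀ hc]
    nlinarith

theorem rise_of_le (h : IsZigzag f a b c c' C x y) {e : ℝ} (hec : e < c) {i r : ℕ} (hr : 2 ≤ r)
    (h1 : x (2 * i) ≤ Real.log r) (h2 : Real.log r ≤ x (2 * i + 1)) :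
    (Real.log r ≤ (c * x (2 * i) - y (2 * i)) / (c - e) - C / (c - e) → f r ≤ e) ∧
    ((c * x (2 * i) - y (2 * i)) / (c - e) + C / (c - e) ≤ Real.log r → e ≤ f r) := by
  have hlog : 0 < Real.log r := Real.log_pos (by exact_mod_cast hr)
  have h3 := abs_le.1 (h.rise i r hr h1 h2)
  have hc : 0 < c - e := by linarith
  constructor
  · intro hf
    rw [← sub_div, le_div_iff₀ hc] at hf
    by_contra hcon
    nlinarith
  · intro hf
    rw [← add_div, div_le_iff₀ hc] at hf
    by_contra hcon
    nlinarith

/-- Two witnesses that pin down the passage on a rising line: `w` lies shortly before the crossing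
at `a'`, and `z` shortly after the crossing at `b'`. -/
theorem exists_mem (h : IsZigzag f a b c c' C x y) (hbc : b ≤ c) {a' b' : ℝ} (haa' : a < a')
    (hab' : a' < b') (hb'b : b' < b) :
    ∀ᶠ i in atTop, ∃ w z : ℕ, 2 ≤ w ∧ 2 ≤ z ∧ x (2 * i) ≤ Real.log w ∧
      (c * x (2 * i) - y (2 * i)) / (c - a') - (C / (c - b') + 1) ≤ Real.log w ∧
      Real.log w ≤ (c * x (2 * i) - y (2 * i)) / (c - a') - C / (c - b') ∧ f w ≤ a' ∧
      (c * x (2 * i) - y (2 * i)) / (c - b') + C / (c - b') ≤ Real.log z ∧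
      Real.log z ≤ (c * x (2 * i) - y (2 * i)) / (c - b') + (C / (c - b') + 1) ∧
      Real.log z ≤ x (2 * i + 1) ∧ b' ≤ f z ∧
      (c * x (2 * i) - y (2 * i)) / (c - a') + C / (c - b') <
        (c * x (2 * i) - y (2 * i)) / (c - b') - C / (c - b') := by
  have hC := h.nonneg
  have hcb : 0 < c - b' := by linarith
  have hK : 0 ≤ C / (c - b') := by positivity
  have hK' : C / (c - a') ≤ C / (c - b') := by
    gcongr
  filter_upwards [h.eventually_rise hbc haa' hab' hb'b (2 * (C / (c - b')) + 1),
    h.tendsto_even.eventually_ge_atTop 1] with i ⟨h1, h2, h3⟩ h4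
  obtain ⟨w, hw1, hw2, hw3⟩ := exists_log_mem_Icc
    (u := (c * x (2 * i) - y (2 * i)) / (c - a') - (C / (c - b') + 1)) (by linarith)
  obtain ⟨z, hz1, hz2, hz3⟩ := exists_log_mem_Icc
    (u := (c * x (2 * i) - y (2 * i)) / (c - b') + C / (c - b')) (by linarith)
  refine ⟨w, z, hw1, hz1, by linarith, hw2, by linarith, ?_, hz2, by linarith, by linarith, ?_,
    by linarith⟩
  · exact (h.rise_of_le (by linarith) hw1 (by linarith) (by linarith)).1 (by linarith)
  · exact (h.rise_of_le (by linarith) hz1 (by linarith) (by linarith)).2 (by linarith)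

/-- A passage which starts on a rising line. -/
theorem passage_of_rise (h : IsZigzag f a b c c' C x y) (hbc : b ≤ c) {a' b' : ℝ} (haa' : a < a')
    (hab' : a' < b') (hb'b : b' < b) :
    ∀ᶠ i in atTop, ∀ r q : ℕ, x (2 * i) ≤ Real.log r → Real.log r ≤ x (2 * i + 1) →
      IsPassage {r | 2 ≤ r ∧ f r ≤ a'} {r | 2 ≤ r ∧ b' ≤ f r} r q →
      |Real.log q - (c - a') / (c - b') * Real.log r| ≤
        (c - a') / (c - b') * (C / (c - b') + 1) + (C / (c - b') + 1) := by
  have hC := h.nonneg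
  have hcb : 0 < c - b' := by linarith
  have hca : 0 < c - a' := by linarith
  have hK : 0 ≤ C / (c - b') := by positivity
  have hK' : C / (c - a') ≤ C / (c - b') := by
    gcongr
  filter_upwards [h.exists_mem hbc haa' hab' hb'b] with i hi r q hr1 hr2 hp
  obtain ⟨w, z, hw0, hz0, hw1, hw2, hw3, hw4, hz1, hz2, hz3, hz4, hwz⟩ := hi
  obtain ⟨hrA, hqB, hrq, hbet⟩ := hp
  have hpos : ∀ {n : ℕ}, 2 ≤ n → (0 : ℝ) < n := fun hn => by exact_mod_cast (by omega : 0 < _)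
  have hlt : ∀ {m n : ℕ}, 2 ≤ m → 2 ≤ n → (m < n ↔ Real.log m < Real.log n) := fun hm hn => by
    rw [Real.log_lt_log_iff (hpos hm) (hpos hn), Nat.cast_lt]
  -- Since `f r ≤ a'`, `r` is before `z`, so `q ≤ z` lies on the same line. Since `b' ≤ f q`, `q` is
  -- after `w`, and the absence of further elements between `r` and `q` forces `w ≤ r`. So `r` and
  -- `q` are near the two crossings.
  have e1 := (h.le_of_mem_rise (e := a') (by linarith) hrA.1 hr1 hr2).1 hrA.2
  have hrz : r < z := (hlt hrA.1 hz0).2 (by linarith)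
  have hqz : q ≤ z := by
    by_contra hcon
    exact hbet z hrz (by omega) (Or.inr ⟨hz0, hz4⟩)
  have hqz' : Real.log q ≤ Real.log z := Real.log_le_log (hpos hqB.1) (by exact_mod_cast hqz)
  have hrq' := (hlt hrA.1 hqB.1).1 hrq
  have e2 := (h.le_of_mem_rise (e := b') (by linarith) hqB.1 (by linarith) (by linarith)).2 hqB.2
  have hwq : w < q := (hlt hw0 hqB.1).2 (by linarith)
  have hwr : w ≤ r := by
    by_contra hcon
    exact hbet w (by omega) hwq (Or.inl ⟨hw0, hw4⟩)
  have hwr' : Real.log w ≤ Real.log r := Real.log_le_log (hpos hw0) (by exact_mod_cast hwr)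
  have hR : 0 < (c - a') / (c - b') := by positivity
  -- The quotient of the two crossings does not depend on the line.
  have e3 : (c * x (2 * i) - y (2 * i)) / (c - b') =
      (c - a') / (c - b') * ((c * x (2 * i) - y (2 * i)) / (c - a')) := by
    field_simp
  rw [abs_le]
  have e4 := mul_le_mul_of_nonneg_left (e1.trans (add_le_add_right hK' _)) hR.le
  have e5 := mul_le_mul_of_nonneg_left (hw2.trans hwr') hR.le
  rw [mul_add] at e4
  rw [mul_sub] at e5
  constructor
  · linarith
  · linarith

/-- No passage starts on a falling line, with finitely many exceptions. -/
theorem not_passage_of_fall (h : IsZigzag f a b c c' C x y) (hbc : b ≤ c) (hac : c' ≤ a)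
    {a' b' : ℝ} (haa' : a < a') (hab' : a' < b') (hb'b : b' < b) :
    ∀ᶠ i in atTop, ∀ r q : ℕ, x (2 * i + 1) ≤ Real.log r → Real.log r < x (2 * i + 2) →
      ¬ IsPassage {r | 2 ≤ r ∧ f r ≤ a'} {r | 2 ≤ r ∧ b' ≤ f r} r q := by
  have hC := h.nonneg
  have hcb : 0 < c - b' := by linarith
  have hK : 0 ≤ C / (c - b') := by positivity
  have hnext : Tendsto (fun i : ℕ => i + 1) atTop atTop := tendsto_add_atTop_nat 1
  filter_upwards [hnext.eventually (h.exists_mem hbc haa' hab' hb'b),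
    h.tendsto_odd.eventually_gt_atTop (2 * C / (b' - a'))] with i hi hx1 r q hr1 hr2 hp
  obtain ⟨w, z, hw0, hz0, hw1, hw2, hw3, hw4, hz1, hz2, hz3, hz4, hwz⟩ := hi
  obtain ⟨hrA, hqB, hrq, hbet⟩ := hp
  have hpos : ∀ {n : ℕ}, 2 ≤ n → (0 : ℝ) < n := fun hn => by exact_mod_cast (by omega : 0 < _)
  have hlt : ∀ {m n : ℕ}, 2 ≤ m → 2 ≤ n → (m < n ↔ Real.log m < Real.log n) := fun hm hn => by
    rw [Real.log_lt_log_iff (hpos hm) (hpos hn), Nat.cast_lt]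
  -- The next rising line contains the point `w` of the lower set, so `q ≤ w`. Then `q` lies on this
  -- falling line or on the next rising line before the crossing at `b'`.
  have hrw : r < w := (hlt hrA.1 hw0).2 (lt_of_lt_of_le hr2 hw1)
  have hqw : q ≤ w := by
    by_contra hcon
    exact hbet w hrw (by omega) (Or.inl ⟨hw0, hw4⟩)
  have hqw' : Real.log q ≤ Real.log w := Real.log_le_log (hpos hqB.1) (by exact_mod_cast hqw)
  have hrq' := (hlt hrA.1 hqB.1).1 hrq
  rcases le_total (Real.log q) (x (2 * i + 2)) with hq | hq
  -- As the slope `c'` is below `a'`, going from ratio `a'` to ratio `b'` on a falling line would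
  -- force `(b' - a') * log q ≤ 2 * C`.
  · have e1 := abs_le.1 (h.fall i r hrA.1 hr1 hr2.le)
    have e2 := abs_le.1 (h.fall i q hqB.1 (by linarith) hq)
    have hr0 : 0 < Real.log r := Real.log_pos (by exact_mod_cast hrA.1)
    have hq0 : 0 < Real.log q := hr0.trans hrq'
    rw [div_lt_iff₀ (by linarith)] at hx1
    have e3 : f r * Real.log r ≤ a' * Real.log r := mul_le_mul_of_nonneg_right hrA.2 hr0.le
    have e4 : b' * Real.log q ≤ f q * Real.log q := mul_le_mul_of_nonneg_right hqB.2 hq0.le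
    have e5 : (a' - c') * Real.log r ≤ (a' - c') * Real.log q :=
      mul_le_mul_of_nonneg_left hrq'.le (by linarith)
    have e6 : x (2 * i + 1) * (b' - a') ≤ Real.log q * (b' - a') :=
      mul_le_mul_of_nonneg_right (by linarith) (by linarith)
    linarith
  · have e2 := (h.le_of_mem_rise (i := i + 1) (e := b') (by linarith) hqB.1 hq
      (by linarith)).2 hqB.2
    linarith

theorem exists_passage (h : IsZigzag f a b c c' C x y) (hbc : b ≤ c)
    {a' b' : ℝ} (haa' : a < a') (hab' : a' < b') (hb'b : b' < b) (M : ℕ) :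
    ∃ r q, M ≤ r ∧ IsPassage {r | 2 ≤ r ∧ f r ≤ a'} {r | 2 ≤ r ∧ b' ≤ f r} r q := by
  obtain ⟨i, hi, hM⟩ := ((h.exists_mem hbc haa' hab' hb'b).and
    (h.tendsto_even.eventually_ge_atTop (Real.log M))).exists
  obtain ⟨w, z, hw0, hz0, hw1, hw2, hw3, hw4, hz1, hz2, hz3, hz4, hwz⟩ := hi
  have hw0' : (0 : ℝ) < w := by exact_mod_cast (by omega : 0 < w)
  have hz0' : (0 : ℝ) < z := by exact_mod_cast (by omega : 0 < z)
  have hK : 0 ≤ C / (c - b') := div_nonneg h.nonneg (by linarith)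
  have hwz' : w < z := by
    have : Real.log w < Real.log z := by linarith
    rwa [Real.log_lt_log_iff hw0' hz0', Nat.cast_lt] at this
  obtain ⟨r, q, hwr, hp⟩ := exists_isPassage (A := {r | 2 ≤ r ∧ f r ≤ a'})
    (B := {r | 2 ≤ r ∧ b' ≤ f r}) ⟨hw0, hw4⟩ ⟨hz0, hz4⟩ hwz' (by
      rw [Set.disjoint_left]
      rintro n ⟨-, h1⟩ ⟨-, h2⟩
      linarith)
  refine ⟨r, q, le_trans ?_ hwr, hp⟩
  rcases Nat.eq_zero_or_pos M with rfl | hM0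
  · exact Nat.zero_le _
  · have : Real.log M ≤ Real.log w := hM.trans hw1
    rwa [Real.log_le_log_iff (by exact_mod_cast hM0) hw0', Nat.cast_le] at this

/-- The passage exponent of a zigzag function. -/
theorem passageExponent_eq (h : IsZigzag f a b c c' C x y) (hbc : b ≤ c) (hac : c' ≤ a)
    {a' b' : ℝ} (haa' : a < a') (hab' : a' < b') (hb'b : b' < b) :
    passageExponent {r | 2 ≤ r ∧ f r ≤ a'} {r | 2 ≤ r ∧ b' ≤ f r} =
      ENNReal.ofReal ((c - a') / (c - b')) := by
  have hlog : Tendsto (fun x : ℕ => Real.log x) atTop atTop :=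
    Real.tendsto_log_atTop.comp tendsto_natCast_atTop_atTop
  obtain ⟨I, hI⟩ := eventually_atTop.1 ((h.passage_of_rise hbc haa' hab' hb'b).and
    (h.not_passage_of_fall hbc hac haa' hab' hb'b))
  obtain ⟨N, hN⟩ := eventually_atTop.1 (hlog.eventually_ge_atTop (x (2 * I)))
  refine passageExponent_eq_of_log (N := N)
    (K := (c - a') / (c - b') * (C / (c - b') + 1) + (C / (c - b') + 1)) (div_nonneg (by linarith) (by linarith))
    (fun r q hr hp => ?_) (h.exists_passage hbc haa' hab' hb'b)
  have hrI := hN r hr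
  obtain ⟨j, hj, hj1, hj2⟩ := exists_le_and_lt_succ h.tendsto hrI
  rcases Nat.even_or_odd' j with ⟨k, rfl | rfl⟩
  · exact (hI k (by omega)).1 r q hj1 hj2.le hp
  · exact absurd hp ((hI k (by omega)).2 r q hj1 hj2)

end IsZigzag

/-- `0 < n` excludes the form `0 / 0`; for `d = 0`, which occurs when `γ = β` or `α = δ`, the limit
is `∞`. -/
theorem tendsto_ofReal_div {a b n d : ℝ} (hab : a < b) {N D : ℝ × ℝ → ℝ} {u : ℝ × ℝ → ℝ≥0∞}
    (hN : Tendsto N (𝓝[>] a ×ˢ 𝓝[<] b) (𝓝 n)) (hD : Tendsto D (𝓝[>] a ×ˢ 𝓝[<] b) (𝓝 d))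
    (hn : 0 < n)
    (hu : ∀ p : ℝ × ℝ, a < p.1 → p.1 < p.2 → p.2 < b →
      0 < D p ∧ u p = ENNReal.ofReal (N p / D p)) :
    Tendsto u (𝓝[>] a ×ˢ 𝓝[<] b) (𝓝 (ENNReal.ofReal n / ENNReal.ofReal d)) := by
  refine (ENNReal.Tendsto.div (ENNReal.tendsto_ofReal hN) (Or.inl ?_) (ENNReal.tendsto_ofReal hD)
    (Or.inr ENNReal.ofReal_ne_top)).congr' ?_
  · simpa using hn
  have m1 : ∀ᶠ a' in 𝓝[>] a, a < a' ∧ a' < (a + b) / 2 := Ioo_mem_nhdsGT (by linarith)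
  have m2 : ∀ᶠ b' in 𝓝[<] b, (a + b) / 2 < b' ∧ b' < b := Ioo_mem_nhdsLT (by linarith)
  filter_upwards [m1.prod_mk m2] with p hp
  obtain ⟨h1, h2⟩ := hu p hp.1.1 (hp.1.2.trans hp.2.1) hp.2.2
  rw [h2, ENNReal.ofReal_div_of_pos h1]

/-! ### Sequences made of the blocks `012` and `222` -/

/-- The sequence is a concatenation of blocks `012` and `222`. -/
def IsBlockSeq (ω : ℕ → Fin 3) : Prop :=
  ∀ j, (ω (3 * j) = 0 ∧ ω (3 * j + 1) = 1 ∧ ω (3 * j + 2) = 2) ∨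
    (ω (3 * j) = 2 ∧ ω (3 * j + 1) = 2 ∧ ω (3 * j + 2) = 2)

/-- The weights of `Γ_ω` at level `k`. -/
noncomputable abbrev weightsAt (ω : ℕ → Fin 3) (k : ℕ) : Fin 3 → ℝ := weights (fun _ => 1) ω k

/-- The change of weights along a block `012`. -/
noncomputable def cyclicStep (l : Fin 3 → ℝ) : Fin 3 → ℝ :=
  weightStep (weightStep (weightStep l 0) 1) 2

/-- The change of weights along a block `222`. -/
noncomputable def constStep (l : Fin 3 → ℝ) : Fin 3 → ℝ :=
  weightStep (weightStep (weightStep l 2) 2) 2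

theorem cyclicStep_apply (l : Fin 3 → ℝ) :
    cyclicStep l 0 = (l 0 + l 1 + l 2) / 2 ∧
    cyclicStep l 1 = ((l 0 + l 1 + l 2) / 2 + l 1 + l 2) / 2 ∧
    cyclicStep l 2 = ((l 0 + l 1 + l 2) / 2 + ((l 0 + l 1 + l 2) / 2 + l 1 + l 2) / 2 + l 2) / 2 := by
  simp [cyclicStep, weightStep, total]

/-- The block `222` only changes `l 2`, which cannot exceed `l 0 + l 1` by the triangle
inequalities; so repeated blocks `222` keep the total bounded. -/
theorem constStep_apply (l : Fin 3 → ℝ) : constStep l 0 = l 0 ∧ constStep l 1 = l 1 := by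
  simp [constStep, weightStep]

theorem exists_admissible_weightsAt (ω : ℕ → Fin 3) (k : ℕ) : ∃ A, Admissible A (weightsAt ω k) :=
  admissible_one.exists_weights ω k

theorem weightsAt_mono (ω : ℕ → Fin 3) (i : Fin 3) : Monotone fun k => weightsAt ω k i :=
  admissible_one.le_weights ω i

theorem one_le_weightsAt (ω : ℕ → Fin 3) (k : ℕ) (i : Fin 3) : 1 ≤ weightsAt ω k i :=
  weightsAt_mono ω i (Nat.zero_le k)

theorem three_le_total_weightsAt (ω : ℕ → Fin 3) (k : ℕ) : 3 ≤ total (weightsAt ω k) := by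
  simp only [total]
  linarith [one_le_weightsAt ω k 0, one_le_weightsAt ω k 1, one_le_weightsAt ω k 2]

theorem total_weightsAt_mono (ω : ℕ → Fin 3) : Monotone fun k => total (weightsAt ω k) :=
  admissible_one.total_weights_mono ω

theorem total_weightsAt_succ_le (ω : ℕ → Fin 3) (k : ℕ) :
    total (weightsAt ω (k + 1)) ≤ 3 / 2 * total (weightsAt ω k) := by
  have h1 : total (weightsAt ω (k + 1)) = 3 / 2 * total (weightsAt ω k) - weightsAt ω k (ω k) :=
    total_weightStep _ _
  rw [h1]
  linarith [one_le_weightsAt ω k (ω k)]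

theorem two_mul_weightsAt_le (ω : ℕ → Fin 3) (k : ℕ) (i : Fin 3) :
    2 * weightsAt ω k i ≤ total (weightsAt ω k) := by
  obtain ⟨A, hA⟩ := exists_admissible_weightsAt ω k
  linarith [hA.triangle i, hA.nonneg]

theorem IsBlockSeq.weightsAt_eq {ω : ℕ → Fin 3} (h : IsBlockSeq ω) (j : ℕ) :
    weightsAt ω (3 * (j + 1)) = cyclicStep (weightsAt ω (3 * j)) ∨
      weightsAt ω (3 * (j + 1)) = constStep (weightsAt ω (3 * j)) := by
  have h3 : weightsAt ω (3 * (j + 1)) = weightStep (weightStep (weightStep (weightsAt ω (3 * j))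
    (ω (3 * j))) (ω (3 * j + 1))) (ω (3 * j + 2)) := rfl
  rw [h3]
  rcases h j with ⟨h0, h1, h2⟩ | ⟨h0, h1, h2⟩ <;> rw [h0, h1, h2]
  · exact Or.inl rfl
  · exact Or.inr rfl

/-- A block `222` preserves `l 0 + l 1` and decreases no weight; a block `012` restores the
inequality from the triangle inequalities alone. -/
theorem IsBlockSeq.le_weightsAt {ω : ℕ → Fin 3} (h : IsBlockSeq ω) (j : ℕ) (i : Fin 3) :
    2 / 5 * (weightsAt ω (3 * j) 0 + weightsAt ω (3 * j) 1) ≤ weightsAt ω (3 * j) i := by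
  induction j generalizing i with
  | zero => norm_num [weightsAt, weights]
  | succ j ih =>
    have ht := two_mul_weightsAt_le ω (3 * j)
    have h0 := ht 0
    have h1 := ht 1
    have h2 := ht 2
    have hmono := weightsAt_mono ω i (show 3 * j ≤ 3 * (j + 1) by omega)
    rcases h.weightsAt_eq j with he | he
    · obtain ⟨e0, e1, e2⟩ := cyclicStep_apply (weightsAt ω (3 * j))
      have p0 := one_le_weightsAt ω (3 * j) 0
      have p1 := one_le_weightsAt ω (3 * j) 1
      have p2 := one_le_weightsAt ω (3 * j) 2
      simp only [total] at h0 h1 h2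
      rw [he]
      fin_cases i
      · change _ ≤ cyclicStep (weightsAt ω (3 * j)) 0
        rw [e0, e1]; linarith
      · change _ ≤ cyclicStep (weightsAt ω (3 * j)) 1
        rw [e0, e1]; linarith
      · change _ ≤ cyclicStep (weightsAt ω (3 * j)) 2
        rw [e0, e1, e2]; linarith
    · obtain ⟨e0, e1⟩ := constStep_apply (weightsAt ω (3 * j))
      refine le_trans ?_ ((ih i).trans hmono)
      rw [he, e0, e1]

theorem total_weightsAt_le_of_div (ω : ℕ → Fin 3) (k : ℕ) :
    total (weightsAt ω k) ≤ 4 * total (weightsAt ω (3 * (k / 3))) := by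
  have h0 := three_le_total_weightsAt ω (3 * (k / 3))
  have h1 := total_weightsAt_succ_le ω (3 * (k / 3))
  have h2 := total_weightsAt_succ_le ω (3 * (k / 3) + 1)
  have h3 : k ≤ 3 * (k / 3) + 2 := by omega
  have := total_weightsAt_mono ω h3
  simp only at this
  linarith

/-- At the start of a block the total is at most `2 (l 0 + l 1)`, hence at most `5` times the least
weight; an incomplete block costs another factor `4`. -/
theorem IsBlockSeq.total_le {ω : ℕ → Fin 3} (h : IsBlockSeq ω) (k : ℕ) :
    total (weightsAt ω k) ≤ 20 * least (weightsAt ω k) := by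
  have h1 := total_weightsAt_le_of_div ω k
  have h2 : total (weightsAt ω (3 * (k / 3))) / 5 ≤ least (weightsAt ω k) := by
    refine le_least fun i => le_trans ?_ (weightsAt_mono ω i (show 3 * (k / 3) ≤ k by omega))
    refine le_trans ?_ (h.le_weightsAt (k / 3) i)
    have := two_mul_weightsAt_le ω (3 * (k / 3)) 2
    simp only [total] at this ⊢
    linarith
  linarith

/-! ### Comparison of the weights of sequences with a common part -/

theorem weightStep_le_mul {l l' : Fin 3 → ℝ} {c : ℝ} (h : ∀ i, l i ≤ c * l' i) (j i : Fin 3) :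
    weightStep l j i ≤ c * weightStep l' j i := by
  by_cases hi : i = j
  · subst hi
    rw [weightStep_self, weightStep_self]
    simp only [total]
    linarith [h 0, h 1, h 2]
  · rw [weightStep_of_ne l hi, weightStep_of_ne l' hi]
    exact h i

theorem weightsAt_le_mul {ψ ω : ℕ → Fin 3} {c : ℝ} {p q : ℕ} (hpq : p ≤ q)
    (h : ∀ k, p ≤ k → k < q → ψ k = ω k) (hp : ∀ i, weightsAt ψ p i ≤ c * weightsAt ω p i)
    (i : Fin 3) : weightsAt ψ q i ≤ c * weightsAt ω q i := by
  induction q, hpq using Nat.le_induction generalizing i with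
  | base => exact hp i
  | succ q hq ih =>
    have h1 := ih fun k hk hk' => h k hk (by omega)
    have h2 : weightsAt ψ (q + 1) = weightStep (weightsAt ψ q) (ψ q) := rfl
    have h3 : weightsAt ω (q + 1) = weightStep (weightsAt ω q) (ω q) := rfl
    rw [h2, h3, h q hq (by omega)]
    exact weightStep_le_mul h1 _ i

/-- Steps are linear and positive, so a bound of the weights of `ψ` by multiples of those of `ω`
persists along the common stretch. At its start, the weights of `ω` are within a factor `20` of
their total. -/
theorem log_total_sub_le {ψ ω : ℕ → Fin 3} (hω : IsBlockSeq ω) {p q : ℕ} (hpq : p ≤ q)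
    (h : ∀ k, p ≤ k → k < q → ψ k = ω k) :
    Real.log (total (weightsAt ψ q)) - Real.log (total (weightsAt ψ p)) ≤
      Real.log (total (weightsAt ω q)) - Real.log (total (weightsAt ω p)) + Real.log 20 := by
  have a1 := three_le_total_weightsAt ψ p
  have a2 := three_le_total_weightsAt ω p
  have a3 := three_le_total_weightsAt ψ q
  have a4 := three_le_total_weightsAt ω q
  have hp : ∀ i, weightsAt ψ p i ≤
      20 * total (weightsAt ψ p) / total (weightsAt ω p) * weightsAt ω p i := fun i => by
    have h1 := hω.total_le p
    have h2 := least_le (weightsAt ω p) i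
    have h3 := two_mul_weightsAt_le ψ p i
    rw [div_mul_eq_mul_div, le_div_iff₀ (by linarith)]
    nlinarith
  have hq := weightsAt_le_mul hpq h hp
  have hle : total (weightsAt ψ q) ≤
      20 * total (weightsAt ψ p) / total (weightsAt ω p) * total (weightsAt ω q) := by
    have b0 := hq 0
    have b1 := hq 1
    have b2 := hq 2
    simp only [total] at *
    linarith
  have hlog := Real.log_le_log (by linarith) hle
  rw [Real.log_mul (by positivity) (by positivity), Real.log_div (by positivity) (by positivity),
    Real.log_mul (by positivity) (by positivity)] at hlog
  linarith

theorem abs_log_total_sub_le {ψ ω : ℕ → Fin 3} (hψ : IsBlockSeq ψ) (hω : IsBlockSeq ω) {p q : ℕ}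
    (hpq : p ≤ q) (h : ∀ k, p ≤ k → k < q → ψ k = ω k) :
    |(Real.log (total (weightsAt ψ q)) - Real.log (total (weightsAt ψ p))) -
      (Real.log (total (weightsAt ω q)) - Real.log (total (weightsAt ω p)))| ≤ Real.log 20 := by
  have h1 := log_total_sub_le hω hpq h
  have h2 := log_total_sub_le hψ hpq fun k hk hk' => (h k hk hk').symm
  rw [abs_le]
  constructor <;> linarith

/-! ### Sequences with prescribed rate of growth of the weights -/

/-- The weights at the ends of the blocks of `rateSeq`. -/
noncomputable def rateWeights (θ : ℝ) : ℕ → Fin 3 → ℝ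
  | 0 => fun _ => 1
  | j + 1 =>
      if total (rateWeights θ j) ≤ 3 * Real.exp (3 * j * θ) then cyclicStep (rateWeights θ j)
      else constStep (rateWeights θ j)

open Classical in
/-- A sequence for which the logarithm of the weights grows at the rate `θ`: a block `012` is
taken if the weights are too small, and a block `222` if they are too large. -/
noncomputable def rateSeq (θ : ℝ) (k : ℕ) : Fin 3 :=
  if total (rateWeights θ (k / 3)) ≤ 3 * Real.exp (3 * (k / 3 : ℕ) * θ) then
    Fin.ofNat 3 (k % 3) else 2

theorem rateSeq_block (θ : ℝ) (j : ℕ) :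
    (total (rateWeights θ j) ≤ 3 * Real.exp (3 * j * θ) ∧
      rateSeq θ (3 * j) = 0 ∧ rateSeq θ (3 * j + 1) = 1 ∧ rateSeq θ (3 * j + 2) = 2) ∨
    (3 * Real.exp (3 * j * θ) < total (rateWeights θ j) ∧
      rateSeq θ (3 * j) = 2 ∧ rateSeq θ (3 * j + 1) = 2 ∧ rateSeq θ (3 * j + 2) = 2) := by
  have d0 : 3 * j / 3 = j := by omega
  have d1 : (3 * j + 1) / 3 = j := by omega
  have d2 : (3 * j + 2) / 3 = j := by omega
  have m0 : 3 * j % 3 = 0 := by omega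
  have m1 : (3 * j + 1) % 3 = 1 := by omega
  have m2 : (3 * j + 2) % 3 = 2 := by omega
  rcases le_or_gt (total (rateWeights θ j)) (3 * Real.exp (3 * j * θ)) with h | h
  · refine Or.inl ⟨h, ?_, ?_, ?_⟩
    · rw [rateSeq, d0, m0, if_pos h]; rfl
    · rw [rateSeq, d1, m1, if_pos h]; rfl
    · rw [rateSeq, d2, m2, if_pos h]; rfl
  · refine Or.inr ⟨h, ?_, ?_, ?_⟩
    · rw [rateSeq, d0, if_neg (not_le.2 h)]
    · rw [rateSeq, d1, if_neg (not_le.2 h)]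
    · rw [rateSeq, d2, if_neg (not_le.2 h)]

theorem isBlockSeq_rateSeq (θ : ℝ) : IsBlockSeq (rateSeq θ) := fun j =>
  (rateSeq_block θ j).imp And.right And.right

theorem weightsAt_rateSeq (θ : ℝ) (j : ℕ) : weightsAt (rateSeq θ) (3 * j) = rateWeights θ j := by
  induction j with
  | zero => rfl
  | succ j ih =>
    have h3 : weightsAt (rateSeq θ) (3 * (j + 1)) =
      weightStep (weightStep (weightStep (weightsAt (rateSeq θ) (3 * j))
        (rateSeq θ (3 * j))) (rateSeq θ (3 * j + 1))) (rateSeq θ (3 * j + 2)) := rfl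
    rw [h3, ih, rateWeights]
    rcases rateSeq_block θ j with ⟨h, h0, h1, h2⟩ | ⟨h, h0, h1, h2⟩
    · rw [h0, h1, h2, if_pos h]; rfl
    · rw [h0, h1, h2, if_neg (not_le.2 h)]; rfl

/-- A linear form which is multiplied by `η⁻³` along every block `012`. -/
noncomputable def eigenform (η : ℝ) (l : Fin 3 → ℝ) : ℝ := l 0 + (1 + η) * l 1 + 2 / η * l 2

/-- The form is a left eigenvector of the matrix of the block `012`; its last coefficient is `2 / η
= η ^ 2 + η + 1`. -/
theorem eigenform_cyclicStep {η : ℝ} (hη0 : 0 < η) (hη : η ^ 3 + η ^ 2 + η - 2 = 0)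
    (l : Fin 3 → ℝ) : η ^ 3 * eigenform η (cyclicStep l) = eigenform η l := by
  obtain ⟨h0, h1, h2⟩ := cyclicStep_apply l
  have h : 2 / η = η ^ 2 + η + 1 := by
    rw [div_eq_iff hη0.ne']
    linear_combination -hη
  rw [eigenform, eigenform, h0, h1, h2, h]
  linear_combination ((3 / 8 * η ^ 2 + 1 / 4 * η + 1 / 2) * l 0 +
    (5 / 8 * η ^ 2 + 3 / 4 * η + 1 / 2) * l 1 + (9 / 8 * η ^ 2 + 3 / 4 * η + 1 / 2) * l 2) * hη

/-- The sum `l 0 + l 1` changes only along a block `012`, taken when the total is at most `3 exp (3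
j θ)`; the new sum is at most `5 / 4` of this total. -/
theorem rateWeights_zero_add_one_le {θ : ℝ} (hθ : 0 ≤ θ) (j : ℕ) :
    rateWeights θ j 0 + rateWeights θ j 1 ≤ 15 / 4 * Real.exp (3 * j * θ) := by
  induction j with
  | zero => norm_num [rateWeights]
  | succ j ih =>
    have hexp : Real.exp (3 * j * θ) ≤ Real.exp (3 * (j + 1 : ℕ) * θ) := by
      refine Real.exp_le_exp.2 ?_
      push_cast
      linarith
    have hpos := one_le_weightsAt (rateSeq θ) (3 * j)
    rw [weightsAt_rateSeq] at hpos
    rw [rateWeights]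
    split_ifs with h
    · obtain ⟨h0, h1, -⟩ := cyclicStep_apply (rateWeights θ j)
      rw [h0, h1]
      simp only [total] at h
      linarith [hpos 0, hpos 1, hpos 2]
    · obtain ⟨h0, h1⟩ := constStep_apply (rateWeights θ j)
      rw [h0, h1]
      linarith

/-- Along a block `012` the form gains the factor `η⁻³ ≥ exp (3 θ)`, so it keeps up with the bound.
A block `222` is taken only if the total already exceeds `3 exp (3 j θ)`, and the factor `exp (-3
θ)` in the bound covers that block. -/
theorem le_eigenform_rateWeights {η θ : ℝ} (hη0 : 0 < η) (hη : η ^ 3 + η ^ 2 + η - 2 = 0)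
    (hθ : 0 ≤ θ) (hθη : θ ≤ -Real.log η) (j : ℕ) :
    3 * Real.exp (-3 * θ) * Real.exp (3 * j * θ) ≤ eigenform η (rateWeights θ j) := by
  have hη1 : η < 1 := by
    by_contra hcon
    nlinarith
  have htot : ∀ j, total (rateWeights θ j) ≤ eigenform η (rateWeights θ j) := fun j => by
    have hpos := one_le_weightsAt (rateSeq θ) (3 * j)
    rw [weightsAt_rateSeq] at hpos
    have h1 : 1 ≤ 2 / η := by rw [le_div_iff₀ hη0]; linarith
    simp only [total, eigenform]
    nlinarith [hpos 0, hpos 1, hpos 2]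
  have hmono : ∀ j, total (rateWeights θ j) ≤ total (rateWeights θ (j + 1)) := fun j => by
    rw [← weightsAt_rateSeq, ← weightsAt_rateSeq]
    exact total_weightsAt_mono _ (by omega)
  have hexp : ∀ j : ℕ, Real.exp (3 * (j + 1 : ℕ) * θ) = Real.exp (3 * θ) * Real.exp (3 * j * θ) :=
    fun j => by
      rw [← Real.exp_add]
      congr 1
      push_cast
      ring
  have hneg : Real.exp (-3 * θ) * Real.exp (3 * θ) = 1 := by
    rw [← Real.exp_add]
    simp
  have hpow : η ^ 3 ≤ Real.exp (-3 * θ) := by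
    rw [← Real.exp_log hη0, ← Real.exp_nat_mul]
    refine Real.exp_le_exp.2 ?_
    push_cast
    linarith
  induction j with
  | zero =>
    have h0 : total (rateWeights θ 0) = 3 := by norm_num [rateWeights, total]
    have h1 : Real.exp (-3 * θ) ≤ 1 := Real.exp_le_one_iff.2 (by linarith)
    refine le_trans ?_ (htot 0)
    rw [h0]
    simp
    linarith
  | succ j ih =>
    have hE := Real.exp_pos (3 * j * θ)
    rw [hexp]
    rcases rateSeq_block θ j with ⟨h, -⟩ | ⟨h, -⟩
    · have h1 : rateWeights θ (j + 1) = cyclicStep (rateWeights θ j) := by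
        rw [rateWeights, if_pos h]
      rw [h1]
      have h2 := eigenform_cyclicStep hη0 hη (rateWeights θ j)
      have h3 := (htot (j + 1))
      rw [h1] at h3
      have h4 : 0 ≤ eigenform η (cyclicStep (rateWeights θ j)) := by
        have := three_le_total_weightsAt (rateSeq θ) (3 * (j + 1))
        rw [weightsAt_rateSeq, h1] at this
        linarith
      have h5 := mul_le_mul_of_nonneg_right hpow h4
      have h6 : 3 * Real.exp (3 * j * θ) ≤ eigenform η (cyclicStep (rateWeights θ j)) := by
        have h7 := Real.exp_pos (-3 * θ)
        by_contra hcon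
        nlinarith
      calc _ = 3 * Real.exp (3 * j * θ) * (Real.exp (-3 * θ) * Real.exp (3 * θ)) := by ring
        _ ≤ _ := by rw [hneg, mul_one]; exact h6
    · calc _ = 3 * Real.exp (3 * j * θ) * (Real.exp (-3 * θ) * Real.exp (3 * θ)) := by ring
        _ ≤ total (rateWeights θ j) := by rw [hneg, mul_one]; exact h.le
        _ ≤ _ := (hmono j).trans (htot _)

theorem exists_abs_log_total_rateSeq_sub_le {η θ : ℝ} (hη0 : 0 < η)
    (hη : η ^ 3 + η ^ 2 + η - 2 = 0) (hθ : 0 ≤ θ) (hθη : θ ≤ -Real.log η) :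
    ∃ C, ∀ k : ℕ, |Real.log (total (weightsAt (rateSeq θ) k)) - k * θ| ≤ C := by
  set c := 3 * Real.exp (-3 * θ) / (1 + (1 + η) + 2 / η) with hc
  have hc0 : 0 < c := by positivity
  refine ⟨|Real.log 30| + |Real.log c| + 3 * θ, fun k => ?_⟩
  set j := k / 3 with hj
  have hk1 : 3 * (j : ℝ) ≤ k := by exact_mod_cast (by omega : 3 * j ≤ k)
  have hk2 : (k : ℝ) ≤ 3 * j + 3 := by exact_mod_cast (by omega : k ≤ 3 * j + 3)
  have hup : total (weightsAt (rateSeq θ) k) ≤ 30 * Real.exp (3 * j * θ) := by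
    have h1 := total_weightsAt_le_of_div (rateSeq θ) k
    have h2 := two_mul_weightsAt_le (rateSeq θ) (3 * j) 2
    rw [weightsAt_rateSeq] at h1 h2
    have h3 := rateWeights_zero_add_one_le hθ j
    simp only [total] at h1 h2 ⊢
    linarith
  have hlow : c * Real.exp (3 * j * θ) ≤ total (weightsAt (rateSeq θ) k) := by
    refine le_trans ?_ (total_weightsAt_mono (rateSeq θ) (show 3 * j ≤ k by omega))
    simp only
    rw [weightsAt_rateSeq, hc, div_mul_eq_mul_div, div_le_iff₀ (by positivity)]
    refine (le_eigenform_rateWeights hη0 hη hθ hθη j).trans ?_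
    have hpos := one_le_weightsAt (rateSeq θ) (3 * j)
    rw [weightsAt_rateSeq] at hpos
    have h1 : 0 < 2 / η := by positivity
    simp only [total, eigenform]
    nlinarith [hpos 0, hpos 1, hpos 2, mul_pos hη0 (lt_of_lt_of_le one_pos (hpos 0)),
      mul_pos hη0 (lt_of_lt_of_le one_pos (hpos 1)), mul_pos hη0 (lt_of_lt_of_le one_pos (hpos 2)),
      mul_pos h1 (lt_of_lt_of_le one_pos (hpos 0)), mul_pos h1 (lt_of_lt_of_le one_pos (hpos 1)),
      mul_pos h1 (lt_of_lt_of_le one_pos (hpos 2))]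
  have h3 := three_le_total_weightsAt (rateSeq θ) k
  have l1 := Real.log_le_log (by linarith) hup
  have l2 := Real.log_le_log (by positivity) hlow
  rw [Real.log_mul (by positivity) (by positivity), Real.log_exp] at l1 l2
  have l3 := mul_le_mul_of_nonneg_right hk1 hθ
  have l4 := mul_le_mul_of_nonneg_right hk2 hθ
  rw [abs_le]
  constructor
  · linarith [neg_abs_le (Real.log c), abs_nonneg (Real.log 30)]
  · linarith [le_abs_self (Real.log 30), abs_nonneg (Real.log c)]

/-! ### Radii and levels -/

/-- The logarithm of the radius `2 ^ k * total (weightsAt ω k)`, which corresponds to the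
level `k`. -/
noncomputable def logRadius (ω : ℕ → Fin 3) (k : ℕ) : ℝ :=
  k * Real.log 2 + Real.log (total (weightsAt ω k))

theorem exp_logRadius (ω : ℕ → Fin 3) (k : ℕ) :
    Real.exp (logRadius ω k) = 2 ^ k * total (weightsAt ω k) := by
  rw [logRadius, Real.exp_add, Real.exp_log (by linarith [three_le_total_weightsAt ω k]),
    Real.exp_nat_mul, Real.exp_log (by norm_num)]

theorem logRadius_add_le (ω : ℕ → Fin 3) (k : ℕ) :
    logRadius ω k + Real.log 2 ≤ logRadius ω (k + 1) := by
  have h := total_weightsAt_mono ω (Nat.le_succ k)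
  have h' := Real.log_le_log (by linarith [three_le_total_weightsAt ω k]) h
  simp only [logRadius]
  push_cast
  simp only [Nat.succ_eq_add_one] at h'
  linarith

theorem logRadius_succ_le (ω : ℕ → Fin 3) (k : ℕ) :
    logRadius ω (k + 1) ≤ logRadius ω k + Real.log 3 := by
  have h0 := three_le_total_weightsAt ω k
  have h1 := three_le_total_weightsAt ω (k + 1)
  have h' := Real.log_le_log (by linarith) (total_weightsAt_succ_le ω k)
  rw [Real.log_mul (by norm_num) (by linarith), Real.log_div (by norm_num) (by norm_num)] at h'
  simp only [logRadius]
  push_cast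
  linarith

theorem logRadius_strictMono (ω : ℕ → Fin 3) : StrictMono (logRadius ω) :=
  strictMono_nat_of_lt_succ fun k => by
    have := logRadius_add_le ω k
    have := Real.log_pos (by norm_num : (1 : ℝ) < 2)
    linarith

theorem tendsto_logRadius (ω : ℕ → Fin 3) : Tendsto (logRadius ω) atTop atTop := by
  have hlog2 := Real.log_pos (by norm_num : (1 : ℝ) < 2)
  refine tendsto_atTop_mono (fun k => ?_) (tendsto_natCast_atTop_atTop.atTop_mul_const hlog2)
  have := Real.log_nonneg (by linarith [three_le_total_weightsAt ω k] :
    (1 : ℝ) ≤ total (weightsAt ω k))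
  simp only [logRadius]
  linarith

theorem logRadius_pos (ω : ℕ → Fin 3) (k : ℕ) : 0 < logRadius ω k := by
  have h := three_le_total_weightsAt ω k
  have h1 := Real.log_pos (by linarith : (1 : ℝ) < total (weightsAt ω k))
  have h2 := Real.log_pos (by norm_num : (1 : ℝ) < 2)
  simp only [logRadius]
  positivity

theorem weightsAt_congr {ψ ω : ℕ → Fin 3} {q : ℕ} (h : ∀ k < q, ψ k = ω k) :
    weightsAt ψ q = weightsAt ω q := by
  induction q with
  | zero => rfl
  | succ q ih =>
    change weightStep (weightsAt ψ q) (ψ q) = weightStep (weightsAt ω q) (ω q)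
    rw [ih fun k hk => h k (by omega), h q (by omega)]

theorem logRadius_congr {ψ ω : ℕ → Fin 3} {q : ℕ} (h : ∀ k < q, ψ k = ω k) :
    logRadius ψ q = logRadius ω q := by
  rw [logRadius, weightsAt_congr h, logRadius]

/-- The sequence has rate of growth `ζ`, up to bounded errors. -/
def HasRate (ω : ℕ → Fin 3) (ζ : ℝ) : Prop :=
  ∃ C, ∀ k : ℕ, |k * Real.log 2 - ζ * logRadius ω k| ≤ C

/-- The rate `θ = log 2 * (1 / ζ - 1)` solves `log 2 = ζ * (log 2 + θ)`; `θ ≥ 0` means `ζ ≤ 1`, and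
`θ ≤ -log η` means `ζ ≥ α₀`. -/
theorem hasRate_rateSeq {η ζ : ℝ} (hη0 : 0 < η) (hη : η ^ 3 + η ^ 2 + η - 2 = 0)
    (hζ0 : 0 < ζ) (h0 : Real.log 2 / (Real.log 2 - Real.log η) ≤ ζ) (hζ : ζ ≤ 1) :
    HasRate (rateSeq (Real.log 2 * (1 / ζ - 1))) ζ := by
  have hlog2 := Real.log_pos (by norm_num : (1 : ℝ) < 2)
  have hη1 : η < 1 := by
    by_contra hcon
    nlinarith
  have hlogη : Real.log η < 0 := Real.log_neg hη0 hη1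
  have h1 : 1 ≤ 1 / ζ := by rw [le_div_iff₀ hζ0]; linarith
  have hle : Real.log 2 * (1 / ζ - 1) ≤ -Real.log η := by
    rw [div_le_iff₀ (by linarith)] at h0
    have : Real.log 2 * (1 / ζ - 1) = Real.log 2 / ζ - Real.log 2 := by ring
    rw [this, sub_le_iff_le_add, div_le_iff₀ hζ0]
    linarith
  obtain ⟨C, hC⟩ := exists_abs_log_total_rateSeq_sub_le hη0 hη
    (mul_nonneg hlog2.le (by linarith)) hle
  refine ⟨C, fun k => ?_⟩
  have e : (k : ℝ) * Real.log 2 - ζ * logRadius (rateSeq (Real.log 2 * (1 / ζ - 1))) k =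
      -(ζ * (Real.log (total (weightsAt (rateSeq (Real.log 2 * (1 / ζ - 1))) k)) -
        k * (Real.log 2 * (1 / ζ - 1)))) := by
    rw [logRadius]
    field_simp
    ring
  rw [e, abs_neg, abs_mul, abs_of_pos hζ0]
  exact (mul_le_of_le_one_left (abs_nonneg _) hζ).trans (hC k)

/-- Along a common part with a sequence of rate `ζ`, a sequence has rate of growth `ζ`. -/
theorem HasRate.exists_abs_sub_le {ω : ℕ → Fin 3} {ζ : ℝ} (h : HasRate ω ζ) (hω : IsBlockSeq ω)
    (hζ0 : 0 < ζ) :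
    ∃ C, ∀ ψ, IsBlockSeq ψ → ∀ p q : ℕ, p ≤ q → (∀ k, p ≤ k → k < q → ψ k = ω k) →
      |(q * Real.log 2 - p * Real.log 2) - ζ * (logRadius ψ q - logRadius ψ p)| ≤ C := by
  obtain ⟨C, hC⟩ := h
  refine ⟨2 * C + ζ * Real.log 20, fun ψ hψ p q hpq hag => ?_⟩
  have h1 := abs_le.1 (abs_log_total_sub_le hψ hω hpq hag)
  have h2 := abs_le.1 (hC p)
  have h3 := abs_le.1 (hC q)
  have h4 := mul_le_mul_of_nonneg_left h1.1 hζ0.le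
  have h5 := mul_le_mul_of_nonneg_left h1.2 hζ0.le
  simp only [logRadius] at h2 h3 ⊢
  rw [abs_le]
  constructor <;> nlinarith

theorem tendsto_div_of_abs_sub_le {ι : Type*} {F : Filter ι} {a b : ι → ℝ} {ζ C : ℝ}
    (hb : Tendsto b F atTop) (h : ∀ᶠ n in F, |a n - ζ * b n| ≤ C) :
    Tendsto (fun n => a n / b n) F (𝓝 ζ) := by
  rw [← tendsto_sub_nhds_zero_iff]
  refine squeeze_zero_norm' ?_ (hb.const_div_atTop C)
  filter_upwards [h, hb.eventually_gt_atTop 0] with n hn hn0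
  rw [Real.norm_eq_abs, show a n / b n - ζ = (a n - ζ * b n) / b n by field_simp, abs_div,
    abs_of_pos hn0]
  gcongr

/-! ### The growth of `Γ_ω` in the coordinates `log r` and `log log b(r)` -/

section Gamma

variable {F : Type*} [Group F] [Finite F] [Nontrivial F]

/-- The growth of `Γ_ω` in terms of levels. -/
theorem exists_abs_log_log_growth_sub_le' {ω : ℕ → Fin 3} (hω : IsBlockSeq ω)
    {S : Set (GammaGroup F ω)} (hS : IsGeneratingSet S) :
    ∃ C : ℝ, ∀ k r : ℕ, 2 ≤ r → logRadius ω k ≤ Real.log r → Real.log r ≤ logRadius ω (k + 1) →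
      |Real.log (Real.log (growth S r)) - k * Real.log 2| ≤ C := by
  obtain ⟨C, hC⟩ := exists_abs_log_log_growth_sub_le (fun k => hω.total_le k) hS
  refine ⟨C, fun k r hr h1 h2 => (hC k r ?_ ?_).2⟩
  · rwa [Real.le_log_iff_exp_le (by positivity), exp_logRadius] at h1
  · rwa [Real.log_le_iff_le_exp (by positivity), exp_logRadius] at h2

theorem hasLogGrowthExponent_of_hasRate {ω : ℕ → Fin 3} (hω : IsBlockSeq ω) {ζ : ℝ}
    (hζ0 : 0 < ζ) (h : HasRate ω ζ) : HasLogGrowthExponent (GammaGroup F ω) ζ := by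
  refine ⟨gammaGroup_fg ω, fun S hS => ?_⟩
  obtain ⟨C, hC⟩ := exists_abs_log_log_growth_sub_le' hω hS
  obtain ⟨C', hC'⟩ := h
  have hlog : Tendsto (fun x : ℕ => Real.log x) atTop atTop :=
    Real.tendsto_log_atTop.comp tendsto_natCast_atTop_atTop
  refine tendsto_div_of_abs_sub_le (C := C + C' + ζ * Real.log 3) hlog ?_
  filter_upwards [hlog.eventually_ge_atTop (logRadius ω 0), eventually_ge_atTop 2] with r hr hr2
  obtain ⟨k, -, hk1, hk2⟩ := exists_le_and_lt_succ (tendsto_logRadius ω) hr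
  have h1 := abs_le.1 (hC k r hr2 hk1 hk2.le)
  have h2 := abs_le.1 (hC' k)
  have h3 := logRadius_succ_le ω k
  have h4 : ζ * Real.log r ≤ ζ * (logRadius ω k + Real.log 3) :=
    mul_le_mul_of_nonneg_left (by linarith) hζ0.le
  have h5 : ζ * logRadius ω k ≤ ζ * Real.log r := mul_le_mul_of_nonneg_left hk1 hζ0.le
  have h6 : 0 ≤ ζ * Real.log 3 := mul_nonneg hζ0.le (Real.log_nonneg (by norm_num))
  rw [abs_le]
  constructor <;> linarith

end Gamma

/-! ### Splicing -/

/-- Greedy splicing: follow `tail j` up to the first admissible position where the goal `Q j` is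
reached, then pass to `tail (j + 1)`. By `hQ` later letters cannot spoil a goal; switching at
multiples of `3` preserves the blocks. The last clause records minimality. -/
theorem exists_spliced {tail : ℕ → ℕ → Fin 3} (htail : ∀ j, IsBlockSeq (tail j))
    {Q : ℕ → (ℕ → Fin 3) → ℕ → Prop}
    (hex : ∀ j ψ p, IsBlockSeq ψ → (∀ k, p ≤ k → ψ k = tail j k) →
      ∃ q, p + 3 ≤ q ∧ 3 ∣ q ∧ Q j ψ q)
    (hQ : ∀ j ψ ψ' q, (∀ k < q, ψ k = ψ' k) → Q j ψ q → Q j ψ' q) :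
    ∃ (Ω : ℕ → Fin 3) (p : ℕ → ℕ), IsBlockSeq Ω ∧ (∀ j, p j + 3 ≤ p (j + 1)) ∧ 3 ≤ p 0 ∧
      (∀ j, 3 ∣ p j) ∧ (∀ k < p 0, Ω k = tail 0 k) ∧
      (∀ j k, p j ≤ k → k < p (j + 1) → Ω k = tail (j + 1) k) ∧ (∀ j, Q j Ω (p j)) ∧
      ∀ j q, p j + 3 ≤ q → q < p (j + 1) → 3 ∣ q → ¬ Q (j + 1) Ω q := by
  classical
  let nextPos : ℕ → (ℕ → Fin 3) → ℕ → ℕ := fun j ψ p => sInf {q | p + 3 ≤ q ∧ 3 ∣ q ∧ Q j ψ q}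
  -- `D j` consists of the sequence in use before switch `j` and of the position of the previous
  -- switch (`0` at the start), so `p j` is stored in `D (j + 1)`. The result is the diagonal of
  -- these sequences.
  let D : ℕ → (ℕ → Fin 3) × ℕ := fun j => Nat.rec (tail 0, 0) (fun j s =>
    (fun k => if k < nextPos j s.1 s.2 then s.1 k else tail (j + 1) k, nextPos j s.1 s.2)) j
  set ψ : ℕ → ℕ → Fin 3 := fun j => (D j).1 with hψ
  set p : ℕ → ℕ := fun j => (D (j + 1)).2 with hp
  have hψ0 : ψ 0 = tail 0 := rfl
  have hpD : ∀ j, p j = nextPos j (ψ j) (D j).2 := fun j => rfl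
  have hψs : ∀ j k, ψ (j + 1) k = if k < p j then ψ j k else tail (j + 1) k := fun j k => rfl
  have hinv : ∀ j, IsBlockSeq (ψ j) ∧ 3 ∣ (D j).2 ∧ ∀ k, (D j).2 ≤ k → ψ j k = tail j k := by
    intro j
    induction j with
    | zero => exact ⟨htail 0, dvd_zero 3, fun k _ => rfl⟩
    | succ j ih =>
      obtain ⟨h1, h2, h3⟩ := ih
      have hmem : p j ∈ {q | (D j).2 + 3 ≤ q ∧ 3 ∣ q ∧ Q j (ψ j) q} := Nat.sInf_mem (hex j _ _ h1 h3)
      obtain ⟨n, hn⟩ := hmem.2.1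
      refine ⟨fun i => ?_, ⟨n, hn⟩, fun k hk => ?_⟩
      · rw [hψs, hψs, hψs]
        rcases lt_or_ge i n with hi | hi
        · rw [if_pos (by omega), if_pos (by omega), if_pos (by omega)]
          exact h1 i
        · rw [if_neg (by omega), if_neg (by omega), if_neg (by omega)]
          exact htail (j + 1) i
      · rw [hψs, if_neg (not_lt.2 hk)]
  have hmem : ∀ j, p j ∈ {q | (D j).2 + 3 ≤ q ∧ 3 ∣ q ∧ Q j (ψ j) q} := fun j =>
    Nat.sInf_mem (hex j _ _ (hinv j).1 (hinv j).2.2)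
  have hstep : ∀ j, p j + 3 ≤ p (j + 1) := fun j => (hmem (j + 1)).1
  have hp0 : 3 ≤ p 0 := (hmem 0).1
  have hmono : StrictMono p := strictMono_nat_of_lt_succ fun j => by have := hstep j; omega
  have hlt : ∀ k, k < p k := fun k => by
    induction k with
    | zero => omega
    | succ k ih => have := hstep k; omega
  have hagree : ∀ j d k, k < p j → ψ (j + d) k = ψ j k := by
    intro j d k hk
    induction d with
    | zero => rfl
    | succ d ih =>
      rw [← add_assoc, hψs, if_pos (lt_of_lt_of_le hk (hmono.monotone (by omega))), ih]
  have hΩ : ∀ j k, k < p j → ψ k k = ψ j k := by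
    intro j k hk
    rcases le_total j k with h | h
    · obtain ⟨d, hd⟩ := Nat.exists_eq_add_of_le h
      have := hagree j d k hk
      rwa [← hd] at this
    · obtain ⟨d, hd⟩ := Nat.exists_eq_add_of_le h
      have := hagree k d k (hlt k)
      rw [← hd] at this
      exact this.symm
  refine ⟨fun k => ψ k k, p, fun i => ?_, hstep, hp0, fun j => (hmem j).2.1, fun k hk => ?_,
    fun j k h1 h2 => ?_, fun j => ?_, fun j q h1 h2 h3 hcon => ?_⟩
  · have h := (hinv (3 * i + 2)).1 i
    have := hlt (3 * i + 2)
    simp only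
    rwa [hΩ (3 * i + 2) (3 * i) (by omega), hΩ (3 * i + 2) (3 * i + 1) (by omega)]
  · simp only
    rw [hΩ 0 k hk, hψ0]
  · simp only
    rw [hΩ (j + 1) k h2, hψs, if_neg (not_lt.2 h1)]
  · exact hQ j (ψ j) _ _ (fun k hk => (hΩ j k hk).symm) (hmem j).2.2
  · have h4 : Q (j + 1) (ψ (j + 1)) q :=
      hQ _ _ _ _ (fun k hk => hΩ (j + 1) k (hk.trans h2)) hcon
    have h5 : p (j + 1) ≤ q := Nat.sInf_le ⟨h1, h3, h4⟩
    omega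

/-- Following `ω` drives the ratio to `ζ` whatever the beginning was; this ensures that each goal of
the splicing is reached. -/
theorem HasRate.tendsto_div {ω ψ : ℕ → Fin 3} {ζ : ℝ} (h : HasRate ω ζ) (hω : IsBlockSeq ω)
    (hψ : IsBlockSeq ψ) (hζ0 : 0 < ζ) {p : ℕ} (hp : ∀ k, p ≤ k → ψ k = ω k) :
    Tendsto (fun q : ℕ => q * Real.log 2 / logRadius ψ q) atTop (𝓝 ζ) := by
  obtain ⟨C, hC⟩ := h.exists_abs_sub_le hω hζ0
  refine tendsto_div_of_abs_sub_le (C := C + |p * Real.log 2 - ζ * logRadius ψ p|)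
    (tendsto_logRadius ψ) ?_
  filter_upwards [eventually_ge_atTop p] with q hq
  have h1 := hC ψ hψ p q hq fun k hk _ => hp k hk
  refine le_trans (le_of_eq_of_le ?_ (abs_add_le _ _)) (add_le_add_left h1 _)
  congr 1
  ring

/-- `p j` is the first position of a new stretch, whereas `splice` is given the last positions of
stretches; hence the `- 1`. -/
theorem eq_splice {D G Ω : ℕ → Fin 3} {p : ℕ → ℕ} (hmono : Monotone p)
    (htop : Tendsto p atTop atTop) (hp : 1 ≤ p 0)
    (h0 : ∀ k < p 0, Ω k = D k) (hG : ∀ i k, p (2 * i) ≤ k → k < p (2 * i + 1) → Ω k = G k)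
    (hD : ∀ i k, p (2 * i + 1) ≤ k → k < p (2 * i + 2) → Ω k = D k) :
    Ω = splice D G (fun i => p (2 * i) - 1) (fun i => p (2 * i + 1) - 1) := by
  have hpos : ∀ j, 1 ≤ p j := fun j => hp.trans (hmono (Nat.zero_le j))
  funext k
  rw [splice]
  split_ifs with h
  · obtain ⟨i, h1, h2⟩ := h
    have := hpos (2 * i)
    have := hpos (2 * i + 1)
    exact hG i k (by omega) (by omega)
  · rcases lt_or_ge k (p 0) with hk | hk
    · exact h0 k hk
    · obtain ⟨j, hj1, hj2⟩ : ∃ j, p j ≤ k ∧ k < p (j + 1) := by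
        obtain ⟨j, -, h1, h2⟩ := exists_le_and_lt_succ (x := fun j => (p j : ℝ)) (t := (k : ℝ))
          (n := 0) (tendsto_natCast_atTop_atTop.comp htop) (by exact_mod_cast hk)
        exact ⟨j, by exact_mod_cast h1, by exact_mod_cast h2⟩
      rcases Nat.even_or_odd' j with ⟨i, rfl | rfl⟩
      · refine absurd ⟨i, ?_, ?_⟩ h
        · have := hpos (2 * i)
          omega
        · omega
      · exact hD i k hj1 hj2

/-- Two sequences of rates `δ` and `γ` can be spliced in such a way that the resulting rate
oscillates between `α` and `β`. -/
theorem exists_splice {D G : ℕ → Fin 3} {α β γ δ : ℝ} (hD : IsBlockSeq D) (hG : IsBlockSeq G)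
    (hDδ : HasRate D δ) (hGγ : HasRate G γ) (hδ : 0 < δ) (hδα : δ ≤ α) (hαβ : α < β)
    (hβγ : β ≤ γ) :
    ∃ p : ℕ → ℕ, 3 ≤ p 0 ∧ (∀ j, p j + 3 ≤ p (j + 1)) ∧
      ∃ Ω, Ω = splice D G (fun i => p (2 * i) - 1) (fun i => p (2 * i + 1) - 1) ∧ IsBlockSeq Ω ∧
      (∀ i k, p (2 * i) ≤ k → k < p (2 * i + 1) → Ω k = G k) ∧
      (∀ i k, p (2 * i + 1) ≤ k → k < p (2 * i + 2) → Ω k = D k) ∧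
      Tendsto (fun i => p (2 * i) * Real.log 2 / logRadius Ω (p (2 * i))) atTop (𝓝 α) ∧
      Tendsto (fun i => p (2 * i + 1) * Real.log 2 / logRadius Ω (p (2 * i + 1))) atTop (𝓝 β) := by
  -- The slack is needed when `δ = α` or `γ = β`, where the ratio may approach the target without
  -- reaching it. The bound `(β - α) / 4` keeps the two kinds of goals incompatible.
  set e : ℕ → ℝ := fun j => (β - α) / 4 / (j + 1) with he
  have hepos : ∀ j, 0 < e j := fun j => div_pos (by linarith) (by positivity)
  have hele : ∀ j, e j ≤ (β - α) / 4 := fun j =>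
    div_le_self (by linarith) (by have : (0 : ℝ) ≤ j := by positivity
                                  linarith)
  have hetend : Tendsto e atTop (𝓝 0) :=
    (tendsto_const_nhds (x := (β - α) / 4)).div_atTop
      (tendsto_atTop_add_const_right _ 1 tendsto_natCast_atTop_atTop)
  set tail : ℕ → ℕ → Fin 3 := fun j => if Even j then D else G with htail
  have heven : ∀ i, Even (2 * i) := fun i => even_two_mul i
  have hodd : ∀ i, ¬ Even (2 * i + 1) := fun i => Nat.not_even_iff_odd.2 ⟨i, rfl⟩
  set Q : ℕ → (ℕ → Fin 3) → ℕ → Prop := fun j ψ q =>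
    if Even j then q * Real.log 2 / logRadius ψ q ≤ α + e j
    else β - e j ≤ q * Real.log 2 / logRadius ψ q with hQdef
  have hlog2 := Real.log_pos (by norm_num : (1 : ℝ) < 2)
  have hblock : ∀ j, IsBlockSeq (tail j) := fun j => by
    simp only [htail]
    split_ifs <;> assumption
  have hex : ∀ j ψ p, IsBlockSeq ψ → (∀ k, p ≤ k → ψ k = tail j k) →
      ∃ q, p + 3 ≤ q ∧ 3 ∣ q ∧ Q j ψ q := by
    intro j ψ p hψ hp
    have hev : ∀ᶠ q in atTop, Q j ψ q := by
      by_cases hj : Even j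
      · simp only [htail, hj, if_true] at hp
        simp only [hQdef, hj, if_true]
        filter_upwards [(hDδ.tendsto_div hD hψ hδ hp).eventually_lt_const
          (show δ < α + e j by linarith [hepos j])] with q hq using hq.le
      · simp only [htail, hj, if_false] at hp
        simp only [hQdef, hj, if_false]
        filter_upwards [(hGγ.tendsto_div hG hψ (by linarith) hp).eventually_const_lt
          (show β - e j < γ by linarith [hepos j])] with q hq using hq.le
    obtain ⟨N, hN⟩ := eventually_atTop.1 hev
    exact ⟨3 * (N + p + 1), by omega, dvd_mul_right _ _, hN _ (by omega)⟩
  have hQ : ∀ j ψ ψ' q, (∀ k < q, ψ k = ψ' k) → Q j ψ q → Q j ψ' q := by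
    intro j ψ ψ' q h hq
    simp only [hQdef] at hq ⊢
    rwa [← logRadius_congr h]
  obtain ⟨Ω, p, hΩ, hstep, hp0, hdvd, h0, hseg, hQp, hmin⟩ := exists_spliced hblock hex hQ
  have hmono : StrictMono p := strictMono_nat_of_lt_succ fun j => by have := hstep j; omega
  have htop : Tendsto p atTop atTop := hmono.tendsto_atTop
  have hsegG : ∀ i k, p (2 * i) ≤ k → k < p (2 * i + 1) → Ω k = G k := fun i k h1 h2 => by
    have := hseg (2 * i) k h1 h2
    simp only [htail] at this
    rwa [if_neg (hodd i)] at this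
  have hsegD : ∀ i k, p (2 * i + 1) ≤ k → k < p (2 * i + 2) → Ω k = D k := fun i k h1 h2 => by
    have := hseg (2 * i + 1) k h1 h2
    simp only [htail] at this
    rwa [if_pos (show Even (2 * i + 1 + 1) from heven (i + 1))] at this
  -- One block earlier the goal is not yet reached: by minimality, or, if that position is `p j`,
  -- because the opposite goal holds there.
  have hprev : ∀ j, ¬ Q (j + 1) Ω (p (j + 1) - 3) := by
    intro j hcon
    obtain ⟨m, hm⟩ := hdvd j
    obtain ⟨n, hn⟩ := hdvd (j + 1)
    have hs := hstep j
    rcases eq_or_lt_of_le hs with h | h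
    · rw [← h, Nat.add_sub_cancel] at hcon
      have h1 := hQp j
      by_cases hj : Even j
      · have hj' : ¬ Even (j + 1) := by rw [Nat.even_add_one]; exact not_not.2 hj
        simp only [hQdef, hj, hj', if_true, if_false] at h1 hcon
        linarith [hele j, hele (j + 1)]
      · have hj' : Even (j + 1) := Nat.even_add_one.2 hj
        simp only [hQdef, hj, hj', if_true, if_false] at h1 hcon
        linarith [hele j, hele (j + 1)]
    · exact hmin j (p (j + 1) - 3) (by omega) (by omega) ⟨n - 1, by omega⟩ hcon
  have hrad : ∀ j, logRadius Ω (p j - 3) ≤ logRadius Ω (p j) ∧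
      logRadius Ω (p j) ≤ logRadius Ω (p j - 3) + 3 * Real.log 3 ∧
      ((p j - 3 : ℕ) : ℝ) = p j - 3 := by
    intro j
    have h3 : 3 ≤ p j := hp0.trans (hmono.monotone (Nat.zero_le j))
    obtain ⟨q, hq⟩ := Nat.exists_eq_add_of_le' h3
    refine ⟨(logRadius_strictMono Ω).monotone (by omega), ?_, by push_cast [Nat.cast_sub h3]; ring⟩
    rw [hq, Nat.add_sub_cancel]
    linarith [logRadius_succ_le Ω q, logRadius_succ_le Ω (q + 1), logRadius_succ_le Ω (q + 2)]
  have hx : Tendsto (fun j => logRadius Ω (p j)) atTop atTop := (tendsto_logRadius Ω).comp htop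
  have htwo : Tendsto (fun i : ℕ => 2 * i) atTop atTop :=
    tendsto_atTop_mono (fun i => by dsimp only [id]; omega) tendsto_id
  have htwo' : Tendsto (fun i : ℕ => 2 * i + 1) atTop atTop :=
    tendsto_atTop_mono (fun i => by dsimp only [id]; omega) tendsto_id
  refine ⟨p, hp0, hstep, Ω, eq_splice hmono.monotone htop (by omega) ?_ hsegG hsegD, hΩ, hsegG,
    hsegD, ?_, ?_⟩
  · intro k hk
    have := h0 k hk
    simp only [htail] at this
    rwa [if_pos Even.zero] at this
  -- At `p (2 * i) - 3` the ratio is still above `α + e (2 * i)`, and three letters add at most `3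
  -- log 3` to `logRadius`.
  · have hlow : Tendsto (fun i => (α + e (2 * i)) * (1 - 3 * Real.log 3 / logRadius Ω (p (2 * i))))
        atTop (𝓝 α) := by
      have h1 := ((hetend.comp htwo).const_add α).mul
        (((hx.comp htwo).const_div_atTop (3 * Real.log 3)).const_sub 1)
      simpa using h1
    have hupp : Tendsto (fun i => α + e (2 * i)) atTop (𝓝 α) := by
      simpa using (hetend.comp htwo).const_add α
    refine tendsto_of_tendsto_of_tendsto_of_le_of_le' hlow hupp ?_ ?_
    · filter_upwards [eventually_ge_atTop 1] with i hi
      obtain ⟨i, rfl⟩ := Nat.exists_eq_add_of_le' hi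
      have h1 := hprev (2 * i + 1)
      rw [show 2 * i + 1 + 1 = 2 * (i + 1) by ring] at h1
      simp only [hQdef, heven, if_true, not_le] at h1
      obtain ⟨h2, h3, h4⟩ := hrad (2 * (i + 1))
      have h5 := logRadius_pos Ω (p (2 * (i + 1)) - 3)
      have h6 := logRadius_pos Ω (p (2 * (i + 1)))
      rw [lt_div_iff₀ h5, h4] at h1
      rw [le_div_iff₀ h6, mul_assoc, sub_mul, one_mul, div_mul_cancel₀ _ h6.ne']
      have h7 : (α + e (2 * (i + 1))) * (logRadius Ω (p (2 * (i + 1))) - 3 * Real.log 3) ≤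
          (α + e (2 * (i + 1))) * logRadius Ω (p (2 * (i + 1)) - 3) :=
        mul_le_mul_of_nonneg_left (by linarith) (by linarith [hepos (2 * (i + 1))])
      linarith
    · filter_upwards with i
      have h1 := hQp (2 * i)
      simpa only [hQdef, heven, if_true] using h1
  · have hlow : Tendsto (fun i => β - e (2 * i + 1)) atTop (𝓝 β) := by
      simpa using (hetend.comp htwo').const_sub β
    have hupp : Tendsto (fun i => β + 3 * Real.log 2 / logRadius Ω (p (2 * i + 1)))
        atTop (𝓝 β) := by
      simpa using ((hx.comp htwo').const_div_atTop (3 * Real.log 2)).const_add β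
    refine tendsto_of_tendsto_of_tendsto_of_le_of_le' hlow hupp ?_ ?_
    · filter_upwards with i
      have h1 := hQp (2 * i + 1)
      simpa only [hQdef, hodd, if_false] using h1
    · filter_upwards with i
      have h1 := hprev (2 * i)
      simp only [hQdef, hodd, if_false, not_le] at h1
      obtain ⟨h2, h3, h4⟩ := hrad (2 * i + 1)
      have h5 := logRadius_pos Ω (p (2 * i + 1) - 3)
      have h6 := logRadius_pos Ω (p (2 * i + 1))
      rw [div_lt_iff₀ h5, h4] at h1
      rw [div_le_iff₀ h6, add_mul, div_mul_cancel₀ _ h6.ne']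
      have h7 : (β - e (2 * i + 1)) * logRadius Ω (p (2 * i + 1) - 3) ≤
          β * logRadius Ω (p (2 * i + 1)) :=
        mul_le_mul (by linarith [hepos (2 * i + 1)]) h2 h5.le (by linarith)
      linarith

/-! ### The growth of the spliced group as a zigzag, and its pseudo-periods -/

section Gamma

variable {F : Type*} [Group F] [Finite F] [Nontrivial F]

/-- If the rate of `Ω` is `γ` and `δ` on alternating intervals, then the growth of `Γ_Ω` is a
zigzag function. -/
theorem exists_isZigzag {D G Ω : ℕ → Fin 3} {α β γ δ : ℝ} (hD : IsBlockSeq D) (hG : IsBlockSeq G)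
    (hDδ : HasRate D δ) (hGγ : HasRate G γ) (hδ : 0 < δ) (hγ : 0 < γ) (hΩ : IsBlockSeq Ω)
    {p : ℕ → ℕ} (hp : StrictMono p)
    (hsegG : ∀ i k, p (2 * i) ≤ k → k < p (2 * i + 1) → Ω k = G k)
    (hsegD : ∀ i k, p (2 * i + 1) ≤ k → k < p (2 * i + 2) → Ω k = D k)
    (hlow : Tendsto (fun i => p (2 * i) * Real.log 2 / logRadius Ω (p (2 * i))) atTop (𝓝 α))
    (hhigh : Tendsto (fun i => p (2 * i + 1) * Real.log 2 / logRadius Ω (p (2 * i + 1))) atTop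
      (𝓝 β))
    {S : Set (GammaGroup F Ω)} (hS : IsGeneratingSet S) :
    ∃ C, IsZigzag (fun r => Real.log (Real.log (growth S r)) / Real.log r) α β γ δ C
        (fun j => logRadius Ω (p j)) (fun j => p j * Real.log 2) ∧
      IsZigzag (fun r => -(Real.log (Real.log (growth S r)) / Real.log r)) (-β) (-α) (-δ) (-γ) C
        (fun j => logRadius Ω (p (j + 1))) (fun j => -(p (j + 1) * Real.log 2)) := by
  obtain ⟨C₀, hC₀⟩ := exists_abs_log_log_growth_sub_le' hΩ hS
  obtain ⟨C₁, hC₁⟩ := hGγ.exists_abs_sub_le hG hγ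
  obtain ⟨C₂, hC₂⟩ := hDδ.exists_abs_sub_le hD hδ
  have hlog3 : 0 < Real.log 3 := Real.log_pos (by norm_num)
  have hC₀' : 0 ≤ C₀ := by
    obtain ⟨r, hr, h1, h2⟩ := exists_log_mem_Icc (le_max_right (logRadius Ω 0) 1)
    obtain ⟨k, -, hk1, hk2⟩ := exists_le_and_lt_succ (tendsto_logRadius Ω)
      (t := Real.log r) ((le_max_left _ _).trans h1)
    exact (abs_nonneg _).trans (hC₀ k r hr hk1 hk2.le)
  have hC₁' : 0 ≤ C₁ := (abs_nonneg _).trans (hC₁ G hG 0 0 le_rfl fun _ _ _ => rfl)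
  have hC₂' : 0 ≤ C₂ := (abs_nonneg _).trans (hC₂ D hD 0 0 le_rfl fun _ _ _ => rfl)
  have hseg : ∀ {ζ C : ℝ} {j : ℕ}, 0 < ζ → (∀ k, p j ≤ k → k ≤ p (j + 1) →
      |(k * Real.log 2 - p j * Real.log 2) - ζ * (logRadius Ω k - logRadius Ω (p j))| ≤ C) →
      ∀ r : ℕ, 2 ≤ r → logRadius Ω (p j) ≤ Real.log r → Real.log r ≤ logRadius Ω (p (j + 1)) →
      |Real.log (Real.log (growth S r)) / Real.log r * Real.log r -
        (p j * Real.log 2 + ζ * (Real.log r - logRadius Ω (p j)))| ≤ C₀ + C + ζ * Real.log 3 := by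
    intro ζ C j hζ hC r hr h1 h2
    have hr0 : 0 < Real.log r := Real.log_pos (by exact_mod_cast hr)
    obtain ⟨k, hk, hk1, hk2⟩ := exists_le_and_lt_succ (tendsto_logRadius Ω) h1
    have hk' : k ≤ p (j + 1) := (logRadius_strictMono Ω).le_iff_le.1 (hk1.trans h2)
    have h3 := abs_le.1 (hC₀ k r hr hk1 hk2.le)
    have h4 := abs_le.1 (hC k hk hk')
    have h5 := logRadius_succ_le Ω k
    have h6 := mul_le_mul_of_nonneg_left hk1 hζ.le
    have h7 : ζ * Real.log r ≤ ζ * (logRadius Ω k + Real.log 3) :=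
      mul_le_mul_of_nonneg_left (by linarith) hζ.le
    rw [div_mul_cancel₀ _ hr0.ne', abs_le]
    constructor <;> nlinarith
  have hGseg : ∀ i k, p (2 * i) ≤ k → k ≤ p (2 * i + 1) → |(k * Real.log 2 - p (2 * i) * Real.log 2)
      - γ * (logRadius Ω k - logRadius Ω (p (2 * i)))| ≤ C₁ := fun i k h1 h2 =>
    hC₁ Ω hΩ _ _ h1 fun k' h3 h4 => hsegG i k' h3 (by omega)
  have hDseg : ∀ i k, p (2 * i + 1) ≤ k → k ≤ p (2 * i + 2) →
      |(k * Real.log 2 - p (2 * i + 1) * Real.log 2)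
      - δ * (logRadius Ω k - logRadius Ω (p (2 * i + 1)))| ≤ C₂ := fun i k h1 h2 =>
    hC₂ Ω hΩ _ _ h1 fun k' h3 h4 => hsegD i k' h3 (by omega)
  set K := C₀ + C₁ + C₂ + γ * Real.log 3 + δ * Real.log 3 with hK
  have hγ3 : 0 ≤ γ * Real.log 3 := by positivity
  have hδ3 : 0 ≤ δ * Real.log 3 := by positivity
  have htop : Tendsto (fun j => logRadius Ω (p j)) atTop atTop :=
    (tendsto_logRadius Ω).comp hp.tendsto_atTop
  have hrise := fun i => hseg hγ (hGseg i)
  have hfall := fun i => hseg hδ (hDseg i)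
  -- The second zigzag is the first one reflected. Its corners are shifted by one index, so that the
  -- stretches along `D` become its rising lines.
  refine ⟨K, ⟨htop, fun i r hr h1 h2 => (hrise i r hr h1 h2).trans (by linarith),
    fun i r hr h1 h2 => (hfall i r hr h1 h2).trans (by linarith), fun i => ?_, hlow, hhigh⟩,
    ⟨htop.comp (tendsto_add_atTop_nat 1),
      fun i r hr h1 h2 => ?_, fun i r hr h1 h2 => ?_, fun i => ?_, ?_, ?_⟩⟩
  · refine le_trans (le_of_eq ?_) ((hGseg i (p (2 * i + 1)) (hp.monotone (by omega)) le_rfl).trans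
      (by linarith))
    congr 1
    ring
  · refine le_trans (le_of_eq ?_) ((hfall i r hr h1 h2).trans (by linarith))
    rw [← abs_neg]
    congr 1
    ring
  · refine le_trans (le_of_eq ?_) ((hrise (i + 1) r hr h1 h2).trans (by linarith))
    rw [← abs_neg]
    congr 1
    rw [show 2 * (i + 1) = 2 * i + 1 + 1 by ring]
    ring
  · refine le_trans (le_of_eq ?_) ((hDseg i (p (2 * i + 2)) (hp.monotone (by omega)) le_rfl).trans
      (by linarith))
    rw [← abs_neg]
    congr 1
    ring
  · simpa only [neg_div] using hhigh.neg
  · have := (hlow.comp (tendsto_add_atTop_nat 1)).neg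
    simpa only [neg_div, Function.comp_def, mul_add, mul_one] using this

theorem hasPseudoPeriodExponents_of_isZigzag {Ω : ℕ → Fin 3} {α β γ δ : ℝ} (hδα : δ ≤ α)
    (hαβ : α < β) (hβγ : β ≤ γ) {x y x' y' : ℕ → ℝ}
    (h : ∀ S : Set (GammaGroup F Ω), IsGeneratingSet S → ∃ C,
      IsZigzag (fun r => Real.log (Real.log (growth S r)) / Real.log r) α β γ δ C x y ∧
      IsZigzag (fun r => -(Real.log (Real.log (growth S r)) / Real.log r)) (-β) (-α) (-δ) (-γ) C
        x' y') :
    HasPseudoPeriodExponents (GammaGroup F Ω) α β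
      (ENNReal.ofReal (γ - α) / ENNReal.ofReal (γ - β))
      (ENNReal.ofReal (β - δ) / ENNReal.ofReal (α - δ)) := by
  refine ⟨gammaGroup_fg Ω, fun S hS => ?_⟩
  obtain ⟨C, h1, h2⟩ := h S hS
  have hfst : Tendsto (fun p : ℝ × ℝ => p.1) (𝓝[>] α ×ˢ 𝓝[<] β) (𝓝 α) :=
    (tendsto_id.mono_left nhdsWithin_le_nhds).comp tendsto_fst
  have hsnd : Tendsto (fun p : ℝ × ℝ => p.2) (𝓝[>] α ×ˢ 𝓝[<] β) (𝓝 β) :=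
    (tendsto_id.mono_left nhdsWithin_le_nhds).comp tendsto_snd
  refine ⟨fun α' β' hα hαβ' hβ => ⟨?_, ?_⟩, ?_, ?_⟩
  · refine Set.infinite_of_forall_exists_gt fun M => ?_
    obtain ⟨r, q, hr, hp⟩ := h1.exists_passage hβγ hα hαβ' hβ (M + 1)
    exact ⟨r, hp.left_mem, by omega⟩
  · refine Set.infinite_of_forall_exists_gt fun M => ?_
    obtain ⟨r, q, hr, hp⟩ := h1.exists_passage hβγ hα hαβ' hβ (M + 1)
    exact ⟨q, hp.right_mem, by have := hp.lt; omega⟩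
  · refine tendsto_ofReal_div hαβ (hfst.const_sub γ) (hsnd.const_sub γ) (by linarith)
      fun p hp1 hp2 hp3 => ⟨by linarith, ?_⟩
    exact h1.passageExponent_eq hβγ hδα hp1 hp2 hp3
  · refine tendsto_ofReal_div hαβ (hsnd.sub_const δ) (hfst.sub_const δ) (by linarith)
      fun p hp1 hp2 hp3 => ⟨by linarith, ?_⟩
    -- Negation turns the upper radii at `p.2` into the lower set at `-p.2` and the lower radii at
    -- `p.1` into the upper set at `-p.1`.
    have := h2.passageExponent_eq (a' := -p.2) (b' := -p.1) (by linarith) (by linarith)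
      (by linarith) (by linarith) (by linarith)
    simp only [neg_le_neg_iff] at this
    rw [show (-δ - -p.2) / (-δ - -p.1) = (p.2 - δ) / (p.1 - δ) by congr 1 <;> ring] at this
    exact this

end Gamma

theorem ofReal_div_le_inv {x y : ℝ} (hx : x ≤ 1) :
    ENNReal.ofReal x / ENNReal.ofReal y ≤ (ENNReal.ofReal y)⁻¹ := by
  rw [div_eq_mul_inv]
  exact mul_le_of_le_one_left' (ENNReal.ofReal_le_one.2 hx)

theorem mainTheorem3 {F : Type*} [Group F] [Finite F] [Nontrivial F]
    (η α₀ : ℝ) (hη : η ^ 3 + η ^ 2 + η - 2 = 0)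
    (hα₀ : α₀ = Real.log 2 / (Real.log 2 - Real.log η)) :
    ∃ ω : ℝ → ℕ → Fin 3,
      (∀ ζ : ℝ, α₀ ≤ ζ → ζ ≤ 1 → HasLogGrowthExponent (GammaGroup F (ω ζ)) ζ) ∧
      ∀ α β γ δ : ℝ, α₀ ≤ δ → δ ≤ α → α < β → β ≤ γ → γ ≤ 1 →
        ∃ m n : ℕ → ℕ, (∀ i, m i < n i ∧ n i < m (i + 1)) ∧
          ∃ u l : ℝ≥0∞,
            HasPseudoPeriodExponents (GammaGroup F (splice (ω δ) (ω γ) m n)) α β u l ∧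
            u ≤ (ENNReal.ofReal (γ - β))⁻¹ ∧ l ≤ (ENNReal.ofReal (α - δ))⁻¹ := by
  have hη0 : 0 < η := by
    by_contra hcon
    nlinarith [sq_nonneg η, sq_nonneg (η + 1)]
  have hη1 : η < 1 := by
    by_contra hcon
    nlinarith
  have hα0 : 0 < α₀ := by
    have := Real.log_neg hη0 hη1
    rw [hα₀]
    exact div_pos (Real.log_pos (by norm_num)) (by linarith [Real.log_pos (by norm_num : (1 : ℝ) < 2)])
  have hrate : ∀ ζ, α₀ ≤ ζ → ζ ≤ 1 → HasRate (rateSeq (Real.log 2 * (1 / ζ - 1))) ζ :=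
    fun ζ h0 h1 => hasRate_rateSeq hη0 hη (by linarith) (hα₀ ▸ h0) h1
  refine ⟨fun ζ => rateSeq (Real.log 2 * (1 / ζ - 1)), fun ζ h0 h1 =>
    hasLogGrowthExponent_of_hasRate (isBlockSeq_rateSeq _) (by linarith) (hrate ζ h0 h1),
    fun α β γ δ h1 h2 h3 h4 h5 => ?_⟩
  have hDδ := hrate δ h1 (by linarith)
  have hGγ := hrate γ (by linarith) h5
  obtain ⟨p, hp0, hstep, Ω, hΩeq, hΩ, hG, hD, hlow, hhigh⟩ :=
    exists_splice (isBlockSeq_rateSeq _) (isBlockSeq_rateSeq _) hDδ hGγ (by linarith) h2 h3 h4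
  have hmono : StrictMono p := strictMono_nat_of_lt_succ fun j => by have := hstep j; omega
  refine ⟨fun i => p (2 * i) - 1, fun i => p (2 * i + 1) - 1, fun i => ?_,
    ENNReal.ofReal (γ - α) / ENNReal.ofReal (γ - β),
    ENNReal.ofReal (β - δ) / ENNReal.ofReal (α - δ), ?_,
    ofReal_div_le_inv (by linarith), ofReal_div_le_inv (by linarith)⟩
  · have a1 := hstep (2 * i)
    have a2 := hstep (2 * i + 1)
    have a3 : p 0 ≤ p (2 * i) := hmono.monotone (Nat.zero_le _)
    simp only [show 2 * (i + 1) = 2 * i + 1 + 1 by ring]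
    omega
  · have key := hasPseudoPeriodExponents_of_isZigzag h2 h3 h4 fun S hS =>
      exists_isZigzag (F := F) (isBlockSeq_rateSeq _) (isBlockSeq_rateSeq _) hDδ hGγ (by linarith)
        (by linarith) hΩ hmono hG hD hlow hhigh hS
    rw [hΩeq] at key
    exact key
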